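/- Let $\mathfrak h\neq\{0\}$ be a complex Hilbert space with a conjugation (antiunitary involution) $u\mapsto\bar u$, let $\epsilon\ge m>0$ be a selfadjoint operator on $\mathfrak h$ that is real, i.e. $\overline{\epsilon u}=\epsilon\bar u$, and let $\beta>0$, $\mu\in\mathbb R$ with $|\mu|<m$. Let $X=\mathfrak h\oplus\mathfrak h$ with elements $x=(x^+,x^-)$, and put $h=\epsilon\oplus\epsilon$, $q=1\oplus(-1)$, $a=h-\mu q$, $\rho=(e^{\beta a}-1)^{-1}$, $\kappa(x^+,x^-)=(\overline{x^-},\overline{x^+})$, $X_\kappa=\{x\in X:\kappa x=x\}$. Let $\overline X$ be the conjugate Hilbert space of $X$ and let $\Gamma(X\oplus\overline X)$ be the bosonic Fock space with vacuum $\Omega$ and Weyl operators $W_F(\cdot)$, normalized by $W_F(f)W_F(g)=e^{-\frac i2\operatorname{Im}(f,g)}W_F(f+g)$ and $(\Omega,W_F(f)\Omega)=e^{-\|f\|^2/4}$. Put $$W_\omega(x)=W_F\bigl((1+\rho)^{1/2}x\oplus\bar\rho^{1/2}\bar x\bigr)\ (x\in X),\qquad L=d\Gamma(a\oplus-\bar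 a),\qquad Q=d\Gamma(q\oplus-\bar q),$$ $$\tau_t(B)=e^{itL}Be^{-itL},\qquad \omega_{\beta,\mu}(B)=(\Omega,B\Omega),$$ so that $\omega_{\beta,\mu}(W_\omega(x))=e^{-\frac14(x,(1+2\rho)x)}$ and $\tau_t(W_\omega(x))=W_\omega(e^{ita}x)$. Let $\mathcal F$ and $\mathcal U$ be the von Neumann algebras generated by $\{W_\omega(x):x\in X\}$ and by $\{W_\omega(x):x\in X_\kappa\}$, and let $\mathcal A=\{B\in\mathcal F: e^{itQ}Be^{-itQ}=B\text{ for all }t\in\mathbb R\}$ and $\mathcal A_\kappa=\mathcal A\cap\mathcal U$ be their gauge-invariant parts. A system $(\mathcal M,\mathcal N,\tau,\omega)$ of von Neumann algebras $\mathcal N\subset\mathcal M$ with $\mathcal N$ abelian, a dynamics $\tau$ and a $(\tau,\beta)$-KMS state $\omega$ is called *stochastically positive* if (i) $\mathcal M$ is the von Neumann algebra generated by $\bigcup_{t\in\mathbb R}\tau_t(\mathcal N)$, and (ii) for all $n$, all positive $A_1,\dots,A_n\in\mathcal N$ and all $s_1\le\dots\le s_n$ with $s_n-s_1\le\beta$,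 the Euclidean Green's function $G(is_1,\dots,is_n)$ is a nonnegative real number, where $G$ is the continuation of $(t_1,\dots,t_n)\mapsto\omega(\tau_{t_1}(A_1)\cdots\tau_{t_n}(A_n))$ from $\mathbb R^n$ to a function that is holomorphic on $\{z\in\mathbb C^n:\operatorname{Im}z_1<\dots<\operatorname{Im}z_n,\ \operatorname{Im}z_n-\operatorname{Im}z_1<\beta\}$ and continuous on its closure. If $\mu\ne0$, then neither the KMS system $(\mathcal F,\mathcal U,\tau,\omega_{\beta,\mu})$ of the charged Klein–Gordon field nor its gauge-invariant restriction $(\mathcal A,\mathcal A_\kappa,\tau,\omega_{\beta,\mu})$ is stochastically positive. -/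

import Mathlib

open scoped ComplexOrder InnerProductSpace

noncomputable section

namespace KleinGordon

/-- The conjugate Hilbert space `Ē` of `E`: the same additive group, with `c • x̄ = \overline{c̄ x}`
and `⟪x̄, ȳ⟫ = ⟪y, x⟫`. -/
def ConjSpace (E : Type*) : Type _ := E

namespace ConjSpace
variable {E : Type*} [NormedAddCommGroup E] [InnerProductSpace ℂ E]

instance : NormedAddCommGroup (ConjSpace E) := inferInstanceAs (NormedAddCommGroup E)
instance [CompleteSpace E] : CompleteSpace (ConjSpace E) := inferInstanceAs (CompleteSpace E)
instance : Module ℂ (ConjSpace E) := Module.compHom E (starRingEnd ℂ)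

/-- The identity map `x ↦ x̄` from `E` to `Ē`, which is antilinear. -/
def bar : E ≃+ ConjSpace E := AddEquiv.refl E

theorem smul_bar (c : ℂ) (x : E) : c • bar x = bar (star c • x) := rfl

instance : InnerProductSpace ℂ (ConjSpace E) where
  norm_smul_le c x := by
    have h : ‖star c • bar.symm x‖ ≤ ‖c‖ * ‖bar.symm x‖ := by rw [norm_smul, norm_star]
    exact h
  inner x y := inner ℂ (bar.symm y) (bar.symm x)
  norm_sq_eq_re_inner x := norm_sq_eq_re_inner (𝕜 := ℂ) (E := E) x
  conj_inner_symm x y := inner_conj_symm (𝕜 := ℂ) (E := E) _ _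
  add_left x y z := inner_add_right (𝕜 := ℂ) (E := E) _ _ _
  smul_left x y c := inner_smul_right (𝕜 := ℂ) (E := E) _ _ _

/-- The bounded operator `Ā x̄ = \overline{A x}`. -/
def mapCLM (A : E →L[ℂ] E) : ConjSpace E →L[ℂ] ConjSpace E where
  toFun x := bar (A (bar.symm x))
  map_add' x y := by simp
  map_smul' c x := by
    change bar (A (star c • bar.symm x)) = star c • A (bar.symm x)
    rw [map_smul]; rfl
  cont := A.continuous

end ConjSpace

section Fock

theorem posSemidef_gram' (K : Type*) {L : Type*} [NormedAddCommGroup L] [InnerProductSpace ℂ L] (f : K → L) :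
    (Matrix.of fun x y : K => (inner ℂ (f x) (f y) : ℂ)).PosSemidef := by
  refine ⟨by ext; simp, fun v => ?_⟩
  have h : (v.sum fun i xi => v.sum fun j xj =>
      star xi * (Matrix.of fun x y : K => (inner ℂ (f x) (f y) : ℂ)) i j * xj)
      = inner ℂ (v.sum fun i xi => xi • f i) (v.sum fun i xi => xi • f i) := by
    simp only [Finsupp.sum, sum_inner]
    refine Finset.sum_congr rfl fun i _ => ?_
    rw [inner_sum]
    refine Finset.sum_congr rfl fun j _ => ?_
    rw [inner_smul_left, inner_smul_right, Matrix.of_apply, RCLike.star_def]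
    ring
  rw [h]
  exact RCLike.nonneg_iff.2 ⟨inner_self_nonneg, inner_self_im _⟩

variable (K : Type*) [NormedAddCommGroup K] [InnerProductSpace ℂ K]

theorem posSemidef_inner_pow (n : ℕ) :
    (Matrix.of fun x y : K => (inner ℂ x y : ℂ) ^ n).PosSemidef := by
  induction n with
  | zero =>
    have h : (Matrix.of fun x y : K => (inner ℂ x y : ℂ) ^ 0)
        = Matrix.of fun x y : K => (inner ℂ (1 : ℂ) (1 : ℂ) : ℂ) := by
      ext; simp
    rw [h]; exact posSemidef_gram' K fun _ => (1 : ℂ)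
  | succ n ih =>
    have h : (Matrix.of fun x y : K => (inner ℂ x y : ℂ) ^ (n + 1))
        = (Matrix.of fun x y : K => (inner ℂ x y : ℂ) ^ n).hadamard
          (Matrix.of fun x y : K => (inner ℂ x y : ℂ)) := by
      ext; simp [pow_succ]
    rw [h]; exact ih.hadamard (posSemidef_gram' K id)

theorem posSemidef_exp_inner :
    (Matrix.of fun x y : K => Complex.exp (inner ℂ x y)).PosSemidef := by
  refine ⟨?_, fun v => ?_⟩
  · ext x y
    simp [← Complex.exp_conj]
  · have hs : HasSum (fun n : ℕ => (n.factorial : ℂ)⁻¹ *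
        v.sum fun i xi => v.sum fun j xj => star xi * (inner ℂ i j : ℂ) ^ n * xj)
        (v.sum fun i xi => v.sum fun j xj => star xi * Complex.exp (inner ℂ i j) * xj) := by
      simp only [Finsupp.sum, Finset.mul_sum]
      refine hasSum_sum fun i _ => hasSum_sum fun j _ => ?_
      have := (NormedSpace.exp_series_hasSum_exp' (𝕂 := ℂ) (𝔸 := ℂ) (inner ℂ i j : ℂ))
      rw [← Complex.exp_eq_exp_ℂ] at this
      have h3 := (this.mul_left (star (v i))).mul_right (v j)
      refine h3.congr_fun fun n => ?_
      simp only [smul_eq_mul]; ring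
    refine hs.nonneg fun n => ?_
    have h1 := (posSemidef_inner_pow K n).2 v
    have h2 : (0 : ℂ) ≤ (n.factorial : ℂ)⁻¹ := by
      rw [← Complex.ofReal_natCast, ← Complex.ofReal_inv]
      exact Complex.zero_le_real.2 (by positivity)
    exact mul_nonneg h2 h1

/-- The positive semidefinite kernel `(x, y) ↦ e^{⟪x, y⟫}` on `K`. -/
def expKernel : Matrix K K (ℂ →L[ℂ] ℂ) :=
  Matrix.of fun x y => Complex.exp (inner ℂ x y) • ContinuousLinearMap.id ℂ ℂ

instance : Fact (expKernel K).PosSemidef := ⟨by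
  have hT := (RKHS.posSemidef_tfae (K := expKernel K)).out 0 2
  refine hT.2 ⟨?_, fun v => ?_⟩
  · ext x y
    simp [expKernel, Matrix.conjTranspose_apply, ContinuousLinearMap.star_eq_adjoint,
      ← Complex.exp_conj, ContinuousLinearMap.adjoint_id]
  · have h2 := (Complex.le_def.1 ((posSemidef_exp_inner K).2 v)).1
    have h3 : (v.sum fun x w => v.sum fun x' w' => (inner ℂ (expKernel K x' x w) w' : ℂ))
        = v.sum fun i xi => v.sum fun j xj =>
          star xi * (Matrix.of fun x y : K => Complex.exp (inner ℂ x y)) i j * xj := by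
      refine Finset.sum_congr rfl fun i _ => Finset.sum_congr rfl fun j _ => ?_
      simp [expKernel, ← Complex.exp_conj]
      ring
    rw [h3]
    exact h2⟩

/-- The bosonic Fock space `Γ(K) = ⨁ₙ ⊗ₛⁿ K`, realized through its total family of exponential
(coherent) vectors `e(g) = ⨁ₙ (n!)^{-1/2} g^{⊗ n}`: it is the Hilbert space generated by vectors
`e(g)`, `g ∈ K`, with `⟪e(g), e(g')⟫ = e^{⟪g, g'⟫}`. -/
abbrev Fock : Type _ := RKHS.OfKernel (expKernel K)

variable {K}

/-- The exponential vector `e(g)`; `e(0)` is the Fock vacuum. -/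
def expVec (g : K) : Fock K := RKHS.kerFun (Fock K) g 1

theorem inner_expVec (g g' : K) :
    (inner ℂ (expVec g) (expVec g') : ℂ) = Complex.exp (inner ℂ g g') := by
  unfold expVec
  rw [← RKHS.kernel_inner, RKHS.OfKernel.kernel_ofKernel]
  simp [expKernel, ← Complex.exp_conj]

/-- The linear map `∑ c_g δ_g ↦ ∑ c_g e(g)`, which has dense range. -/
def expSum : (K →₀ ℂ) →ₗ[ℂ] Fock K := Finsupp.linearCombination ℂ expVec

theorem denseRange_expSum : DenseRange (expSum : (K →₀ ℂ) → Fock K) := by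
  have h := RKHS.kerFun_dense (𝕜 := ℂ) (X := K) (V := ℂ) (H := Fock K)
  have h2 : (Set.range (expSum : (K →₀ ℂ) → Fock K)) =
      (Submodule.span ℂ {RKHS.kerFun (Fock K) x v | (x) (v)} : Set (Fock K)) := by
    have h3 : Submodule.span ℂ {RKHS.kerFun (Fock K) x v | (x) (v)} =
        LinearMap.range (expSum : (K →₀ ℂ) →ₗ[ℂ] Fock K) := by
      rw [expSum, Finsupp.range_linearCombination]
      apply le_antisymm
      · rw [Submodule.span_le]
        rintro _ ⟨x, v, rfl⟩
        have : RKHS.kerFun (Fock K) x v = v • expVec x := by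
          rw [expVec, ← map_smul]; simp
        rw [this]
        exact Submodule.smul_mem _ _ (Submodule.subset_span ⟨x, rfl⟩)
      · refine Submodule.span_mono ?_
        rintro _ ⟨x, rfl⟩
        exact ⟨x, 1, rfl⟩
    rw [h3]; rfl
  unfold DenseRange
  rw [h2]
  exact (Submodule.dense_iff_topologicalClosure_eq_top).2 h

/-- The bounded operator on `Γ(K)` determined by `e(g) ↦ c(g) e(φ(g))` (see `expOp_expVec`; the value
is irrelevant if there is no such operator). -/
def expOp (c : K → ℂ) (φ : K → K) : Fock K →L[ℂ] Fock K :=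
  (Finsupp.linearCombination ℂ fun g => c g • expVec (φ g)).extendOfNorm expSum

theorem expOp_expVec {c : K → ℂ} {φ : K → K}
    (h : ∀ g g', star (c g) * c g' * Complex.exp (inner ℂ (φ g) (φ g'))
      = Complex.exp (inner ℂ g g')) (g : K) :
    expOp c φ (expVec g) = c g • expVec (φ g) := by
  have key : ∀ v : K →₀ ℂ,
      ‖Finsupp.linearCombination ℂ (fun g => c g • expVec (φ g)) v‖ ≤ 1 * ‖expSum v‖ := by
    intro v
    have : (inner ℂ (Finsupp.linearCombination ℂ (fun g => c g • expVec (φ g)) v)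
        (Finsupp.linearCombination ℂ (fun g => c g • expVec (φ g)) v) : ℂ)
        = inner ℂ (expSum v) (expSum v) := by
      simp only [expSum, Finsupp.linearCombination_apply, Finsupp.sum, sum_inner]
      refine Finset.sum_congr rfl fun i _ => ?_
      rw [inner_sum, inner_sum]
      refine Finset.sum_congr rfl fun j _ => ?_
      simp only [inner_smul_left, inner_smul_right, inner_expVec]
      rw [← h i j, RCLike.star_def]; ring
    rw [one_mul, ← sq_le_sq₀ (norm_nonneg _) (norm_nonneg _),
      norm_sq_eq_re_inner (𝕜 := ℂ), norm_sq_eq_re_inner (𝕜 := ℂ), this]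
  have := LinearMap.extendOfNorm_eq (f := Finsupp.linearCombination ℂ fun g => c g • expVec (φ g))
    (e := expSum) denseRange_expSum ⟨1, key⟩ (Finsupp.single g 1)
  simpa [expSum, expOp] using this

/-- The Fock space Weyl operator `W_F(h) = e^{i φ_F(h)}`, `φ_F(h) = (a*(h) + a(h)) / √2`, through its
action on exponential vectors (`a(h) e(g) = ⟪h, g⟫ e(g)`, `e^{a*(h)} e(g) = e(g + h)`):
`W_F(h) e(g) = e^{-‖h‖²/4 + (i/√2) ⟪h, g⟫} e(g + (i/√2) h)`. -/
def fockWeyl (h : K) : Fock K →L[ℂ] Fock K :=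
  expOp (fun g => Complex.exp (-(‖h‖ ^ 2 / 4 : ℝ) + Complex.I / √2 * inner ℂ h g))
    (fun g => g + (Complex.I / √2 : ℂ) • h)

theorem fockWeyl_expVec (h g : K) : fockWeyl h (expVec g) =
    Complex.exp (-(‖h‖ ^ 2 / 4 : ℝ) + Complex.I / √2 * inner ℂ h g) •
      expVec (g + (Complex.I / √2 : ℂ) • h) := by
  refine expOp_expVec (fun g g' => ?_) g
  have h2 : ((√2 : ℝ) : ℂ) ^ 2 = 2 := by
    rw [← Complex.ofReal_pow, Real.sq_sqrt (by norm_num)]; norm_num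
  have h0 : ((√2 : ℝ) : ℂ) ≠ 0 := by
    intro h; rw [h] at h2; norm_num at h2
  rw [RCLike.star_def, ← Complex.exp_conj, ← Complex.exp_add, ← Complex.exp_add]
  congr 1
  simp only [inner_add_left, inner_add_right, inner_smul_left, inner_smul_right, map_add, map_neg,
    map_mul, map_div₀, Complex.conj_I, Complex.conj_ofReal, inner_conj_symm,
    inner_self_eq_norm_sq_to_K]
  push_cast
  field_simp
  simp only [Complex.coe_algebraMap]
  ring_nf
  rw [h2, Complex.I_sq]
  ring

/-- The second quantization `Γ(V)` of an isometry `V` of `K`: `Γ(V) e(g) = e(V g)`.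
In particular `Γ(e^{itb}) = e^{it dΓ(b)}` for a selfadjoint operator `b` on `K`. -/
def secondQuant (V : K →L[ℂ] K) : Fock K →L[ℂ] Fock K := expOp (fun _ => 1) V

theorem secondQuant_expVec {V : K →L[ℂ] K}
    (hV : ∀ x y, (inner ℂ (V x) (V y) : ℂ) = inner ℂ x y) (g : K) :
    secondQuant V (expVec g) = expVec (V g) := by
  simpa [secondQuant] using expOp_expVec (c := fun _ => 1) (φ := V) (by simp [hV]) g

end Fock
section FC
variable {E : Type*} [NormedAddCommGroup E] [InnerProductSpace ℂ E]
  {A : E →ₗ.[ℂ] E} {m : ℝ}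

theorem norm_le_of_lowerBound
    (hAm : ∀ x : A.domain, m * ‖(x : E)‖ ^ 2 ≤ (inner ℂ (x : E) (A x)).re) (x : A.domain) :
    m * ‖(x : E)‖ ≤ ‖A x‖ := by
  have h1 := hAm x
  have h2 : (inner ℂ (x : E) (A x)).re ≤ ‖(x : E)‖ * ‖A x‖ :=
    (Complex.re_le_norm _).trans (norm_inner_le_norm _ _)
  rcases eq_or_ne ‖(x : E)‖ 0 with h0 | h0
  · rw [h0]; simp
  · have h3 : 0 < ‖(x : E)‖ := lt_of_le_of_ne (norm_nonneg _) (Ne.symm h0)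
    nlinarith

theorem injective_of_lowerBound (hm : 0 < m)
    (hAm : ∀ x : A.domain, m * ‖(x : E)‖ ^ 2 ≤ (inner ℂ (x : E) (A x)).re) (x x' : A.domain)
    (h : A x = A x') : x = x' := by
  have h1 := norm_le_of_lowerBound hAm (x - x')
  rw [LinearPMap.map_sub, h, sub_self, norm_zero] at h1
  have h2 : ‖((x - x' : A.domain) : E)‖ = 0 :=
    le_antisymm (by by_contra h; push Not at h; nlinarith [mul_pos hm h]) (norm_nonneg _)
  exact sub_eq_zero.1 (Subtype.ext (norm_eq_zero.1 h2))

variable [CompleteSpace E]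

open Classical in
/-- The bounded everywhere defined inverse `A⁻¹` of an unbounded operator `A`. It exists if `A` is
selfadjoint and `A ≥ m > 0` (see `boundedInverse_spec`); otherwise the value is irrelevant. -/
def boundedInverse (A : E →ₗ.[ℂ] E) : E →L[ℂ] E :=
  if h : ∃ T : E →L[ℂ] E, ∀ y, ∃ hy : T y ∈ A.domain, A ⟨T y, hy⟩ = y then h.choose else 0

/-- The functional calculus `f(A)` of a selfadjoint operator `A ≥ m > 0` for a function `f` that is
continuous and bounded on `[m, ∞)`: the bounded operator with
`f(A) A⁻¹ = (λ ↦ λ f(1/λ))(A⁻¹)` on the dense range of `A⁻¹` (see `boundedFC_boundedInverse`), the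
right side being the continuous functional calculus of the bounded operator `A⁻¹`. -/
def boundedFC (A : E →ₗ.[ℂ] E) (f : ℝ → ℂ) : E →L[ℂ] E :=
  (cfc (fun z : ℂ => z * f (z.re)⁻¹) (boundedInverse A)).toLinearMap.extendOfNorm
    (boundedInverse A).toLinearMap

theorem exists_boundedInverse (hA : IsSelfAdjoint A) (hm : 0 < m)
    (hAm : ∀ x : A.domain, m * ‖(x : E)‖ ^ 2 ≤ (inner ℂ (x : E) (A x)).re) :
    ∃ T : E →L[ℂ] E, ∀ y, ∃ hy : T y ∈ A.domain, A ⟨T y, hy⟩ = y := by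
  have hlow := norm_le_of_lowerBound hAm
  have hdense := hA.dense_domain
  have hclosed : A.IsClosed := hA.isClosed
  set R : Submodule ℂ E := LinearMap.range A.toFun with hR
  have hRc : IsClosed (R : Set E) := by
    rw [← isSeqClosed_iff_isClosed]
    intro y y0 hy hy0
    choose x hx using hy
    have hc : CauchySeq (fun n => (x n : E)) := by
      rw [Metric.cauchySeq_iff]
      intro e he
      obtain ⟨N, hN⟩ := Metric.cauchySeq_iff.1 hy0.cauchySeq (m * e) (by positivity)
      refine ⟨N, fun a ha b hb => ?_⟩
      have h := hN a ha b hb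
      have h2 := hlow (x a - x b)
      rw [← hx a, ← hx b, dist_eq_norm, ← map_sub] at h
      rw [dist_eq_norm]
      have h3 : m * ‖(x a : E) - x b‖ < m * e := lt_of_le_of_lt h2 h
      exact lt_of_mul_lt_mul_left h3 hm.le
    obtain ⟨x0, hx0⟩ := cauchySeq_tendsto_of_complete hc
    have hg : (x0, y0) ∈ A.graph := by
      have : IsClosed (A.graph : Set (E × E)) := hclosed
      refine this.mem_of_tendsto (hx0.prodMk_nhds hy0) (Filter.Eventually.of_forall fun n => ?_)
      exact (A.mem_graph_iff).2 ⟨x n, rfl, hx n⟩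
    obtain ⟨z, -, hz⟩ := A.mem_graph_iff.1 hg
    exact ⟨z, hz⟩
  have hRtop : R = ⊤ := by
    have : CompleteSpace R := hRc.completeSpace_coe
    rw [← Submodule.orthogonal_eq_bot_iff, Submodule.eq_bot_iff]
    intro w hw
    have hw' : ∀ x : A.domain, (inner ℂ w (A x) : ℂ) = 0 := fun x =>
      Submodule.inner_left_of_mem_orthogonal (LinearMap.mem_range_self A.toFun x) hw
    have hwd : w ∈ A.adjoint.domain :=
      A.mem_adjoint_domain_of_exists w ⟨0, fun x => by rw [hw' x]; simp⟩
    have hA' : A.adjoint = A := hA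
    have hAw : A.adjoint ⟨w, hwd⟩ = 0 :=
      A.adjoint_apply_eq hdense ⟨w, hwd⟩ (fun x => by rw [hw' x]; simp)
    have hwd2 : w ∈ A.domain := hA' ▸ hwd
    have h0 : A ⟨w, hwd2⟩ = 0 := by
      have h : ∀ B : E →ₗ.[ℂ] E, B = A → ∀ hB : w ∈ B.domain, B ⟨w, hB⟩ = A ⟨w, hwd2⟩ := by
        rintro _ rfl _; rfl
      rw [← h _ hA' hwd, hAw]
    have h1 := hlow ⟨w, hwd2⟩
    rw [h0, norm_zero] at h1
    have h2 : ‖w‖ = 0 := le_antisymm (by by_contra h; push Not at h; nlinarith [mul_pos hm h]) (norm_nonneg _)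
    exact norm_eq_zero.1 h2
  have hsurj : ∀ y, ∃ x : A.domain, A x = y := fun y => by
    have : y ∈ R := hRtop ▸ Submodule.mem_top
    exact this
  have hinj := injective_of_lowerBound hm hAm
  choose S hS using hsurj
  let T0 : E →ₗ[ℂ] E :=
    { toFun := fun y => (S y : E)
      map_add' := fun y y' => by
        have := hinj (S (y + y')) (S y + S y') (by rw [LinearPMap.map_add, hS, hS, hS])
        exact congrArg Subtype.val this
      map_smul' := fun c y => by
        have := hinj (S (c • y)) (c • S y) (by rw [LinearPMap.map_smul, hS, hS])
        exact congrArg Subtype.val this }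
  refine ⟨T0.mkContinuous m⁻¹ fun y => ?_, fun y => ⟨(S y).2, hS y⟩⟩
  have h := hlow (S y)
  rw [hS] at h
  change ‖(S y : E)‖ ≤ _
  rw [inv_mul_eq_div, le_div_iff₀ hm, mul_comm]
  exact h

theorem boundedInverse_spec (hA : IsSelfAdjoint A) (hm : 0 < m)
    (hAm : ∀ x : A.domain, m * ‖(x : E)‖ ^ 2 ≤ (inner ℂ (x : E) (A x)).re) (y : E) :
    ∃ hy : boundedInverse A y ∈ A.domain, A ⟨boundedInverse A y, hy⟩ = y := by
  have h := exists_boundedInverse hA hm hAm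
  unfold boundedInverse
  rw [dif_pos h]
  exact h.choose_spec y

theorem boundedInverse_isPositive (hA : IsSelfAdjoint A) (hm : 0 < m)
    (hAm : ∀ x : A.domain, m * ‖(x : E)‖ ^ 2 ≤ (inner ℂ (x : E) (A x)).re) :
    (boundedInverse A).IsPositive := by
  have hA' : A.adjoint = A := hA
  have hf : A.IsFormalAdjoint A := by
    have := A.adjoint_isFormalAdjoint hA.dense_domain
    rwa [hA'] at this
  have hsym : (boundedInverse A).toLinearMap.IsSymmetric := by
    intro y y'
    obtain ⟨h, hy⟩ := boundedInverse_spec hA hm hAm y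
    obtain ⟨h', hy'⟩ := boundedInverse_spec hA hm hAm y'
    have := hf ⟨_, h'⟩ ⟨_, h⟩
    rw [hy, hy'] at this
    change (inner ℂ (boundedInverse A y) y' : ℂ) = inner ℂ y (boundedInverse A y')
    rw [← inner_conj_symm, this, inner_conj_symm]
  refine ⟨hsym, fun y => ?_⟩
  obtain ⟨h, hy⟩ := boundedInverse_spec hA hm hAm y
  have h2 := hAm ⟨_, h⟩
  rw [hy] at h2
  exact le_trans (by positivity) h2

theorem spectrum_boundedInverse (hA : IsSelfAdjoint A) (hm : 0 < m)
    (hAm : ∀ x : A.domain, m * ‖(x : E)‖ ^ 2 ≤ (inner ℂ (x : E) (A x)).re) {z : ℂ}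
    (hz : z ∈ spectrum ℂ (boundedInverse A)) : z.im = 0 ∧ 0 ≤ z.re ∧ z.re ≤ m⁻¹ := by
  have hpos := boundedInverse_isPositive hA hm hAm
  have h0 : (0 : ℂ) ≤ z := spectrum_nonneg_of_nonneg
    ((ContinuousLinearMap.nonneg_iff_isPositive _).2 hpos) hz
  obtain ⟨h1, h2⟩ := Complex.le_def.1 h0
  refine ⟨h2.symm, h1, ?_⟩
  have hn : ‖boundedInverse A‖ ≤ m⁻¹ := by
    refine ContinuousLinearMap.opNorm_le_bound _ (by positivity) fun y => ?_
    obtain ⟨h, hy⟩ := boundedInverse_spec hA hm hAm y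
    have h3 := hAm ⟨_, h⟩
    rw [hy] at h3
    have h4 : (inner ℂ (boundedInverse A y) y).re ≤ ‖boundedInverse A y‖ * ‖y‖ :=
      (Complex.re_le_norm _).trans (norm_inner_le_norm _ _)
    rw [inv_mul_eq_div, le_div_iff₀ hm]
    rcases eq_or_ne ‖boundedInverse A y‖ 0 with h0 | h0
    · rw [h0]; simp
    · have h5 : 0 < ‖boundedInverse A y‖ := lt_of_le_of_ne (norm_nonneg _) (Ne.symm h0)
      simp only at h3
      nlinarith
  rcases subsingleton_or_nontrivial E with hs | hs
  · have : Subsingleton (E →L[ℂ] E) := inferInstance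
    rw [spectrum.of_subsingleton] at hz
    exact absurd hz (Set.notMem_empty _)
  · exact (Complex.re_le_norm z).trans ((spectrum.norm_le_norm_of_mem hz).trans hn)

theorem boundedFC_boundedInverse (hA : IsSelfAdjoint A) (hm : 0 < m)
    (hAm : ∀ x : A.domain, m * ‖(x : E)‖ ^ 2 ≤ (inner ℂ (x : E) (A x)).re)
    {f : ℝ → ℂ} (hf : ContinuousOn f (Set.Ici m)) {C : ℝ} (hC : ∀ e, m ≤ e → ‖f e‖ ≤ C) (y : E) :
    boundedFC A f (boundedInverse A y)
      = cfc (fun z : ℂ => z * f (z.re)⁻¹) (boundedInverse A) y := by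
  set T := boundedInverse A with hT
  set g : ℂ → ℂ := fun z => z * f (z.re)⁻¹ with hg
  have hpos := boundedInverse_isPositive hA hm hAm
  have hsa : IsSelfAdjoint T := hpos.isSelfAdjoint
  have hC0 : 0 ≤ C := (norm_nonneg _).trans (hC m le_rfl)
  have hbd : ∀ z ∈ spectrum ℂ T, ‖g z‖ ≤ C * ‖z‖ := by
    intro z hz
    obtain ⟨h1, h2, h3⟩ := spectrum_boundedInverse hA hm hAm hz
    rcases h2.eq_or_lt with h0 | h0
    · have : z = 0 := Complex.ext h0.symm h1
      simp [hg, this]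
    · rw [hg]
      simp only [norm_mul]
      rw [mul_comm]
      refine mul_le_mul_of_nonneg_right (hC _ ?_) (norm_nonneg _)
      rwa [le_inv_comm₀ hm h0]
  have hcont : ContinuousOn g (spectrum ℂ T) := by
    intro z hz
    obtain ⟨h1, h2, h3⟩ := spectrum_boundedInverse hA hm hAm hz
    rcases h2.eq_or_lt with h0 | h0
    · have hz0 : z = 0 := Complex.ext h0.symm h1
      have hgz : g z = 0 := by simp [hg, hz0]
      rw [ContinuousWithinAt, hgz]
      refine squeeze_zero_norm' (a := fun z => C * ‖z‖) ?_ ?_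
      · filter_upwards [self_mem_nhdsWithin] with w hw using hbd w hw
      · have : Filter.Tendsto (fun w : ℂ => C * ‖w‖) (nhds z) (nhds (C * ‖z‖)) := by
          exact (continuous_const.mul continuous_norm).tendsto z
        rw [hz0, norm_zero, mul_zero, ← hz0] at this
        exact this.mono_left nhdsWithin_le_nhds
    · refine continuousWithinAt_id.mul ?_
      have hinv : ContinuousWithinAt (fun w : ℂ => (w.re)⁻¹) (spectrum ℂ T ∩ {w | 0 < w.re}) z :=
        (Complex.continuous_re.continuousAt.inv₀ h0.ne').continuousWithinAt
      have hmaps : Set.MapsTo (fun w : ℂ => (w.re)⁻¹) (spectrum ℂ T ∩ {w | 0 < w.re})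
          (Set.Ici m) := by
        rintro w ⟨hw, hw0⟩
        obtain ⟨-, -, h⟩ := spectrum_boundedInverse hA hm hAm hw
        exact (le_inv_comm₀ hm hw0).2 h
      have hcomp : ContinuousWithinAt (fun w : ℂ => f (w.re)⁻¹) (spectrum ℂ T ∩ {w | 0 < w.re}) z :=
        ContinuousWithinAt.comp (f := fun w : ℂ => (w.re)⁻¹) (hf _ (hmaps ⟨hz, h0⟩)) hinv hmaps
      refine (hcomp.mono_of_mem_nhdsWithin ?_)
      exact inter_mem_nhdsWithin _ ((isOpen_lt continuous_const Complex.continuous_re).mem_nhds h0)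
  have hkey : ∀ y, ‖cfc g T y‖ ≤ C * ‖T y‖ := by
    intro y
    have hnorm : IsStarNormal T := hsa.isStarNormal
    have hTid : cfc (fun z : ℂ => z) T = T := cfc_id' ℂ T
    have h1 : star (cfc g T) * cfc g T = cfc (fun z => star (g z) * g z) T := by
      rw [← cfc_star, ← cfc_mul _ _ T hcont.star hcont]
    have h2 : ((C : ℂ) ^ 2) • (star T * T) = cfc (fun z : ℂ => (C : ℂ) ^ 2 * (star z * z)) T := by
      rw [cfc_const_mul _ _ T, cfc_mul _ _ T, cfc_star, hTid]
    have h3 : star (cfc g T) * cfc g T ≤ ((C : ℂ) ^ 2) • (star T * T) := by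
      rw [h1, h2]
      refine cfc_mono (fun z hz => ?_) (hcont.star.mul hcont) (by fun_prop)
      have h4 := hbd z hz
      have h5 : ∀ w : ℂ, star w * w = ((‖w‖ ^ 2 : ℝ) : ℂ) := fun w => by
        rw [RCLike.star_def, Complex.conj_mul']; push_cast; rfl
      rw [h5, h5, ← Complex.ofReal_pow, ← Complex.ofReal_mul, ← mul_pow]
      exact Complex.real_le_real.2 (pow_le_pow_left₀ (norm_nonneg _) h4 2)
    have h6 := ((ContinuousLinearMap.le_def _ _).1 h3).2 y
    have h7 : ∀ S : E →L[ℂ] E, (inner ℂ ((star S * S) y) y : ℂ) = ((‖S y‖ ^ 2 : ℝ) : ℂ) := by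
      intro S
      change (inner ℂ (ContinuousLinearMap.adjoint S (S y)) y : ℂ) = _
      rw [ContinuousLinearMap.adjoint_inner_left, inner_self_eq_norm_sq_to_K]
      push_cast; rfl
    have h8 : (inner ℂ ((((C : ℂ) ^ 2) • (star T * T) - star (cfc g T) * cfc g T) y) y : ℂ)
        = ((C ^ 2 * ‖T y‖ ^ 2 - ‖cfc g T y‖ ^ 2 : ℝ) : ℂ) := by
      rw [sub_apply, inner_sub_left, smul_apply,
        inner_smul_left, h7, h7]
      simp
    have h9 : 0 ≤ C ^ 2 * ‖T y‖ ^ 2 - ‖cfc g T y‖ ^ 2 := by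
      have h10 : (inner ℂ ((((C : ℂ) ^ 2) • (star T * T) - star (cfc g T) * cfc g T) y) y : ℂ).re
        = C ^ 2 * ‖T y‖ ^ 2 - ‖cfc g T y‖ ^ 2 := by rw [h8, Complex.ofReal_re]
      rw [← h10]
      exact h6
    rw [← sq_le_sq₀ (norm_nonneg _) (by positivity), mul_pow]
    linarith
  have hdr : DenseRange (T : E → E) := by
    have hd := hA.dense_domain
    refine hd.mono fun x hx => ?_
    obtain ⟨h, hy⟩ := boundedInverse_spec hA hm hAm (A ⟨x, hx⟩)
    exact ⟨A ⟨x, hx⟩, congrArg Subtype.val (injective_of_lowerBound hm hAm _ _ hy)⟩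
  exact LinearMap.extendOfNorm_eq (f := (cfc g T).toLinearMap) (e := T.toLinearMap) hdr
    ⟨C, hkey⟩ y
end FC

section Model
variable {𝔥 : Type*} [NormedAddCommGroup 𝔥] [InnerProductSpace ℂ 𝔥] [CompleteSpace 𝔥]

/-- The operator `A ⊕ B` on the Hilbert space direct sum `E ⊕ F`. -/
def blockDiag {E F : Type*} [NormedAddCommGroup E] [InnerProductSpace ℂ E]
    [NormedAddCommGroup F] [InnerProductSpace ℂ F] (A : E →L[ℂ] E) (B : F →L[ℂ] F) :
    WithLp 2 (E × F) →L[ℂ] WithLp 2 (E × F) :=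
  ((WithLp.prodContinuousLinearEquiv 2 ℂ E F).symm : E × F →L[ℂ] WithLp 2 (E × F)) ∘L
    (A.prodMap B) ∘L
      (WithLp.prodContinuousLinearEquiv 2 ℂ E F : WithLp 2 (E × F) →L[ℂ] E × F)

/-- The one-particle space `X = 𝔥 ⊕ 𝔥`, with elements `x = (x⁺, x⁻)`. -/
abbrev OneParticle (𝔥 : Type*) : Type _ := WithLp 2 (𝔥 × 𝔥)

/-- The operator `f(a)` on `X`, where `a = h - μ q` with `h = ε ⊕ ε` and `q = 1 ⊕ (-1)`, that is
`a = (ε - μ) ⊕ (ε + μ)`. -/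
def energyFC (ε : 𝔥 →ₗ.[ℂ] 𝔥) (μ : ℝ) (f : ℝ → ℂ) : OneParticle 𝔥 →L[ℂ] OneParticle 𝔥 :=
  blockDiag (boundedFC ε fun e => f (e - μ)) (boundedFC ε fun e => f (e + μ))

/-- The Bose function `e ↦ (e^{β e} - 1)⁻¹`, so that `ρ = bose β (a)`. -/
def bose (β e : ℝ) : ℝ := (Real.exp (β * e) - 1)⁻¹

/-- The Araki-Woods one-particle space `X ⊕ X̄`. -/
abbrev Doubled (𝔥 : Type*) [NormedAddCommGroup 𝔥] [InnerProductSpace ℂ 𝔥] : Type _ :=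
  WithLp 2 (OneParticle 𝔥 × ConjSpace (OneParticle 𝔥))

/-- The Araki-Woods Hilbert space `H_ω = Γ(X ⊕ X̄)`. -/
abbrev ArakiWoods (𝔥 : Type*) [NormedAddCommGroup 𝔥] [InnerProductSpace ℂ 𝔥] : Type _ :=
  Fock (Doubled 𝔥)

/-- The Araki-Woods Weyl operator `W_ω(x) = W_F((1+ρ)^{1/2} x ⊕ ρ̄^{1/2} x̄)`. -/
def weyl (ε : 𝔥 →ₗ.[ℂ] 𝔥) (β μ : ℝ) (x : OneParticle 𝔥) : ArakiWoods 𝔥 →L[ℂ] ArakiWoods 𝔥 :=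
  fockWeyl (WithLp.toLp 2
    (energyFC ε μ (fun e => (√(1 + bose β e) : ℝ)) x,
      ConjSpace.bar (energyFC ε μ (fun e => (√(bose β e) : ℝ)) x)))

/-- The state `ω_{β,μ}`, i.e. `ω(B) = (Ω, B Ω)` for the Fock vacuum `Ω`. -/
def state (B : ArakiWoods 𝔥 →L[ℂ] ArakiWoods 𝔥) : ℂ :=
  inner ℂ (expVec (0 : Doubled 𝔥)) (B (expVec (0 : Doubled 𝔥)))

/-- For an isometry `V` of `X`, the operator `Γ(V ⊕ V̄)`. -/
def doubledQuant (V : OneParticle 𝔥 →L[ℂ] OneParticle 𝔥) : ArakiWoods 𝔥 →L[ℂ] ArakiWoods 𝔥 :=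
  secondQuant (blockDiag V (ConjSpace.mapCLM V))

/-- `e^{itL}`, `L = dΓ(a ⊕ -ā)`; note that `e^{-itā} x̄ = \overline{e^{ita} x}`. -/
def liouvilleGroup (ε : 𝔥 →ₗ.[ℂ] 𝔥) (μ t : ℝ) : ArakiWoods 𝔥 →L[ℂ] ArakiWoods 𝔥 :=
  doubledQuant (energyFC ε μ fun e => Complex.exp (Complex.I * t * e))

/-- The dynamics `τ_t(B) = e^{itL} B e^{-itL}`. -/
def dynamics (ε : 𝔥 →ₗ.[ℂ] 𝔥) (μ t : ℝ) (B : ArakiWoods 𝔥 →L[ℂ] ArakiWoods 𝔥) :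
    ArakiWoods 𝔥 →L[ℂ] ArakiWoods 𝔥 :=
  liouvilleGroup ε μ t * B * liouvilleGroup ε μ (-t)

variable (𝔥) in
/-- `e^{itQ}`, `Q = dΓ(q ⊕ -q̄)`, where `e^{itq} = e^{it} ⊕ e^{-it}` on `X`. -/
def gaugeGroup (t : ℝ) : ArakiWoods 𝔥 →L[ℂ] ArakiWoods 𝔥 :=
  doubledQuant (blockDiag (Complex.exp (Complex.I * t) • ContinuousLinearMap.id ℂ 𝔥)
    (Complex.exp (-(Complex.I * t)) • ContinuousLinearMap.id ℂ 𝔥))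

/-- The von Neumann algebra generated by a set of bounded operators: the double commutant of its
star-closure. -/
def vonNeumannSpan {H : Type*} [NormedAddCommGroup H] [InnerProductSpace ℂ H] [CompleteSpace H]
    (S : Set (H →L[ℂ] H)) : StarSubalgebra ℂ (H →L[ℂ] H) :=
  StarSubalgebra.centralizer ℂ (StarSubalgebra.centralizer ℂ S : Set (H →L[ℂ] H))

/-- The field algebra, generated by all `W_ω(x)`, `x ∈ X`. -/
def fieldAlgebra (ε : 𝔥 →ₗ.[ℂ] 𝔥) (β μ : ℝ) :
    StarSubalgebra ℂ (ArakiWoods 𝔥 →L[ℂ] ArakiWoods 𝔥) :=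
  vonNeumannSpan (Set.range (weyl ε β μ))

/-- The real subspace `X_κ = {x | κ x = x}` for `κ (x⁺, x⁻) = (\overline{x⁻}, \overline{x⁺})`, the
composition of time reversal and charge conjugation. -/
def realSubspace (conj : 𝔥 ≃ₗᵢ⋆[ℂ] 𝔥) : Set (OneParticle 𝔥) :=
  {x | WithLp.toLp 2 (conj x.snd, conj x.fst) = x}

/-- The abelian algebra of time-zero fields, generated by the `W_ω(x)`, `x ∈ X_κ`. -/
def timeZeroAlgebra (conj : 𝔥 ≃ₗᵢ⋆[ℂ] 𝔥) (ε : 𝔥 →ₗ.[ℂ] 𝔥) (β μ : ℝ) :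
    StarSubalgebra ℂ (ArakiWoods 𝔥 →L[ℂ] ArakiWoods 𝔥) :=
  vonNeumannSpan (weyl ε β μ '' realSubspace conj)

/-- The observable algebra: the elements `B` of the field algebra with `e^{itQ} B e^{-itQ} = B` for
all `t`, i.e. those that commute with all `e^{itQ}`. -/
def observableAlgebra (ε : 𝔥 →ₗ.[ℂ] 𝔥) (β μ : ℝ) :
    StarSubalgebra ℂ (ArakiWoods 𝔥 →L[ℂ] ArakiWoods 𝔥) :=
  fieldAlgebra ε β μ ⊓ StarSubalgebra.centralizer ℂ (Set.range (gaugeGroup 𝔥))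

/-- The abelian observable algebra: the gauge invariant time-zero observables. -/
def timeZeroObservables (conj : 𝔥 ≃ₗᵢ⋆[ℂ] 𝔥) (ε : 𝔥 →ₗ.[ℂ] 𝔥) (β μ : ℝ) :
    StarSubalgebra ℂ (ArakiWoods 𝔥 →L[ℂ] ArakiWoods 𝔥) :=
  observableAlgebra ε β μ ⊓ timeZeroAlgebra conj ε β μ

end Model

section StochasticPositivity
variable {H : Type*} [NormedAddCommGroup H] [InnerProductSpace ℂ H] [CompleteSpace H]

/-- The tube of all `z ∈ ℂⁿ` with `Im z₁ < ⋯ < Im zₙ` and `Im zₙ - Im z₁ < β`. -/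
def greenTube (β : ℝ) (n : ℕ) : Set (Fin n → ℂ) :=
  {z | (∀ i j, i < j → (z i).im < (z j).im) ∧ ∀ i j, (z j).im - (z i).im < β}

/-- `G` is the analytic continuation of the Green's function
`(t₁, …, tₙ) ↦ ω(τ_{t₁}(A₁) ⋯ τ_{tₙ}(Aₙ))`: it is holomorphic in the tube, continuous on its closure,
and has the Green's function as its values on `ℝⁿ`. This determines `G` on the closed tube. -/
structure IsGreenContinuation (β : ℝ) (τ : ℝ → (H →L[ℂ] H) → (H →L[ℂ] H)) (ω : (H →L[ℂ] H) → ℂ)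
    {n : ℕ} (A : Fin n → (H →L[ℂ] H)) (G : (Fin n → ℂ) → ℂ) : Prop where
  holomorphic : DifferentiableOn ℂ G (greenTube β n)
  continuous : ContinuousOn G (closure (greenTube β n))
  boundary : ∀ t : Fin n → ℝ,
    G (fun i => (t i : ℂ)) = ω (List.ofFn fun i => τ (t i) (A i)).prod

/-- Stochastic positivity of `(𝓕, 𝓤, τ, ω)` at inverse temperature `β`, for von Neumann algebras
`𝓤 ⊆ 𝓕`: the translates `τ_t(𝓤)` generate the von Neumann algebra `𝓕`, and the Euclidean Green's
functions `G(i s₁, …, i sₙ)` of positive elements of `𝓤` are nonnegative. -/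
structure IsStochasticallyPositive (𝓕 𝓤 : StarSubalgebra ℂ (H →L[ℂ] H))
    (τ : ℝ → (H →L[ℂ] H) → (H →L[ℂ] H)) (ω : (H →L[ℂ] H) → ℂ) (β : ℝ) : Prop where
  generates : vonNeumannSpan (⋃ t : ℝ, τ t '' (𝓤 : Set (H →L[ℂ] H))) = 𝓕
  green_nonneg : ∀ (n : ℕ) (A : Fin n → (H →L[ℂ] H)), (∀ i, A i ∈ 𝓤 ∧ (A i).IsPositive) →
    ∀ s : Fin n → ℝ, Monotone s → (∀ i j, s j - s i ≤ β) →
      ∀ G, IsGreenContinuation β τ ω A G → 0 ≤ G (fun i => Complex.I * s i)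

end StochasticPositivity

end KleinGordon

end

/-! Positivity is tested on averages of time-zero Weyl operators over gauge phases `θ` distributed
by a measure `ν` on the circle. If `ν` is symmetric under `θ ↦ -θ`, such an average is a selfadjoint
contraction `W`, so `W + 1` is positive. Stochastic positivity makes the Green's functions of
products of factors `W + 1` nonnegative, and expanding these products shows that the Euclidean
functions of the averages themselves are real (`euclideanThree_real`). At the points `0, iβ/4, iβ/2`
such a function is a positive constant times `∫ exp(-S/2)`, where `S` is a trigonometric polynomial
on the three-torus whose coefficients are pair correlations of the form `⟪u, P v⟫` and `⟪v, R u⟫`.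
For a gap `s` between the points, `P` is `(1 + ρ(ε-μ)) e^{-s(ε-μ)} + ρ(ε+μ) e^{s(ε+μ)}`
(`thermalOp`), and `R` is the same operator with `-μ` for `μ`. Rescaling the vectors multiplies `S`
by an arbitrary nonnegative number, so analyticity forces every moment `∫ Sⁿ` to be real
(`moment_real`). For `s = β/4` the difference `P - R` is definite, because `(1 + ρ(x)) e^{-βx/4} -
ρ(x) e^{βx/4} = 1 / (2 cosh(βx/4))` is strictly decreasing in `x > 0`; this is where `μ ≠ 0` enters.

Charged field: take `ν` uniform on `{1, -1}`. The second moment is `(⟪u, P v⟫ + ⟪v, R u⟫)²`, which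
is not real for `v = (1 + i) u`.

Observables, dimension at least two: take `ν` to be Haar measure. Reality of the second moment `2
⟪u, P v⟫ ⟪v, R u⟫` for all vectors gives `P v = c R v`, with `c > 0` on a side of `1` fixed by the
sign of `μ`. The third moment compares the two orientations of a three-cycle, whose third edge is
the operator `T` for `s = β/2`, which does not depend on the sign of `μ`. Its reality forces `R v`
to be parallel to `T w` whenever `⟪v, R w⟫ ≠ 0`, which is impossible beyond dimension one
(`moments_not_real`).

Observables, dimension one: here the generation axiom fails. A time-zero vector `(c e, c̄ e)` keeps
components of equal modulus under the evolution, so its gauge orbit is invariant under the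
interchange of particles and antiparticles. Hence the averaged time-zero operators and their
translates cannot tell `|x⁺|` from `|x⁻|`, whereas the gauge average of `W_ω(e, 0)` can. The
interchange need not preserve the state, so this is expressed by two Gaussian vectors `η₁, η₂` whose
overlaps with `W_ω(x) Ω` are interchanged copies of each other: the closed space `swapSpace`
contains `Ω`, is invariant under the generated algebra, and is left by the average of `W_ω(e, 0)`.
-/

set_option linter.unusedSectionVars false

noncomputable section

namespace KleinGordon

open MeasureTheory

/-! ### Weyl relations and second quantization on exponential vectors. -/

section FockSpace
variable {K : Type*} [NormedAddCommGroup K] [InnerProductSpace ℂ K]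

theorem clm_ext_expVec {F : Type*} [NormedAddCommGroup F] [NormedSpace ℂ F]
    {A B : Fock K →L[ℂ] F} (h : ∀ g, A (expVec g) = B (expVec g)) : A = B := by
  have h1 : (A : Fock K →ₗ[ℂ] F) ∘ₗ expSum = (B : Fock K →ₗ[ℂ] F) ∘ₗ expSum := by
    refine Finsupp.lhom_ext fun g c => ?_
    simp [expSum, h]
  have h2 : (A : Fock K → F) ∘ expSum = (B : Fock K → F) ∘ expSum :=
    funext fun v => LinearMap.congr_fun h1 v
  exact DFunLike.coe_injective (denseRange_expSum.equalizer A.continuous B.continuous h2)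

theorem eq_of_inner_expVec {ψ ψ' : Fock K}
    (h : ∀ g : K, (inner ℂ ψ (expVec g) : ℂ) = inner ℂ ψ' (expVec g)) : ψ = ψ' := by
  have h1 : innerSL ℂ ψ = innerSL ℂ ψ' := clm_ext_expVec h
  exact ext_inner_right ℂ fun v => DFunLike.congr_fun h1 v

theorem op_ext_inner_expVec {A B : Fock K →L[ℂ] Fock K}
    (h : ∀ g g' : K, (inner ℂ (expVec g) (A (expVec g')) : ℂ) = inner ℂ (expVec g) (B (expVec g'))) :
    A = B := by
  refine clm_ext_expVec fun g' => eq_of_inner_expVec fun g => ?_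
  rw [← inner_conj_symm, h, inner_conj_symm]

theorem continuous_expVec : Continuous (expVec : K → Fock K) := by
  rw [continuous_iff_continuousAt]
  intro g
  rw [ContinuousAt, tendsto_iff_norm_sub_tendsto_zero]
  have h : ∀ x : K, ‖expVec x - expVec g‖ = √((Complex.exp (inner ℂ x x) -
      Complex.exp (inner ℂ x g) - Complex.exp (inner ℂ g x) + Complex.exp (inner ℂ g g)).re) := by
    intro x
    rw [norm_eq_sqrt_re_inner (𝕜 := ℂ), inner_sub_left, inner_sub_right, inner_sub_right]
    simp only [inner_expVec]
    rw [RCLike.re_eq_complex_re]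
    congr 2
    ring
  simp_rw [h]
  have hc : Continuous fun x : K => √((Complex.exp (inner ℂ x x) -
      Complex.exp (inner ℂ x g) - Complex.exp (inner ℂ g x) + Complex.exp (inner ℂ g g)).re) := by
    fun_prop
  have := hc.tendsto g
  simpa using this

theorem sqrt_two_sq : ((√2 : ℝ) : ℂ) ^ 2 = 2 := by
  rw [← Complex.ofReal_pow, Real.sq_sqrt (by norm_num)]; norm_num

theorem I_div_sqrt_two_sq : (Complex.I / √2) * (Complex.I / √2) = (-1 / 2 : ℂ) := by
  rw [div_mul_div_comm, Complex.I_mul_I, ← sq, sqrt_two_sq]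

theorem norm_sq_eq_inner (f : K) : ((‖f‖ : ℝ) : ℂ) ^ 2 = inner ℂ f f := by
  rw [inner_self_eq_norm_sq_to_K]; rfl

/-- The Weyl relations. -/
theorem fockWeyl_mul (f g : K) : fockWeyl f * fockWeyl g =
    Complex.exp (-(inner ℂ f g - inner ℂ g f) / 4) • fockWeyl (f + g) := by
  refine clm_ext_expVec fun k => ?_
  rw [mul_apply_eq_comp, fockWeyl_expVec, map_smul, fockWeyl_expVec,
    smul_apply, fockWeyl_expVec, smul_smul, smul_smul, ← Complex.exp_add,
    ← Complex.exp_add]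
  have h1 : k + (Complex.I / √2 : ℂ) • g + (Complex.I / √2 : ℂ) • f
      = k + (Complex.I / √2 : ℂ) • (f + g) := by rw [smul_add]; abel
  rw [h1]
  congr 2
  push_cast
  rw [norm_sq_eq_inner, norm_sq_eq_inner, norm_sq_eq_inner]
  simp only [inner_add_left, inner_add_right, inner_smul_right]
  -- The shift by `(i/√2) g` contributes `-⟪f, g⟫/2`; the polarization of `‖f + g‖²/4` absorbs its
  -- symmetric part and leaves the symplectic phase.
  linear_combination inner ℂ f g * I_div_sqrt_two_sq

theorem fockWeyl_zero : fockWeyl (0 : K) = 1 := by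
  refine clm_ext_expVec fun k => ?_
  rw [fockWeyl_expVec]
  simp

theorem fockWeyl_neg_mul (f : K) : fockWeyl (-f) * fockWeyl f = 1 := by
  rw [fockWeyl_mul]; simp [fockWeyl_zero]

theorem star_fockWeyl (f : K) : star (fockWeyl f) = fockWeyl (-f) := by
  refine op_ext_inner_expVec fun g g' => ?_
  rw [ContinuousLinearMap.star_eq_adjoint, ContinuousLinearMap.adjoint_inner_right,
    fockWeyl_expVec, fockWeyl_expVec, inner_smul_left, inner_smul_right, inner_expVec, inner_expVec,
    ← Complex.exp_conj, ← Complex.exp_add, ← Complex.exp_add]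
  congr 1
  simp only [inner_add_left, inner_add_right, inner_smul_left, inner_smul_right, map_add, map_neg,
    map_mul, map_div₀, Complex.conj_I, Complex.conj_ofReal, inner_conj_symm, smul_neg,
    inner_neg_left, inner_neg_right, norm_neg]
  ring

theorem norm_fockWeyl_apply (f : K) (ψ : Fock K) : ‖fockWeyl f ψ‖ = ‖ψ‖ := by
  have h : (inner ℂ (fockWeyl f ψ) (fockWeyl f ψ) : ℂ) = inner ℂ ψ ψ := by
    rw [← ContinuousLinearMap.adjoint_inner_right, ← ContinuousLinearMap.star_eq_adjoint,
      star_fockWeyl, ← mul_apply_eq_comp, fockWeyl_neg_mul,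
      one_apply_eq_self]
  rw [norm_eq_sqrt_re_inner (𝕜 := ℂ), h, ← norm_eq_sqrt_re_inner]

theorem fockWeyl_vacuum (f : K) : fockWeyl f (expVec 0) =
    Complex.exp (-(inner ℂ f f) / 4) • expVec ((Complex.I / √2 : ℂ) • f) := by
  rw [fockWeyl_expVec]
  push_cast
  rw [norm_sq_eq_inner]
  simp [neg_div]

theorem vacuum_fockWeyl (f : K) : (inner ℂ (expVec (0 : K)) (fockWeyl f (expVec 0)) : ℂ) =
    Complex.exp (-(inner ℂ f f) / 4) := by
  rw [fockWeyl_vacuum, inner_smul_right, inner_expVec]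
  simp

theorem norm_vacuum : ‖expVec (0 : K)‖ = 1 := by
  rw [norm_eq_sqrt_re_inner (𝕜 := ℂ), inner_expVec]; simp

/-- A family of contractions that is continuous on exponential vectors is strongly continuous. -/
theorem continuous_apply_of_expVec {Y : Type*} [TopologicalSpace Y]
    (A : Y → Fock K →L[ℂ] Fock K) (hA : ∀ y ψ, ‖A y ψ‖ ≤ ‖ψ‖)
    (hc : ∀ g : K, Continuous fun y => A y (expVec g)) (ψ : Fock K) :
    Continuous fun y => A y ψ := by
  rw [continuous_iff_continuousAt]
  intro y
  have h1 : ∀ v : K →₀ ℂ, Continuous fun y => A y (expSum v) := by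
    intro v
    simp only [expSum, Finsupp.linearCombination_apply, Finsupp.sum, map_sum, map_smul]
    exact continuous_finsetSum _ fun g _ => (hc g).const_smul (v g)
  rw [Metric.continuousAt_iff']
  intro e he
  obtain ⟨v, hv⟩ := Metric.denseRange_iff.1 (denseRange_expSum (K := K)) ψ (e / 3) (by positivity)
  have h2 := Metric.continuousAt_iff'.1 ((h1 v).continuousAt (x := y)) (e / 3) (by positivity)
  filter_upwards [h2] with x hx
  have h3 : ∀ y, dist (A y ψ) (A y (expSum v)) < e / 3 := fun y => by
    rw [dist_eq_norm, ← map_sub]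
    exact lt_of_le_of_lt (hA _ _) (by rwa [← dist_eq_norm])
  calc dist (A x ψ) (A y ψ) ≤ dist (A x ψ) (A x (expSum v)) + dist (A x (expSum v)) (A y (expSum v))
        + dist (A y (expSum v)) (A y ψ) := dist_triangle4 _ _ _ _
    _ < e / 3 + e / 3 + e / 3 := by
      have := h3 x
      have h4 := h3 y
      rw [dist_comm] at h4
      gcongr
    _ = e := by ring

theorem continuous_fockWeyl_apply (ψ : Fock K) : Continuous fun f : K => fockWeyl f ψ := by
  refine continuous_apply_of_expVec _ (fun f ψ => (norm_fockWeyl_apply f ψ).le) (fun g => ?_) ψ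
  simp only [fockWeyl_expVec]
  have h1 : Continuous fun f : K =>
      Complex.exp (-(‖f‖ ^ 2 / 4 : ℝ) + Complex.I / √2 * inner ℂ f g) := by fun_prop
  have h2 : Continuous fun f : K => g + (Complex.I / √2 : ℂ) • f := by fun_prop
  exact h1.smul (continuous_expVec.comp h2)

theorem secondQuant_mul {V V' : K →L[ℂ] K}
    (hV : ∀ x y, (inner ℂ (V x) (V y) : ℂ) = inner ℂ x y)
    (hV' : ∀ x y, (inner ℂ (V' x) (V' y) : ℂ) = inner ℂ x y) :
    secondQuant V * secondQuant V' = secondQuant (V * V') := by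
  refine clm_ext_expVec fun g => ?_
  rw [mul_apply_eq_comp, secondQuant_expVec hV', secondQuant_expVec hV,
    secondQuant_expVec fun x y => ?_]
  · rfl
  · rw [mul_apply_eq_comp, mul_apply_eq_comp, hV, hV']

theorem secondQuant_one : secondQuant (1 : K →L[ℂ] K) = 1 := by
  refine clm_ext_expVec fun g => ?_
  rw [secondQuant_expVec (by simp)]; rfl

theorem secondQuant_vacuum {V : K →L[ℂ] K}
    (hV : ∀ x y, (inner ℂ (V x) (V y) : ℂ) = inner ℂ x y) :
    secondQuant V (expVec 0) = expVec 0 := by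
  rw [secondQuant_expVec hV, map_zero]

theorem secondQuant_mul_fockWeyl {V : K →L[ℂ] K}
    (hV : ∀ x y, (inner ℂ (V x) (V y) : ℂ) = inner ℂ x y) (f : K) :
    secondQuant V * fockWeyl f = fockWeyl (V f) * secondQuant V := by
  refine clm_ext_expVec fun g => ?_
  have h : ‖V f‖ = ‖f‖ := by
    rw [norm_eq_sqrt_re_inner (𝕜 := ℂ), hV, ← norm_eq_sqrt_re_inner]
  rw [mul_apply_eq_comp, mul_apply_eq_comp, fockWeyl_expVec, map_smul,
    secondQuant_expVec hV, secondQuant_expVec hV, fockWeyl_expVec, hV, h, map_add, map_smul]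

theorem star_secondQuant {V V' : K →L[ℂ] K}
    (hV : ∀ x y, (inner ℂ (V x) (V y) : ℂ) = inner ℂ x y)
    (hV' : ∀ x y, (inner ℂ (V' x) (V' y) : ℂ) = inner ℂ x y) (h : V' * V = 1) :
    star (secondQuant V) = secondQuant V' := by
  refine op_ext_inner_expVec fun g g' => ?_
  rw [ContinuousLinearMap.star_eq_adjoint, ContinuousLinearMap.adjoint_inner_right,
    secondQuant_expVec hV, secondQuant_expVec hV', inner_expVec, inner_expVec]
  congr 1
  rw [← hV' (V g) g', ← mul_apply_eq_comp, h, one_apply_eq_self]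

end FockSpace

/-! ### Functional calculus of a selfadjoint operator with a spectral gap. -/

section Calculus
variable {E : Type*} [NormedAddCommGroup E] [InnerProductSpace ℂ E]

/-- By polarization: `J` preserves norms and exchanges the terms with `i` and `-i`. -/
theorem inner_conj_map (J : E ≃ₗᵢ⋆[ℂ] E) (x y : E) : (inner ℂ (J x) (J y) : ℂ) = inner ℂ y x := by
  have h1 : J x - Complex.I • J y = J (x + Complex.I • y) := by
    rw [map_add, map_smulₛₗ, Complex.conj_I, neg_smul, sub_eq_add_neg]
  have h2 : J x + Complex.I • J y = J (x - Complex.I • y) := by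
    rw [map_sub, map_smulₛₗ, Complex.conj_I, neg_smul, sub_neg_eq_add]
  rw [← inner_conj_symm y x, inner_eq_sum_norm_sq_div_four x y,
    inner_eq_sum_norm_sq_div_four (J x) (J y)]
  simp only [RCLike.I_to_complex, h1, h2, ← map_add, ← map_sub, J.norm_map]
  have h4 : (starRingEnd ℂ) 4 = 4 := Complex.conj_ofNat 4
  simp [h4]
  ring

/-- `A` is selfadjoint with `A ≥ m > 0`. -/
structure IsGapped (A : E →ₗ.[ℂ] E) (m : ℝ) [CompleteSpace E] : Prop where
  selfAdjoint : IsSelfAdjoint A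
  pos : 0 < m
  lower : ∀ x : A.domain, m * ‖(x : E)‖ ^ 2 ≤ (inner ℂ (x : E) (A x)).re

/-- `f` is continuous and bounded on `[m, ∞)`. -/
structure BddCont (m : ℝ) (f : ℝ → ℂ) : Prop where
  cont : ContinuousOn f (Set.Ici m)
  bdd : ∃ C : ℝ, ∀ e, m ≤ e → ‖f e‖ ≤ C

namespace BddCont
variable {m : ℝ} {f g : ℝ → ℂ}

theorem mul (hf : BddCont m f) (hg : BddCont m g) : BddCont m fun e => f e * g e := by
  obtain ⟨C, hC⟩ := hf.bdd
  obtain ⟨D, hD⟩ := hg.bdd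
  refine ⟨hf.cont.mul hg.cont, C * D, fun e he => ?_⟩
  rw [norm_mul]
  exact mul_le_mul (hC e he) (hD e he) (norm_nonneg _) ((norm_nonneg _).trans (hC e he))

theorem add (hf : BddCont m f) (hg : BddCont m g) : BddCont m fun e => f e + g e := by
  obtain ⟨C, hC⟩ := hf.bdd
  obtain ⟨D, hD⟩ := hg.bdd
  exact ⟨hf.cont.add hg.cont, C + D, fun e he => norm_add_le_of_le (hC e he) (hD e he)⟩

theorem const (c : ℂ) : BddCont m fun _ => c :=
  ⟨continuousOn_const, ‖c‖, fun _ _ => le_rfl⟩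

theorem star (hf : BddCont m f) : BddCont m fun e => star (f e) := by
  obtain ⟨C, hC⟩ := hf.bdd
  exact ⟨hf.cont.star, C, fun e he => by rw [norm_star]; exact hC e he⟩

theorem of_real {f : ℝ → ℝ} (hf : ContinuousOn f (Set.Ici m)) {C : ℝ}
    (hC : ∀ e, m ≤ e → |f e| ≤ C) : BddCont m fun e => (f e : ℂ) :=
  ⟨Complex.continuous_ofReal.comp_continuousOn hf, C, fun e he => by
    rw [Complex.norm_real]; exact hC e he⟩

end BddCont

variable [CompleteSpace E] {A : E →ₗ.[ℂ] E} {m : ℝ}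

namespace IsGapped

theorem dense_range (H : IsGapped A m) : DenseRange (boundedInverse A : E → E) := by
  refine H.selfAdjoint.dense_domain.mono fun x hx => ?_
  obtain ⟨h, hy⟩ := boundedInverse_spec H.selfAdjoint H.pos H.lower (A ⟨x, hx⟩)
  exact ⟨A ⟨x, hx⟩, congrArg Subtype.val (injective_of_lowerBound H.pos H.lower _ _ hy)⟩

theorem isSelfAdjoint_inverse (H : IsGapped A m) : IsSelfAdjoint (boundedInverse A) :=
  (boundedInverse_isPositive H.selfAdjoint H.pos H.lower).isSelfAdjoint

theorem isStarNormal_inverse (H : IsGapped A m) : IsStarNormal (boundedInverse A) :=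
  H.isSelfAdjoint_inverse.isStarNormal

theorem spectrum_le (H : IsGapped A m) {z : ℂ} (hz : z ∈ spectrum ℂ (boundedInverse A)) :
    z.im = 0 ∧ 0 ≤ z.re ∧ z.re ≤ m⁻¹ :=
  spectrum_boundedInverse H.selfAdjoint H.pos H.lower hz

/-- Only the point `0` is delicate. It corresponds to infinite energy, where `f` may have no limit,
but `f` is bounded and the factor `z` tends to zero. -/
theorem continuousOn_mul_inv (H : IsGapped A m) {f : ℝ → ℂ} (hf : BddCont m f) :
    ContinuousOn (fun z : ℂ => z * f (z.re)⁻¹) (spectrum ℂ (boundedInverse A)) := by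
  obtain ⟨C, hC⟩ := hf.bdd
  have hbd : ∀ z ∈ spectrum ℂ (boundedInverse A), ‖z * f (z.re)⁻¹‖ ≤ C * ‖z‖ := by
    intro z hz
    obtain ⟨h1, h2, h3⟩ := H.spectrum_le hz
    rcases h2.eq_or_lt with h0 | h0
    · have : z = 0 := Complex.ext h0.symm h1
      simp [this]
    · rw [norm_mul, mul_comm]
      exact mul_le_mul_of_nonneg_right (hC _ ((le_inv_comm₀ H.pos h0).2 h3)) (norm_nonneg _)
  intro z hz
  obtain ⟨h1, h2, h3⟩ := H.spectrum_le hz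
  rcases h2.eq_or_lt with h0 | h0
  · have hz0 : z = 0 := Complex.ext h0.symm h1
    rw [ContinuousWithinAt, hz0, zero_mul]
    refine squeeze_zero_norm' (a := fun z => C * ‖z‖) ?_ ?_
    · filter_upwards [self_mem_nhdsWithin] with w hw using hbd w hw
    · have : Filter.Tendsto (fun w : ℂ => C * ‖w‖) (nhds 0) (nhds (C * ‖(0 : ℂ)‖)) :=
        (continuous_const.mul continuous_norm).tendsto _
      rw [norm_zero, mul_zero] at this
      exact this.mono_left nhdsWithin_le_nhds
  · refine continuousWithinAt_id.mul ?_
    have hinv : ContinuousWithinAt (fun w : ℂ => (w.re)⁻¹)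
        (spectrum ℂ (boundedInverse A) ∩ {w | 0 < w.re}) z :=
      (Complex.continuous_re.continuousAt.inv₀ h0.ne').continuousWithinAt
    have hmaps : Set.MapsTo (fun w : ℂ => (w.re)⁻¹)
        (spectrum ℂ (boundedInverse A) ∩ {w | 0 < w.re}) (Set.Ici m) := by
      rintro w ⟨hw, hw0⟩
      exact (le_inv_comm₀ H.pos hw0).2 (H.spectrum_le hw).2.2
    have hcomp : ContinuousWithinAt (fun w : ℂ => f (w.re)⁻¹)
        (spectrum ℂ (boundedInverse A) ∩ {w | 0 < w.re}) z :=
      ContinuousWithinAt.comp (f := fun w : ℂ => (w.re)⁻¹) (hf.cont _ (hmaps ⟨hz, h0⟩)) hinv hmaps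
    exact hcomp.mono_of_mem_nhdsWithin
      (inter_mem_nhdsWithin _ ((isOpen_lt continuous_const Complex.continuous_re).mem_nhds h0))

theorem apply_inverse (H : IsGapped A m) {f : ℝ → ℂ} (hf : BddCont m f) (y : E) :
    boundedFC A f (boundedInverse A y) = cfc (fun z : ℂ => z * f (z.re)⁻¹) (boundedInverse A) y := by
  obtain ⟨C, hC⟩ := hf.bdd
  exact boundedFC_boundedInverse H.selfAdjoint H.pos H.lower hf.cont hC y

theorem inverse_cfc (H : IsGapped A m) (f : ℂ → ℂ) (y : E) :
    boundedInverse A (cfc f (boundedInverse A) y) = cfc f (boundedInverse A) (boundedInverse A y) := by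
  have hn := H.isStarNormal_inverse
  have h := cfc_commute_cfc (R := ℂ) (fun z => z) f (boundedInverse A)
  rw [cfc_id' ℂ (boundedInverse A)] at h
  exact DFunLike.congr_fun h.eq y

/-- Two bounded operators that agree on the range of `A⁻¹` are equal. -/
theorem clm_ext (H : IsGapped A m) {F : Type*} [NormedAddCommGroup F] [NormedSpace ℂ F]
    {S S' : E →L[ℂ] F} (h : ∀ y, S (boundedInverse A y) = S' (boundedInverse A y)) : S = S' :=
  DFunLike.coe_injective (H.dense_range.equalizer S.continuous S'.continuous (funext h))

/-- Each factor of a product of two operators `f(A) g(A)` uses up one `A⁻¹`, so products are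
compared on the range of `A⁻²`. -/
theorem clm_ext_sq (H : IsGapped A m) {F : Type*} [NormedAddCommGroup F] [NormedSpace ℂ F]
    {S S' : E →L[ℂ] F}
    (h : ∀ y, S (boundedInverse A (boundedInverse A y)) = S' (boundedInverse A (boundedInverse A y))) :
    S = S' := by
  refine H.clm_ext fun y => ?_
  have := H.clm_ext (S := S ∘L boundedInverse A) (S' := S' ∘L boundedInverse A) h
  exact DFunLike.congr_fun this y

/-- The spectrum of `A⁻¹` lies in `[0, 1/m]`, so only values of `f` on `[m, ∞)` matter; at `0` the
factor `z` hides the junk value of `(z.re)⁻¹`. -/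
theorem fc_congr (H : IsGapped A m) {f g : ℝ → ℂ} (hf : BddCont m f) (hg : BddCont m g)
    (h : ∀ e, m ≤ e → f e = g e) : boundedFC A f = boundedFC A g := by
  refine H.clm_ext fun y => ?_
  rw [H.apply_inverse hf, H.apply_inverse hg]
  refine DFunLike.congr_fun (cfc_congr fun z hz => ?_) y
  obtain ⟨h1, h2, h3⟩ := H.spectrum_le hz
  rcases h2.eq_or_lt with h0 | h0
  · have : z = 0 := Complex.ext h0.symm h1
    simp [this]
  · simp only [h _ ((le_inv_comm₀ H.pos h0).2 h3)]

theorem fc_one (H : IsGapped A m) : boundedFC A (fun _ => 1) = 1 := by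
  have hn := H.isStarNormal_inverse
  refine H.clm_ext fun y => ?_
  rw [H.apply_inverse (BddCont.const 1)]
  simp only [mul_one]
  rw [cfc_id' ℂ (boundedInverse A)]
  rfl

theorem fc_mul (H : IsGapped A m) {f g : ℝ → ℂ} (hf : BddCont m f) (hg : BddCont m g) :
    boundedFC A f * boundedFC A g = boundedFC A fun e => f e * g e := by
  have hn := H.isStarNormal_inverse
  refine H.clm_ext_sq fun y => ?_
  rw [mul_apply_eq_comp, H.apply_inverse hg, ← H.inverse_cfc, H.apply_inverse hf,
    H.apply_inverse (hf.mul hg)]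
  have h1 := cfc_mul _ _ (boundedInverse A) (H.continuousOn_mul_inv hf) (H.continuousOn_mul_inv hg)
  have h2 := cfc_mul _ (fun z => z) (boundedInverse A) (H.continuousOn_mul_inv (hf.mul hg))
    continuousOn_id
  rw [cfc_id' ℂ (boundedInverse A)] at h2
  rw [← mul_apply_eq_comp, ← mul_apply_eq_comp, ← h1, ← h2]
  refine DFunLike.congr_fun (cfc_congr fun z _ => ?_) y
  ring

theorem fc_mul_apply (H : IsGapped A m) {f g : ℝ → ℂ} (hf : BddCont m f) (hg : BddCont m g)
    (x : E) : boundedFC A f (boundedFC A g x) = boundedFC A (fun e => f e * g e) x := by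
  rw [← H.fc_mul hf hg]; rfl

theorem fc_add (H : IsGapped A m) {f g : ℝ → ℂ} (hf : BddCont m f) (hg : BddCont m g) :
    boundedFC A f + boundedFC A g = boundedFC A fun e => f e + g e := by
  refine H.clm_ext fun y => ?_
  rw [add_apply, H.apply_inverse hg, H.apply_inverse hf,
    H.apply_inverse (hf.add hg)]
  have h1 := cfc_add (a := boundedInverse A) _ _ (H.continuousOn_mul_inv hf)
    (H.continuousOn_mul_inv hg)
  rw [← add_apply, ← h1]
  refine DFunLike.congr_fun (cfc_congr fun z _ => ?_) y
  ring

theorem fc_const_mul (H : IsGapped A m) {f : ℝ → ℂ} (hf : BddCont m f) (c : ℂ) :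
    boundedFC A (fun e => c * f e) = c • boundedFC A f := by
  refine H.clm_ext fun y => ?_
  rw [smul_apply, H.apply_inverse ((BddCont.const c).mul hf), H.apply_inverse hf, ← smul_apply,
    ← cfc_smul c _ (boundedInverse A) (H.continuousOn_mul_inv hf)]
  refine DFunLike.congr_fun (cfc_congr fun z _ => ?_) y
  simp only [smul_eq_mul]; ring

theorem fc_star (H : IsGapped A m) {f : ℝ → ℂ} (hf : BddCont m f) :
    star (boundedFC A f) = boundedFC A fun e => star (f e) := by
  have hn := H.isStarNormal_inverse
  have hs : ∀ x y, (inner ℂ (boundedInverse A x) y : ℂ) = inner ℂ x (boundedInverse A y) :=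
    fun x y => by
      rw [← ContinuousLinearMap.adjoint_inner_right, ← ContinuousLinearMap.star_eq_adjoint,
        H.isSelfAdjoint_inverse.star_eq]
  have key : ∀ y y', (inner ℂ (boundedFC A f (boundedInverse A y)) (boundedInverse A y') : ℂ)
      = inner ℂ (boundedInverse A y) (boundedFC A (fun e => star (f e)) (boundedInverse A y')) := by
    intro y y'
    rw [H.apply_inverse hf, H.apply_inverse hf.star, ← ContinuousLinearMap.adjoint_inner_right,
      ← ContinuousLinearMap.star_eq_adjoint, ← cfc_star, hs, H.inverse_cfc]
    congr 1
    refine DFunLike.congr_fun (cfc_congr fun z hz => ?_) _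
    obtain ⟨h1, -⟩ := H.spectrum_le hz
    have : star z = z := Complex.conj_eq_iff_im.2 h1
    simp only [star_mul', this]
  refine H.clm_ext fun y' => ext_inner_left ℂ fun x => ?_
  rw [ContinuousLinearMap.star_eq_adjoint, ContinuousLinearMap.adjoint_inner_right]
  have h2 : (fun x => (inner ℂ (boundedFC A f x) (boundedInverse A y') : ℂ))
      = fun x => inner ℂ x (boundedFC A (fun e => star (f e)) (boundedInverse A y')) :=
    H.dense_range.equalizer (by fun_prop) (by fun_prop) (funext fun y => key y y')
  exact congrFun h2 x

theorem inner_fc_left (H : IsGapped A m) {f : ℝ → ℂ} (hf : BddCont m f) (x y : E) :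
    (inner ℂ (boundedFC A f x) y : ℂ) = inner ℂ x (boundedFC A (fun e => star (f e)) y) := by
  rw [← H.fc_star hf, ContinuousLinearMap.star_eq_adjoint, ContinuousLinearMap.adjoint_inner_right]

theorem inner_fc_real_left (H : IsGapped A m) {f : ℝ → ℝ} (hf : BddCont m fun e => (f e : ℂ))
    (x y : E) : (inner ℂ (boundedFC A (fun e => (f e : ℂ)) x) y : ℂ)
      = inner ℂ x (boundedFC A (fun e => (f e : ℂ)) y) := by
  rw [H.inner_fc_left hf]
  simp

/-- With `h = √(C² - |f|²)` one has `|f|² + h² = C²` on the spectrum, hence `‖f(A) x‖² + ‖h(A) x‖² =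
C² ‖x‖²`. -/
theorem norm_fc_apply_le (H : IsGapped A m) {f : ℝ → ℂ} (hf : BddCont m f) {C : ℝ}
    (hC : ∀ e, m ≤ e → ‖f e‖ ≤ C) (x : E) : ‖boundedFC A f x‖ ≤ C * ‖x‖ := by
  have hC0 : 0 ≤ C := (norm_nonneg _).trans (hC m le_rfl)
  set h : ℝ → ℝ := fun e => √(C ^ 2 - ‖f e‖ ^ 2) with hh
  have h1 : BddCont m fun e => (h e : ℂ) := by
    refine BddCont.of_real (C := C) ?_ fun e he => ?_
    · exact Real.continuous_sqrt.comp_continuousOn (continuousOn_const.sub (hf.cont.norm.pow 2))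
    · rw [hh, abs_of_nonneg (Real.sqrt_nonneg _)]
      refine Real.sqrt_le_iff.2 ⟨hC0, ?_⟩
      nlinarith [sq_nonneg ‖f e‖]
  have h2 : (inner ℂ (boundedFC A f x) (boundedFC A f x) : ℂ)
      + inner ℂ (boundedFC A (fun e => (h e : ℂ)) x) (boundedFC A (fun e => (h e : ℂ)) x)
      = (C : ℂ) ^ 2 * inner ℂ x x := by
    rw [H.inner_fc_left hf, H.inner_fc_left h1, ← inner_add_right, H.fc_mul_apply hf.star hf,
      H.fc_mul_apply h1.star h1, ← add_apply, H.fc_add (hf.star.mul hf) (h1.star.mul h1),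
      H.fc_congr (g := fun _ => (C : ℂ) ^ 2 * 1) ((hf.star.mul hf).add (h1.star.mul h1))
        (BddCont.const _) fun e he => ?_, H.fc_const_mul (BddCont.const 1), H.fc_one]
    · simp
    · simp only [RCLike.star_def, Complex.conj_mul', Complex.norm_real]
      rw [hh]
      simp only [Real.norm_eq_abs, abs_of_nonneg (Real.sqrt_nonneg _)]
      rw [← Complex.ofReal_pow (√_), Real.sq_sqrt]
      · push_cast; ring
      · have := hC e he
        have := norm_nonneg (f e)
        nlinarith
  simp only [← norm_sq_eq_inner] at h2
  norm_cast at h2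
  rw [← sq_le_sq₀ (norm_nonneg _) (by positivity), mul_pow, ← h2]
  linarith [sq_nonneg ‖boundedFC A (fun e => (h e : ℂ)) x‖]

theorem inner_fc_self_nonneg (H : IsGapped A m) {f : ℝ → ℝ} (hf : BddCont m fun e => (f e : ℂ))
    (h0 : ∀ e, m ≤ e → 0 ≤ f e) (x : E) :
    (inner ℂ x (boundedFC A (fun e => (f e : ℂ)) x) : ℂ)
      = ((‖boundedFC A (fun e => (√(f e) : ℝ)) x‖ ^ 2 : ℝ) : ℂ) := by
  obtain ⟨C, hC⟩ := hf.bdd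
  have h1 : BddCont m fun e => ((√(f e) : ℝ) : ℂ) := by
    refine BddCont.of_real (C := √C) ?_ fun e he => ?_
    · refine Real.continuous_sqrt.comp_continuousOn ?_
      exact Complex.continuous_re.comp_continuousOn hf.cont
    · rw [abs_of_nonneg (Real.sqrt_nonneg _)]
      refine Real.sqrt_le_sqrt ((le_abs_self _).trans ?_)
      simpa using hC e he
  push_cast
  rw [norm_sq_eq_inner, H.inner_fc_real_left h1, H.fc_mul_apply h1 h1]
  congr 2
  refine H.fc_congr hf (h1.mul h1) fun e he => ?_
  rw [← Complex.ofReal_mul, Real.mul_self_sqrt (h0 e he)]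

theorem fc_inv (H : IsGapped A m) :
    BddCont m (fun e => ((e⁻¹ : ℝ) : ℂ)) ∧ boundedFC A (fun e => ((e⁻¹ : ℝ) : ℂ)) = boundedInverse A := by
  have hn := H.isStarNormal_inverse
  have h1 : BddCont m (fun e => ((e⁻¹ : ℝ) : ℂ)) := by
    refine BddCont.of_real (C := m⁻¹) ?_ fun e he => ?_
    · exact ContinuousOn.inv₀ continuousOn_id fun e he => (H.pos.trans_le he).ne'
    · rw [abs_of_pos (inv_pos.2 (H.pos.trans_le he))]
      exact inv_anti₀ H.pos he
  refine ⟨h1, H.clm_ext fun y => ?_⟩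
  rw [H.apply_inverse h1]
  have h2 := cfc_mul (fun z : ℂ => z) (fun z : ℂ => z) (boundedInverse A) continuousOn_id continuousOn_id
  rw [cfc_id' ℂ (boundedInverse A)] at h2
  rw [← mul_apply_eq_comp, ← h2]
  refine DFunLike.congr_fun (cfc_congr fun z hz => ?_) _
  obtain ⟨h1, -⟩ := H.spectrum_le hz
  simp only [inv_inv]
  congr 1
  exact Complex.ext (by simp) (by simp [h1])

end IsGapped

/-- The continuous cutoff function that is `1` on `(-∞, n]` and `0` on `[n + 1, ∞)`. -/
def cutoff (n : ℕ) (e : ℝ) : ℝ := max 0 (min 1 (n + 1 - e))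

theorem continuous_cutoff (n : ℕ) : Continuous (cutoff n) := by unfold cutoff; fun_prop

theorem cutoff_nonneg (n : ℕ) (e : ℝ) : 0 ≤ cutoff n e := le_max_left _ _

theorem cutoff_le_one (n : ℕ) (e : ℝ) : cutoff n e ≤ 1 := max_le zero_le_one (min_le_left _ _)

theorem cutoff_eq_one {n : ℕ} {e : ℝ} (h : e ≤ n) : cutoff n e = 1 := by
  rw [cutoff, min_eq_left (by linarith), max_eq_right zero_le_one]

theorem cutoff_eq_zero {n : ℕ} {e : ℝ} (h : n + 1 ≤ e) : cutoff n e = 0 := by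
  rw [cutoff, max_eq_left]
  exact (min_le_right _ _).trans (by linarith)

/-- A continuous function times a cutoff is continuous and bounded. -/
theorem BddCont.cutoff_mul {f : ℝ → ℂ} (hf : ContinuousOn f (Set.Ici m)) (n : ℕ) :
    BddCont m fun e => (cutoff n e : ℂ) * f e := by
  have hc : ContinuousOn (fun e => (cutoff n e : ℂ) * f e) (Set.Ici m) :=
    (Complex.continuous_ofReal.comp (continuous_cutoff n)).continuousOn.mul hf
  obtain ⟨C, hC⟩ := (isCompact_Icc (a := m) (b := (n + 1 : ℝ))).exists_bound_of_continuousOn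
    (hc.mono Set.Icc_subset_Ici_self)
  refine ⟨hc, max C 0, fun e he => ?_⟩
  rcases le_total e (n + 1) with h | h
  · exact (hC e ⟨he, h⟩).trans (le_max_left _ _)
  · simp [cutoff_eq_zero h]

theorem bddCont_cutoff (n : ℕ) : BddCont m fun e => (cutoff n e : ℂ) := by
  simpa using BddCont.cutoff_mul (m := m) (f := fun _ => 1) continuousOn_const n

namespace IsGapped

/-- On the range of `A⁻¹` the error is `(cutoff - 1) e⁻¹` applied to `y`, which vanishes for `e ≤ n`
and is at most `1/n` beyond. -/
theorem tendsto_cutoff (H : IsGapped A m) (y : E) :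
    Filter.Tendsto (fun n => boundedFC A (fun e => (cutoff n e : ℂ)) (boundedInverse A y))
      Filter.atTop (nhds (boundedInverse A y)) := by
  rw [tendsto_iff_norm_sub_tendsto_zero]
  have h0 : Filter.Tendsto (fun n : ℕ => 1 / (n : ℝ) * ‖y‖) Filter.atTop (nhds 0) := by
    simpa using (tendsto_one_div_atTop_nhds_zero_nat (𝕜 := ℝ)).mul_const ‖y‖
  refine squeeze_zero' (Filter.Eventually.of_forall fun _ => norm_nonneg _) ?_ h0
  filter_upwards [Filter.eventually_gt_atTop 0] with n hn
  obtain ⟨hi, hi'⟩ := H.fc_inv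
  have h1 := (bddCont_cutoff (m := m) n).mul hi
  have h2 : boundedFC A (fun e => (cutoff n e : ℂ)) (boundedInverse A y) - boundedInverse A y
      = boundedFC A (fun e => (cutoff n e : ℂ) * ((e⁻¹ : ℝ) : ℂ) + (-1) * ((e⁻¹ : ℝ) : ℂ)) y := by
    rw [← H.fc_add h1 ((BddCont.const _).mul hi), H.fc_const_mul hi, add_apply,
      ← H.fc_mul_apply (bddCont_cutoff n) hi, smul_apply, hi']
    simp [sub_eq_add_neg]
  rw [h2]
  refine H.norm_fc_apply_le (h1.add ((BddCont.const _).mul hi)) (fun e he => ?_) y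
  have he0 := H.pos.trans_le he
  rcases le_total e n with h | h
  · simp [cutoff_eq_one h]
  · rw [← add_mul, norm_mul, ← Complex.ofReal_one, ← Complex.ofReal_neg, ← Complex.ofReal_add,
      Complex.norm_real, Complex.norm_real, one_div, Real.norm_eq_abs, Real.norm_eq_abs,
      abs_of_pos (inv_pos.2 he0)]
    have hn' : (0 : ℝ) < n := by exact_mod_cast hn
    have h4 : |cutoff n e + -1| ≤ 1 := by
      rw [abs_le]; constructor <;> linarith [cutoff_nonneg n e, cutoff_le_one n e]
    calc |cutoff n e + -1| * e⁻¹ ≤ 1 * (n : ℝ)⁻¹ :=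
          mul_le_mul h4 (inv_anti₀ hn' h) (inv_pos.2 he0).le zero_le_one
      _ = _ := one_mul _

theorem dense_cutoff (H : IsGapped A m) :
    Dense {x : E | ∃ (n : ℕ) (y : E), x = boundedFC A (fun e => (cutoff n e : ℂ)) y} := by
  refine dense_iff_closure_eq.2 (Set.eq_univ_of_univ_subset ?_)
  rw [← H.dense_range.closure_range]
  refine closure_minimal ?_ isClosed_closure
  rintro _ ⟨y, rfl⟩
  exact mem_closure_of_tendsto (H.tendsto_cutoff y) (Filter.Eventually.of_forall fun n => ⟨n, _, rfl⟩)

/-- If `f > 0` then `f(A)` is injective. -/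
theorem fc_injective (H : IsGapped A m) {f : ℝ → ℝ} (hf : BddCont m fun e => (f e : ℂ))
    (h0 : ∀ e, m ≤ e → 0 < f e) {x : E} (hx : boundedFC A (fun e => (f e : ℂ)) x = 0) : x = 0 := by
  have h1 : ∀ n, boundedFC A (fun e => (cutoff n e : ℂ)) x = 0 := by
    intro n
    have hne : ∀ e, m ≤ e → (f e : ℂ) ≠ 0 := fun e he => Complex.ofReal_ne_zero.2 (h0 e he).ne'
    -- The function `1/f` may be unbounded at high energy, but `cutoff / f` is bounded, so
    -- `cutoff(A) x = (cutoff / f)(A) f(A) x = 0` for every `n`.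
    have h2 : BddCont m fun e => (cutoff n e : ℂ) * (f e : ℂ)⁻¹ :=
      BddCont.cutoff_mul (hf.cont.inv₀ hne) n
    rw [H.fc_congr (g := fun e => ((cutoff n e : ℂ) * (f e : ℂ)⁻¹) * f e) (bddCont_cutoff n)
      (h2.mul hf) fun e he => by rw [inv_mul_cancel_right₀ (hne e he)], ← H.fc_mul_apply h2 hf, hx,
      map_zero]
  refine ext_inner_right ℂ fun z => ?_
  rw [inner_zero_left]
  have h2 : (fun z => (inner ℂ x z : ℂ)) = fun _ => 0 := by
    refine H.dense_range.equalizer (by fun_prop) (by fun_prop) (funext fun y => ?_)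
    refine tendsto_nhds_unique ((tendsto_const_nhds (x := x)).inner (𝕜 := ℂ) (H.tendsto_cutoff y)) ?_
    refine tendsto_const_nhds.congr fun n => ?_
    rw [← H.inner_fc_real_left (bddCont_cutoff n), h1, inner_zero_left]
    rfl
  exact congrFun h2 z

/-- If `f > 0` then `f(A)` is strictly positive. -/
theorem inner_fc_pos (H : IsGapped A m) {f : ℝ → ℝ} (hf : BddCont m fun e => (f e : ℂ))
    (h0 : ∀ e, m ≤ e → 0 < f e) {x : E} (hx : x ≠ 0) :
    ∃ c : ℝ, 0 < c ∧ (inner ℂ x (boundedFC A (fun e => (f e : ℂ)) x) : ℂ) = c := by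
  refine ⟨_, ?_, H.inner_fc_self_nonneg hf (fun e he => (h0 e he).le) x⟩
  refine sq_pos_of_ne_zero (norm_ne_zero_iff.2 fun h => hx ?_)
  obtain ⟨C, hC⟩ := hf.bdd
  refine H.fc_injective (f := fun e => √(f e)) ?_ (fun e he => Real.sqrt_pos.2 (h0 e he)) h
  refine BddCont.of_real (C := √C) ?_ fun e he => ?_
  · exact Real.continuous_sqrt.comp_continuousOn (Complex.continuous_re.comp_continuousOn hf.cont)
  · rw [abs_of_nonneg (Real.sqrt_nonneg _)]
    refine Real.sqrt_le_sqrt ((le_abs_self _).trans ?_)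
    simpa using hC e he

/-- On vectors of bounded energy, `e^{izA}` is an entire function of `z`. -/
theorem exists_entire_exp (H : IsGapped A m) (n : ℕ) :
    ∃ Φ : ℂ → E →L[ℂ] E, Differentiable ℂ Φ ∧ ∀ (z : ℂ) (k l : ℝ → ℂ), BddCont m k → BddCont m l →
      (∀ e, m ≤ e → l e = Complex.exp (Complex.I * z * e) * k e) → ∀ y,
      Φ z (boundedFC A k (boundedFC A (fun e => (cutoff n e : ℂ)) y))
        = boundedFC A l (boundedFC A (fun e => (cutoff n e : ℂ)) y) := by
  have hn := H.isStarNormal_inverse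
  set T := boundedInverse A with hT
  -- The cutoff vanishes at energies above `n + 1 = 1/δ`. Where it does not vanish, `1 / max w δ` is
  -- the energy itself, so a bounded operator replaces `A` and its exponential is entire.
  set δ : ℝ := (n + 1 : ℝ)⁻¹ with hδ
  have hδ0 : 0 < δ := by positivity
  have hb : Continuous fun w : ℂ => (((max w.re δ)⁻¹ : ℝ) : ℂ) := by
    refine Complex.continuous_ofReal.comp (Continuous.inv₀ (by fun_prop) fun w => ?_)
    exact (lt_max_of_lt_right hδ0).ne'
  set b : ℂ → ℂ := fun w => (((max w.re δ)⁻¹ : ℝ) : ℂ) with hbdef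
  have hBn : IsStarNormal (cfc b T) := cfc_predicate b T
  have hexp : ∀ z : ℂ, NormedSpace.exp (z • cfc b T) = cfc (fun w => Complex.exp (z * b w)) T := by
    intro z
    have h1 : z • cfc b T = cfc (fun w => z * b w) T := (cfc_const_mul z b T hb.continuousOn).symm
    have h2 : IsStarNormal (cfc (fun w => z * b w) T) := cfc_predicate _ T
    rw [h1, ← CFC.complex_exp_eq_normedSpace_exp h2, ← cfc_comp' Complex.exp (fun w => z * b w) T
      Complex.continuous_exp.continuousOn (by fun_prop)]
  refine ⟨fun z => NormedSpace.exp ((Complex.I * z) • cfc b T), ?_, fun z k l hk hl hkl y => ?_⟩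
  · intro z
    have h1 : HasDerivAt (fun w : ℂ => NormedSpace.exp (w • cfc b T)) _ (Complex.I * z) :=
      hasDerivAt_exp_smul_const (𝕂 := ℂ) (cfc b T) (Complex.I * z)
    have h2 : HasDerivAt (fun z : ℂ => Complex.I * z) _ z := (hasDerivAt_id z).const_mul Complex.I
    exact (HasDerivAt.scomp z h1 h2).differentiableAt
  · have hc := bddCont_cutoff (m := m) n
    simp only [H.fc_mul_apply hk hc, H.fc_mul_apply hl hc, hexp]
    have key : (cfc (fun w => Complex.exp (Complex.I * z * b w)) T) ∘L
        boundedFC A (fun e => k e * (cutoff n e : ℂ)) =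
        boundedFC A (fun e => l e * (cutoff n e : ℂ)) := by
      refine H.clm_ext fun y => ?_
      rw [ContinuousLinearMap.comp_apply, H.apply_inverse (hk.mul hc), H.apply_inverse (hl.mul hc),
        ← mul_apply_eq_comp, ← cfc_mul _ _ T (by fun_prop) (H.continuousOn_mul_inv (hk.mul hc))]
      refine DFunLike.congr_fun (cfc_congr fun w hw => ?_) y
      obtain ⟨h1, h2, h3⟩ := H.spectrum_le hw
      rcases h2.eq_or_lt with h0 | h0
      · have : w = 0 := Complex.ext h0.symm h1
        simp [this]
      · simp only [hbdef]
        rcases le_total w.re δ with h4 | h4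
        · have : cutoff n (w.re)⁻¹ = 0 := by
            refine cutoff_eq_zero ?_
            rwa [le_inv_comm₀ (by positivity) h0]
          simp [this]
        · rw [max_eq_left h4, hkl _ ((le_inv_comm₀ H.pos h0).2 h3)]
          ring
    exact DFunLike.congr_fun key y

end IsGapped

/-- Conjugation of bounded operators by an antiunitary involution. -/
def conjHom (J : E ≃ₗᵢ⋆[ℂ] E) (hJ : ∀ x, J (J x) = x) : (E →L[ℂ] E) →⋆ₐ[ℝ] (E →L[ℂ] E) where
  toFun S :=
    { toFun := fun x => J (S (J x))
      map_add' := fun x y => by simp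
      map_smul' := fun c x => by rw [map_smulₛₗ, map_smul, map_smulₛₗ]; simp
      cont := J.continuous.comp (S.continuous.comp J.continuous) }
  map_one' := by ext x; simp [hJ]
  map_mul' S S' := by ext x; simp [hJ]
  map_zero' := by ext x; simp
  map_add' S S' := by ext x; simp
  commutes' r := by
    ext x
    have : J (((r : ℝ) : ℂ) • J x) = ((r : ℝ) : ℂ) • x := by
      rw [map_smulₛₗ, hJ, Complex.conj_ofReal]
    simpa [Algebra.algebraMap_eq_smul_one] using this
  map_star' S := by
    ext x
    refine ext_inner_left ℂ fun y => ?_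
    rw [ContinuousLinearMap.star_eq_adjoint, ContinuousLinearMap.star_eq_adjoint,
      ContinuousLinearMap.adjoint_inner_right]
    change (inner ℂ y (J (ContinuousLinearMap.adjoint S (J x))) : ℂ) = inner ℂ (J (S (J y))) x
    conv_lhs => rw [← hJ y]
    conv_rhs => rw [← hJ x]
    rw [inner_conj_map, inner_conj_map, ContinuousLinearMap.adjoint_inner_left]

/-- The functional calculus of a real operator with a real function commutes with the conjugation. -/
theorem IsGapped.fc_conj (H : IsGapped A m) (J : E ≃ₗᵢ⋆[ℂ] E) (hJ : ∀ x, J (J x) = x)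
    (hreal : ∀ x : A.domain, ∃ hx : J (x : E) ∈ A.domain, A ⟨J (x : E), hx⟩ = J (A x))
    {f : ℝ → ℝ} (hf : BddCont m fun e => (f e : ℂ)) (x : E) :
    boundedFC A (fun e => (f e : ℂ)) (J x) = J (boundedFC A (fun e => (f e : ℂ)) x) := by
  have hT : ∀ y, boundedInverse A (J y) = J (boundedInverse A y) := by
    intro y
    obtain ⟨h1, h1'⟩ := boundedInverse_spec H.selfAdjoint H.pos H.lower y
    obtain ⟨h2, h2'⟩ := boundedInverse_spec H.selfAdjoint H.pos H.lower (J y)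
    obtain ⟨h3, h3'⟩ := hreal ⟨_, h1⟩
    rw [h1', ← h2'] at h3'
    exact (congrArg Subtype.val (injective_of_lowerBound H.pos H.lower _ _ h3')).symm
  have hTfix : conjHom J hJ (boundedInverse A) = boundedInverse A := by
    ext y
    change J (boundedInverse A (J y)) = _
    rw [hT, hJ]
  have hsa := H.isSelfAdjoint_inverse
  -- Conjugation by `J` is only a real star-algebra homomorphism, so the naturality of the calculus
  -- is used over `ℝ`.
  have hreal' : cfc (fun z : ℂ => z * (f (z.re)⁻¹ : ℂ)) (boundedInverse A)
      = cfc (fun t : ℝ => t * f t⁻¹) (boundedInverse A) := by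
    rw [cfc_real_eq_complex (fun t : ℝ => t * f t⁻¹) hsa]
    refine cfc_congr fun z hz => ?_
    obtain ⟨h1, -⟩ := H.spectrum_le hz
    push_cast
    congr 1
    exact Complex.ext (by simp) (by simp [h1])
  have hcont : ContinuousOn (fun t : ℝ => t * f t⁻¹) (spectrum ℝ (boundedInverse A)) := by
    have h1 := H.continuousOn_mul_inv hf
    have h2 : Set.MapsTo (fun t : ℝ => (t : ℂ)) (spectrum ℝ (boundedInverse A))
        (spectrum ℂ (boundedInverse A)) := fun t ht => by
      simpa using (spectrum.algebraMap_mem ℂ ht)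
    have h3 := Complex.continuous_re.comp_continuousOn
      (h1.comp Complex.continuous_ofReal.continuousOn h2)
    refine h3.congr fun t _ => ?_
    simp
  have hcomm : ∀ y, J (cfc (fun t : ℝ => t * f t⁻¹) (boundedInverse A) (J y))
      = cfc (fun t : ℝ => t * f t⁻¹) (boundedInverse A) y := by
    intro y
    have hcφ : Continuous (conjHom J hJ) := by
      refine AddMonoidHomClass.continuous_of_bound (conjHom J hJ) 1 fun S => ?_
      refine ContinuousLinearMap.opNorm_le_bound _ (by positivity) fun x => ?_
      change ‖J (S (J x))‖ ≤ _
      rw [J.norm_map, one_mul]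
      exact (S.le_opNorm _).trans (by rw [J.norm_map])
    have h := StarAlgHom.map_cfc (conjHom J hJ) (fun t : ℝ => t * f t⁻¹) (boundedInverse A)
      hcont hcφ hsa (by rw [hTfix]; exact hsa)
    rw [hTfix] at h
    exact DFunLike.congr_fun h y
  have key : (fun x => boundedFC A (fun e => (f e : ℂ)) (J x))
      = fun x => J (boundedFC A (fun e => (f e : ℂ)) x) := by
    refine H.dense_range.equalizer ((ContinuousLinearMap.continuous _).comp J.continuous)
      (J.continuous.comp (ContinuousLinearMap.continuous _)) (funext fun y => ?_)
    simp only [Function.comp_apply]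
    rw [← hT, H.apply_inverse hf, H.apply_inverse hf, hreal', ← hcomm y, hJ]
  exact congrFun key x

end Calculus

/-! ### Bounds for the Bose function and for its thermal factors. -/

section BoseFunction
variable {β : ℝ}

theorem bose_pos (hβ : 0 < β) {e : ℝ} (he : 0 < e) : 0 < bose β e :=
  inv_pos.2 (sub_pos.2 (Real.one_lt_exp_iff.2 (mul_pos hβ he)))

theorem continuousOn_bose (hβ : 0 < β) : ContinuousOn (bose β) (Set.Ioi 0) := by
  refine ContinuousOn.inv₀ (by fun_prop) fun e he => ?_
  exact (sub_pos.2 (Real.one_lt_exp_iff.2 (mul_pos hβ he))).ne'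

theorem bose_anti (hβ : 0 < β) {d e : ℝ} (hd : 0 < d) (he : d ≤ e) : bose β e ≤ bose β d := by
  refine inv_anti₀ (sub_pos.2 (Real.one_lt_exp_iff.2 (mul_pos hβ hd))) ?_
  gcongr

theorem bose_mul_exp (hβ : 0 < β) {e : ℝ} (he : 0 < e) :
    bose β e * Real.exp (β * e) = 1 + bose β e := by
  have h := (sub_pos.2 (Real.one_lt_exp_iff.2 (mul_pos hβ he))).ne'
  unfold bose
  field_simp
  ring

/-- The function `e ↦ (1 + ρ(e)) e^{-s e}`. -/
def thermalCreate (β s e : ℝ) : ℝ := (1 + bose β e) * Real.exp (-(s * e))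

/-- The function `e ↦ ρ(e) e^{s e}`. -/
def thermalAnnih (β s e : ℝ) : ℝ := bose β e * Real.exp (s * e)

theorem thermalCreate_pos (hβ : 0 < β) (s : ℝ) {e : ℝ} (he : 0 < e) : 0 < thermalCreate β s e :=
  mul_pos (by linarith [bose_pos hβ he]) (Real.exp_pos _)

theorem thermalAnnih_pos (hβ : 0 < β) (s : ℝ) {e : ℝ} (he : 0 < e) : 0 < thermalAnnih β s e :=
  mul_pos (bose_pos hβ he) (Real.exp_pos _)

/-- The condition `|ν| < m` keeps `e - ν` at least `m - |ν| > 0`, away from the pole of the Bose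
function. -/
theorem bddCont_shift {m ν : ℝ} (hν : |ν| < m) {F : ℝ → ℝ} (hF : ContinuousOn F (Set.Ioi 0))
    (hb : ∀ d, 0 < d → ∃ C, ∀ e, d ≤ e → |F e| ≤ C) : BddCont m fun e => (F (e - ν) : ℂ) := by
  obtain ⟨C, hC⟩ := hb (m - |ν|) (by linarith)
  have h := le_abs_self ν
  refine BddCont.of_real (f := fun e => F (e - ν)) (C := C) ?_ fun e he => hC _ (by linarith)
  refine hF.comp (by fun_prop) fun e he => ?_
  have : m ≤ e := he
  exact Set.mem_Ioi.2 (by linarith)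

theorem bddCont_bose {m ν : ℝ} (hβ : 0 < β) (hν : |ν| < m) :
    BddCont m fun e => (bose β (e - ν) : ℂ) := by
  refine bddCont_shift hν (continuousOn_bose hβ) fun d hd => ⟨bose β d, fun e he => ?_⟩
  rw [abs_of_pos (bose_pos hβ (hd.trans_le he))]
  exact bose_anti hβ hd he

theorem bddCont_sqrt_bose {m ν : ℝ} (hβ : 0 < β) (hν : |ν| < m) :
    BddCont m fun e => ((√(bose β (e - ν)) : ℝ) : ℂ) := by
  refine bddCont_shift (F := fun e => √(bose β e)) hν
    (Real.continuous_sqrt.comp_continuousOn (continuousOn_bose hβ)) fun d hd => ⟨√(bose β d), fun e he => ?_⟩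
  rw [abs_of_nonneg (Real.sqrt_nonneg _)]
  exact Real.sqrt_le_sqrt (bose_anti hβ hd he)

theorem bddCont_sqrt_one_add_bose {m ν : ℝ} (hβ : 0 < β) (hν : |ν| < m) :
    BddCont m fun e => ((√(1 + bose β (e - ν)) : ℝ) : ℂ) := by
  refine bddCont_shift (F := fun e => √(1 + bose β e)) hν
    (Real.continuous_sqrt.comp_continuousOn (continuousOn_const.add (continuousOn_bose hβ)))
    fun d hd => ⟨√(1 + bose β d), fun e he => ?_⟩
  rw [abs_of_nonneg (Real.sqrt_nonneg _)]
  exact Real.sqrt_le_sqrt (by linarith [bose_anti hβ hd he])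

theorem bddCont_thermalCreate {m ν s : ℝ} (hβ : 0 < β) (hν : |ν| < m) (hs : 0 ≤ s) :
    BddCont m fun e => (thermalCreate β s (e - ν) : ℂ) := by
  refine bddCont_shift hν ?_ fun d hd => ⟨1 + bose β d, fun e he => ?_⟩
  · exact (continuousOn_const.add (continuousOn_bose hβ)).mul (by fun_prop)
  · have he0 := hd.trans_le he
    have h1 := bose_pos hβ he0
    rw [abs_of_pos (thermalCreate_pos hβ s he0)]
    have h2 : Real.exp (-(s * e)) ≤ 1 := Real.exp_le_one_iff.2 (by nlinarith)
    calc (1 + bose β e) * Real.exp (-(s * e)) ≤ (1 + bose β e) * 1 := by gcongr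
      _ ≤ 1 + bose β d := by linarith [bose_anti hβ hd he]

/-- The growth of `e^{se}` is compensated by the Bose factor exactly up to `s = β`, where `ρ(e)
e^{βe} = 1 + ρ(e)`. -/
theorem bddCont_thermalAnnih {m ν s : ℝ} (hβ : 0 < β) (hν : |ν| < m) (hs : s ≤ β) :
    BddCont m fun e => (thermalAnnih β s (e - ν) : ℂ) := by
  refine bddCont_shift hν ?_ fun d hd => ⟨1 + bose β d, fun e he => ?_⟩
  · exact (continuousOn_bose hβ).mul (by fun_prop)
  · have he0 := hd.trans_le he
    have h1 := bose_pos hβ he0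
    rw [abs_of_pos (thermalAnnih_pos hβ s he0)]
    calc bose β e * Real.exp (s * e) ≤ bose β e * Real.exp (β * e) := by gcongr
      _ = 1 + bose β e := bose_mul_exp hβ he0
      _ ≤ 1 + bose β d := by linarith [bose_anti hβ hd he]

theorem bddCont_phase {m ν t : ℝ} :
    BddCont m fun e => Complex.exp (Complex.I * t * ((e - ν : ℝ) : ℂ)) := by
  refine ⟨by fun_prop, 1, fun e _ => ?_⟩
  rw [mul_assoc, ← Complex.ofReal_mul, mul_comm, Complex.norm_exp_ofReal_mul_I]

end BoseFunction

/-! ### Araki-Woods Weyl operators, their time evolution and their gauge rotations. -/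

section OneParticleSpace
variable {𝔥 : Type*} [NormedAddCommGroup 𝔥] [InnerProductSpace ℂ 𝔥] [CompleteSpace 𝔥]
  {ε : 𝔥 →ₗ.[ℂ] 𝔥} {m β μ : ℝ}

theorem energyFC_apply (f : ℝ → ℂ) (x : OneParticle 𝔥) : energyFC ε μ f x =
    WithLp.toLp 2 (boundedFC ε (fun e => f (e - μ)) x.fst, boundedFC ε (fun e => f (e + μ)) x.snd) :=
  rfl

theorem inner_prod_eq {E F : Type*} [NormedAddCommGroup E] [InnerProductSpace ℂ E]
    [NormedAddCommGroup F] [InnerProductSpace ℂ F] (x y : WithLp 2 (E × F)) :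
    (inner ℂ x y : ℂ) = inner ℂ x.fst y.fst + inner ℂ x.snd y.snd := rfl

/-- The Araki-Woods vector `(1+ρ)^{1/2} x ⊕ ρ̄^{1/2} x̄`. -/
def dvec (ε : 𝔥 →ₗ.[ℂ] 𝔥) (β μ : ℝ) (x : OneParticle 𝔥) : Doubled 𝔥 :=
  WithLp.toLp 2 (energyFC ε μ (fun e => (√(1 + bose β e) : ℝ)) x,
      ConjSpace.bar (energyFC ε μ (fun e => (√(bose β e) : ℝ)) x))

theorem weyl_eq (x : OneParticle 𝔥) : weyl ε β μ x = fockWeyl (dvec ε β μ x) := rfl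

theorem dvec_add (x y : OneParticle 𝔥) : dvec ε β μ (x + y) = dvec ε β μ x + dvec ε β μ y := by
  unfold dvec
  rw [map_add, map_add, map_add]
  rfl

theorem dvec_zero : dvec ε β μ 0 = 0 := by
  have := dvec_add (ε := ε) (β := β) (μ := μ) 0 0
  simpa using this

theorem dvec_neg (x : OneParticle 𝔥) : dvec ε β μ (-x) = -dvec ε β μ x := by
  have := dvec_add (ε := ε) (β := β) (μ := μ) x (-x)
  rw [add_neg_cancel, dvec_zero] at this
  exact (neg_eq_of_add_eq_zero_right this.symm).symm

theorem continuous_bar {E : Type*} [NormedAddCommGroup E] [InnerProductSpace ℂ E] :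
    Continuous (ConjSpace.bar : E → ConjSpace E) := continuous_id

theorem continuous_dvec : Continuous (dvec ε β μ) := by
  unfold dvec
  refine (WithLp.prod_continuous_toLp 2 _ _).comp (Continuous.prodMk ?_ ?_)
  · exact ContinuousLinearMap.continuous _
  · exact continuous_bar.comp (ContinuousLinearMap.continuous _)

/-- In the terms with `ρ` alone `x` and `y` change places, since they come from the conjugate space.
Writing `ε + μ` as `ε - (-μ)` lets one argument with `ν = ±μ` treat both charges. -/
theorem inner_dvec (H : IsGapped ε m) (hβ : 0 < β) (hμm : |μ| < m) (x y : OneParticle 𝔥) :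
    (inner ℂ (dvec ε β μ x) (dvec ε β μ y) : ℂ) =
      inner ℂ x.fst (boundedFC ε (fun e => ((1 + bose β (e - μ) : ℝ) : ℂ)) y.fst)
      + inner ℂ x.snd (boundedFC ε (fun e => ((1 + bose β (e - -μ) : ℝ) : ℂ)) y.snd)
      + (inner ℂ y.fst (boundedFC ε (fun e => (bose β (e - μ) : ℂ)) x.fst)
      + inner ℂ y.snd (boundedFC ε (fun e => (bose β (e - -μ) : ℂ)) x.snd)) := by
  have hμ' : |-μ| < m := by rwa [abs_neg]
  have key : ∀ ν, |ν| < m → (∀ x y : 𝔥,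
      (inner ℂ (boundedFC ε (fun e => ((√(1 + bose β (e - ν)) : ℝ) : ℂ)) x)
        (boundedFC ε (fun e => ((√(1 + bose β (e - ν)) : ℝ) : ℂ)) y) : ℂ) =
      inner ℂ x (boundedFC ε (fun e => ((1 + bose β (e - ν) : ℝ) : ℂ)) y)) ∧ ∀ x y : 𝔥,
      (inner ℂ (boundedFC ε (fun e => ((√(bose β (e - ν)) : ℝ) : ℂ)) x)
        (boundedFC ε (fun e => ((√(bose β (e - ν)) : ℝ) : ℂ)) y) : ℂ) =
      inner ℂ x (boundedFC ε (fun e => (bose β (e - ν) : ℂ)) y) := by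
    intro ν hν
    have h0 : ∀ e, m ≤ e → 0 < bose β (e - ν) := fun e he =>
      bose_pos hβ (by linarith [le_abs_self ν])
    have h1 := bddCont_sqrt_one_add_bose hβ hν
    have h2 := bddCont_sqrt_bose hβ hν
    have h3 := bddCont_bose hβ hν
    have h4 : BddCont m fun e => ((1 + bose β (e - ν) : ℝ) : ℂ) := by
      have := (BddCont.const (m := m) 1).add h3
      simpa using this
    constructor
    · intro x y
      rw [H.inner_fc_real_left h1, H.fc_mul_apply h1 h1]
      congr 2
      refine H.fc_congr (h1.mul h1) h4 fun e he => ?_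
      rw [← Complex.ofReal_mul, Real.mul_self_sqrt (by linarith [h0 e he])]
    · intro x y
      rw [H.inner_fc_real_left h2, H.fc_mul_apply h2 h2]
      congr 2
      refine H.fc_congr (h2.mul h2) h3 fun e he => ?_
      rw [← Complex.ofReal_mul, Real.mul_self_sqrt (h0 e he).le]
  have k1 := key μ hμm
  have k2 := key (-μ) hμ'
  rw [← k1.1, ← k1.2, ← k2.1, ← k2.2]
  simp only [sub_neg_eq_add]
  rfl

/-- The symplectic form of the Weyl relations is that of `X`. -/
theorem inner_dvec_sub (H : IsGapped ε m) (hβ : 0 < β) (hμm : |μ| < m) (x y : OneParticle 𝔥) :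
    (inner ℂ (dvec ε β μ x) (dvec ε β μ y) - inner ℂ (dvec ε β μ y) (dvec ε β μ x) : ℂ)
      = inner ℂ x y - inner ℂ y x := by
  have key : ∀ ν, |ν| < m → ∀ x : 𝔥, boundedFC ε (fun e => ((1 + bose β (e - ν) : ℝ) : ℂ)) x =
      x + boundedFC ε (fun e => (bose β (e - ν) : ℂ)) x := by
    intro ν hν x
    have h := H.fc_add (BddCont.const 1) (bddCont_bose hβ hν)
    rw [H.fc_one] at h
    have := DFunLike.congr_fun h x
    simp only [add_apply, one_apply_eq_self] at this
    simp [this]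
  rw [inner_dvec H hβ hμm, inner_dvec H hβ hμm]
  simp only [key μ hμm, key (-μ) (by rwa [abs_neg]), inner_add_right, inner_prod_eq]
  ring

theorem weyl_mul (H : IsGapped ε m) (hβ : 0 < β) (hμm : |μ| < m) (x y : OneParticle 𝔥) :
    weyl ε β μ x * weyl ε β μ y =
      Complex.exp (-(inner ℂ x y - inner ℂ y x) / 4) • weyl ε β μ (x + y) := by
  rw [weyl_eq, weyl_eq, weyl_eq, fockWeyl_mul, inner_dvec_sub H hβ hμm, dvec_add]

theorem weyl_zero : weyl ε β μ 0 = 1 := by rw [weyl_eq, dvec_zero, fockWeyl_zero]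

theorem star_weyl (x : OneParticle 𝔥) : star (weyl ε β μ x) = weyl ε β μ (-x) := by
  rw [weyl_eq, weyl_eq, star_fockWeyl, dvec_neg]

theorem norm_weyl_apply (x : OneParticle 𝔥) (ψ : ArakiWoods 𝔥) : ‖weyl ε β μ x ψ‖ = ‖ψ‖ :=
  norm_fockWeyl_apply _ _

theorem continuous_weyl_apply (ψ : ArakiWoods 𝔥) : Continuous fun x => weyl ε β μ x ψ :=
  (continuous_fockWeyl_apply ψ).comp continuous_dvec

section Implementers
variable {V V' : OneParticle 𝔥 →L[ℂ] OneParticle 𝔥}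

theorem inner_blockDiag_mapCLM (hV : ∀ x y, (inner ℂ (V x) (V y) : ℂ) = inner ℂ x y)
    (x y : Doubled 𝔥) : (inner ℂ (blockDiag V (ConjSpace.mapCLM V) x)
      (blockDiag V (ConjSpace.mapCLM V) y) : ℂ) = inner ℂ x y := by
  rw [inner_prod_eq, inner_prod_eq]
  exact congrArg₂ (· + ·) (hV _ _) (hV (ConjSpace.bar.symm y.snd) (ConjSpace.bar.symm x.snd))

theorem blockDiag_mapCLM_mul (V V' : OneParticle 𝔥 →L[ℂ] OneParticle 𝔥) :
    (blockDiag V (ConjSpace.mapCLM V) * blockDiag V' (ConjSpace.mapCLM V') :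
      Doubled 𝔥 →L[ℂ] Doubled 𝔥) = blockDiag (V * V') (ConjSpace.mapCLM (V * V')) := rfl

theorem blockDiag_mapCLM_one :
    (blockDiag 1 (ConjSpace.mapCLM 1) : Doubled 𝔥 →L[ℂ] Doubled 𝔥) = 1 := rfl

theorem doubledQuant_mul (hV : ∀ x y, (inner ℂ (V x) (V y) : ℂ) = inner ℂ x y)
    (hV' : ∀ x y, (inner ℂ (V' x) (V' y) : ℂ) = inner ℂ x y) :
    doubledQuant V * doubledQuant V' = doubledQuant (V * V') := by
  unfold doubledQuant
  rw [secondQuant_mul (inner_blockDiag_mapCLM hV) (inner_blockDiag_mapCLM hV'),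
    blockDiag_mapCLM_mul]

theorem doubledQuant_one : doubledQuant (1 : OneParticle 𝔥 →L[ℂ] OneParticle 𝔥) = 1 := by
  unfold doubledQuant
  rw [blockDiag_mapCLM_one, secondQuant_one]

theorem star_doubledQuant (hV : ∀ x y, (inner ℂ (V x) (V y) : ℂ) = inner ℂ x y)
    (hV' : ∀ x y, (inner ℂ (V' x) (V' y) : ℂ) = inner ℂ x y) (h : V' * V = 1) :
    star (doubledQuant V) = doubledQuant V' := by
  unfold doubledQuant
  refine star_secondQuant (inner_blockDiag_mapCLM hV) (inner_blockDiag_mapCLM hV') ?_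
  rw [blockDiag_mapCLM_mul, h, blockDiag_mapCLM_one]

theorem doubledQuant_vacuum (hV : ∀ x y, (inner ℂ (V x) (V y) : ℂ) = inner ℂ x y) :
    doubledQuant V (expVec 0) = expVec 0 := secondQuant_vacuum (inner_blockDiag_mapCLM hV)

theorem doubledQuant_mul_weyl (hV : ∀ x y, (inner ℂ (V x) (V y) : ℂ) = inner ℂ x y)
    (x : OneParticle 𝔥)
    (h1 : V (energyFC ε μ (fun e => (√(1 + bose β e) : ℝ)) x)
      = energyFC ε μ (fun e => (√(1 + bose β e) : ℝ)) (V x))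
    (h2 : V (energyFC ε μ (fun e => (√(bose β e) : ℝ)) x)
      = energyFC ε μ (fun e => (√(bose β e) : ℝ)) (V x)) :
    doubledQuant V * weyl ε β μ x = weyl ε β μ (V x) * doubledQuant V := by
  have h : blockDiag V (ConjSpace.mapCLM V) (dvec ε β μ x) = dvec ε β μ (V x) := by
    unfold dvec
    rw [← h1, ← h2]
    rfl
  rw [weyl_eq, weyl_eq, ← h]
  exact secondQuant_mul_fockWeyl (inner_blockDiag_mapCLM hV) _

end Implementers

section Dynamics

/-- The one-particle time evolution `e^{ita}`. -/
def evol (ε : 𝔥 →ₗ.[ℂ] 𝔥) (μ t : ℝ) : OneParticle 𝔥 →L[ℂ] OneParticle 𝔥 :=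
  energyFC ε μ fun e => Complex.exp (Complex.I * t * e)

theorem evol_apply (t : ℝ) (x : OneParticle 𝔥) : evol ε μ t x = WithLp.toLp 2
    (boundedFC ε (fun e => Complex.exp (Complex.I * t * ((e - μ : ℝ) : ℂ))) x.fst,
     boundedFC ε (fun e => Complex.exp (Complex.I * t * ((e - -μ : ℝ) : ℂ))) x.snd) := by
  simp only [sub_neg_eq_add]
  rfl

theorem phase_fc_mul (H : IsGapped ε m) (ν t s : ℝ) (x : 𝔥) :
    boundedFC ε (fun e => Complex.exp (Complex.I * t * ((e - ν : ℝ) : ℂ)))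
      (boundedFC ε (fun e => Complex.exp (Complex.I * s * ((e - ν : ℝ) : ℂ))) x)
    = boundedFC ε (fun e => Complex.exp (Complex.I * (t + s : ℝ) * ((e - ν : ℝ) : ℂ))) x := by
  rw [H.fc_mul_apply bddCont_phase bddCont_phase]
  congr 2
  ext e
  rw [← Complex.exp_add]
  push_cast
  congr 1; ring

theorem phase_fc_zero (H : IsGapped ε m) (ν : ℝ) (x : 𝔥) :
    boundedFC ε (fun e => Complex.exp (Complex.I * (0 : ℝ) * ((e - ν : ℝ) : ℂ))) x = x := by
  simp [H.fc_one]

theorem evol_mul (H : IsGapped ε m) (t s : ℝ) : evol ε μ t * evol ε μ s = evol ε μ (t + s) := by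
  refine ContinuousLinearMap.ext fun x => ?_
  rw [mul_apply_eq_comp, evol_apply, evol_apply, evol_apply]
  simp only [WithLp.toLp_fst, WithLp.toLp_snd, phase_fc_mul H]

theorem evol_zero (H : IsGapped ε m) : evol ε μ 0 = 1 := by
  refine ContinuousLinearMap.ext fun x => ?_
  rw [evol_apply, phase_fc_zero H, phase_fc_zero H]
  rfl

theorem inner_phase_fc (H : IsGapped ε m) (ν t : ℝ) (x y : 𝔥) :
    (inner ℂ (boundedFC ε (fun e => Complex.exp (Complex.I * t * ((e - ν : ℝ) : ℂ))) x) y : ℂ) =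
    inner ℂ x (boundedFC ε (fun e => Complex.exp (Complex.I * (-t : ℝ) * ((e - ν : ℝ) : ℂ))) y) := by
  rw [H.inner_fc_left bddCont_phase]
  congr 3
  ext e
  rw [RCLike.star_def, ← Complex.exp_conj]
  simp only [map_mul, Complex.conj_I, Complex.conj_ofReal]
  push_cast
  congr 1; ring

theorem inner_evol (H : IsGapped ε m) (t : ℝ) (x y : OneParticle 𝔥) :
    (inner ℂ (evol ε μ t x) (evol ε μ t y) : ℂ) = inner ℂ x y := by
  rw [evol_apply, evol_apply, inner_prod_eq, inner_prod_eq]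
  simp only [WithLp.toLp_fst, WithLp.toLp_snd, inner_phase_fc H, phase_fc_mul H, neg_add_cancel,
    phase_fc_zero H]

theorem evol_comm (H : IsGapped ε m) (t : ℝ) {f : ℝ → ℝ} (h1 : BddCont m fun e => (f (e - μ) : ℂ))
    (h2 : BddCont m fun e => (f (e - -μ) : ℂ)) (x : OneParticle 𝔥) :
    evol ε μ t (energyFC ε μ (fun e => (f e : ℂ)) x)
      = energyFC ε μ (fun e => (f e : ℂ)) (evol ε μ t x) := by
  rw [evol_apply, evol_apply, energyFC_apply, energyFC_apply]
  simp only [← sub_neg_eq_add _ μ]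
  simp only [WithLp.toLp_fst, WithLp.toLp_snd, H.fc_mul_apply bddCont_phase h1,
    H.fc_mul_apply h1 bddCont_phase, H.fc_mul_apply bddCont_phase h2,
    H.fc_mul_apply h2 bddCont_phase, mul_comm]

theorem liouvilleGroup_eq (t : ℝ) : liouvilleGroup ε μ t = doubledQuant (evol ε μ t) := rfl

theorem liouvilleGroup_mul (H : IsGapped ε m) (t s : ℝ) :
    liouvilleGroup ε μ t * liouvilleGroup ε μ s = liouvilleGroup ε μ (t + s) := by
  simp only [liouvilleGroup_eq]
  rw [doubledQuant_mul (inner_evol H t) (inner_evol H s), evol_mul H]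

theorem liouvilleGroup_zero (H : IsGapped ε m) : liouvilleGroup ε μ 0 = 1 := by
  rw [liouvilleGroup_eq, evol_zero H, doubledQuant_one]

theorem liouvilleGroup_mul_neg (H : IsGapped ε m) (t : ℝ) :
    liouvilleGroup ε μ t * liouvilleGroup ε μ (-t) = 1 := by
  rw [liouvilleGroup_mul H, add_neg_cancel, liouvilleGroup_zero H]

theorem liouvilleGroup_mul_weyl (H : IsGapped ε m) (hβ : 0 < β) (hμm : |μ| < m) (t : ℝ)
    (x : OneParticle 𝔥) : liouvilleGroup ε μ t * weyl ε β μ x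
      = weyl ε β μ (evol ε μ t x) * liouvilleGroup ε μ t := by
  have hμ' : |-μ| < m := by rwa [abs_neg]
  refine doubledQuant_mul_weyl (inner_evol H t) x ?_ ?_
  · exact evol_comm (f := fun e => √(1 + bose β e)) H t (bddCont_sqrt_one_add_bose hβ hμm)
      (bddCont_sqrt_one_add_bose hβ hμ') x
  · exact evol_comm (f := fun e => √(bose β e)) H t (bddCont_sqrt_bose hβ hμm)
      (bddCont_sqrt_bose hβ hμ') x

end Dynamics

section Gauge

/-- The one-particle gauge rotation by a phase. -/
def rot (w : ℂ) : OneParticle 𝔥 →L[ℂ] OneParticle 𝔥 :=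
  blockDiag (w • ContinuousLinearMap.id ℂ 𝔥) (star w • ContinuousLinearMap.id ℂ 𝔥)

theorem rot_apply (w : ℂ) (x : OneParticle 𝔥) :
    rot w x = WithLp.toLp 2 (w • x.fst, star w • x.snd) := rfl

theorem inner_rot {w : ℂ} (hw : star w * w = 1) (x y : OneParticle 𝔥) :
    (inner ℂ (rot w x) (rot w y) : ℂ) = inner ℂ x y := by
  rw [rot_apply, rot_apply, inner_prod_eq, inner_prod_eq]
  simp only [WithLp.toLp_fst, WithLp.toLp_snd, inner_smul_left, inner_smul_right, RCLike.star_def,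
    Complex.conj_conj] at hw ⊢
  linear_combination (inner ℂ x.fst y.fst + inner ℂ x.snd y.snd) * hw

theorem star_mul_self_exp (t : ℝ) :
    star (Complex.exp (Complex.I * t)) * Complex.exp (Complex.I * t) = 1 := by
  rw [RCLike.star_def, ← Complex.exp_conj, ← Complex.exp_add]
  simp

theorem gaugeGroup_eq (t : ℝ) :
    gaugeGroup 𝔥 t = doubledQuant (rot (Complex.exp (Complex.I * t))) := by
  unfold gaugeGroup rot
  congr 3
  rw [RCLike.star_def, ← Complex.exp_conj]
  simp

theorem rot_comm (w : ℂ) (f : ℝ → ℂ) (x : OneParticle 𝔥) :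
    rot w (energyFC ε μ f x) = energyFC ε μ f (rot w x) := by
  simp only [rot_apply, energyFC_apply, WithLp.toLp_fst, WithLp.toLp_snd, map_smul]

theorem rot_mul (w w' : ℂ) :
    (rot w * rot w' : OneParticle 𝔥 →L[ℂ] OneParticle 𝔥) = rot (w * w') := by
  refine ContinuousLinearMap.ext fun x => ?_
  simp only [mul_apply_eq_comp, rot_apply, WithLp.toLp_fst, WithLp.toLp_snd, smul_smul, star_mul']

theorem rot_one : (rot 1 : OneParticle 𝔥 →L[ℂ] OneParticle 𝔥) = 1 := by
  refine ContinuousLinearMap.ext fun x => ?_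
  simp only [rot_apply, star_one, one_smul]
  rfl

theorem gaugeGroup_vacuum (t : ℝ) : gaugeGroup 𝔥 t (expVec 0) = expVec 0 := by
  rw [gaugeGroup_eq]; exact doubledQuant_vacuum (inner_rot (star_mul_self_exp t))

theorem gaugeGroup_mul_weyl (t : ℝ) (x : OneParticle 𝔥) : gaugeGroup 𝔥 t * weyl ε β μ x
    = weyl ε β μ (rot (Complex.exp (Complex.I * t)) x) * gaugeGroup 𝔥 t := by
  rw [gaugeGroup_eq]
  exact doubledQuant_mul_weyl (inner_rot (star_mul_self_exp t)) x (rot_comm _ _ _) (rot_comm _ _ _)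

theorem evol_rot (t : ℝ) (w : ℂ) (x : OneParticle 𝔥) :
    evol ε μ t (rot w x) = rot w (evol ε μ t x) := (rot_comm w _ x).symm

end Gauge

/-- The vector `(u, ū)` of `X_κ`. -/
def kvec (J : 𝔥 ≃ₗᵢ⋆[ℂ] 𝔥) (u : 𝔥) : OneParticle 𝔥 := WithLp.toLp 2 (u, J u)

theorem kvec_mem (J : 𝔥 ≃ₗᵢ⋆[ℂ] 𝔥) (hJ : ∀ x, J (J x) = x) (u : 𝔥) : kvec J u ∈ realSubspace J := by
  simp [realSubspace, kvec, hJ]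

theorem eq_kvec {J : 𝔥 ≃ₗᵢ⋆[ℂ] 𝔥} {x : OneParticle 𝔥} (hx : x ∈ realSubspace J) :
    x = kvec J x.fst := by
  have h : WithLp.toLp 2 (J x.snd, J x.fst) = x := hx
  have h2 : J x.fst = x.snd := congrArg WithLp.snd h
  rw [kvec, h2]
  rfl

/-- The antilinearity of `J` matches the opposite charge of the second component. Gauge rotations
therefore preserve `X_κ`, and gauge averages of time-zero Weyl operators remain in the time-zero
algebra. -/
theorem rot_kvec (J : 𝔥 ≃ₗᵢ⋆[ℂ] 𝔥) (w : ℂ) (u : 𝔥) : rot w (kvec J u) = kvec J (w • u) := by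
  rw [rot_apply, kvec, kvec, map_smulₛₗ]
  rfl

end OneParticleSpace

/-! ### Haar measure of the circle and averages of Weyl operators. -/

instance : MeasurableSpace Circle := borel Circle
instance : BorelSpace Circle := ⟨rfl⟩

/-- The normalized Haar measure of the circle. -/
def circleHaar : Measure Circle := Measure.haarMeasure ⊤

instance : circleHaar.IsHaarMeasure := inferInstanceAs (Measure.haarMeasure ⊤).IsHaarMeasure

instance : IsProbabilityMeasure circleHaar :=
  ⟨Measure.haarMeasure_self (K₀ := (⊤ : TopologicalSpace.PositiveCompacts Circle))⟩

instance : circleHaar.IsInvInvariant := inferInstance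

theorem map_mul_circleHaar (z : Circle) : circleHaar.map (z * ·) = circleHaar :=
  map_mul_left_eq_self circleHaar z

section Averages
variable {𝔥 : Type*} [NormedAddCommGroup 𝔥] [InnerProductSpace ℂ 𝔥] [CompleteSpace 𝔥]
  {ε : 𝔥 →ₗ.[ℂ] 𝔥} {m β μ : ℝ}
  {Λ : Type*} [TopologicalSpace Λ] [CompactSpace Λ] [MeasurableSpace Λ] [BorelSpace Λ]
  (ν : Measure Λ) [IsFiniteMeasure ν]

theorem integrable_of_continuous {F : Type*} [NormedAddCommGroup F] {f : Λ → F}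
    (hf : Continuous f) : Integrable f ν :=
  hf.integrable_of_hasCompactSupport (HasCompactSupport.of_compactSpace f)

theorem continuous_weyl_comp (x : C(Λ, OneParticle 𝔥)) (ψ : ArakiWoods 𝔥) :
    Continuous fun l => weyl ε β μ (x l) ψ := (continuous_weyl_apply ψ).comp x.continuous

/-- The weak integral of the Weyl operators `W_ω(x(λ))` against a finite measure. -/
def avgWeyl (ε : 𝔥 →ₗ.[ℂ] 𝔥) (β μ : ℝ) (x : C(Λ, OneParticle 𝔥)) :
    ArakiWoods 𝔥 →L[ℂ] ArakiWoods 𝔥 :=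
  LinearMap.mkContinuous
    { toFun := fun ψ => ∫ l, weyl ε β μ (x l) ψ ∂ν
      map_add' := fun ψ φ => by
        simp only [map_add]
        exact integral_add (integrable_of_continuous ν (continuous_weyl_comp x ψ))
          (integrable_of_continuous ν (continuous_weyl_comp x φ))
      map_smul' := fun c ψ => by
        simp only [map_smul]
        exact integral_smul c _ }
    (ν.real Set.univ) fun ψ => by
      refine (norm_integral_le_integral_norm _).trans ?_
      simp [norm_weyl_apply]

theorem avgWeyl_apply (x : C(Λ, OneParticle 𝔥)) (ψ : ArakiWoods 𝔥) :
    avgWeyl ν ε β μ x ψ = ∫ l, weyl ε β μ (x l) ψ ∂ν := rfl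

theorem norm_avgWeyl_apply_le (x : C(Λ, OneParticle 𝔥)) (ψ : ArakiWoods 𝔥) :
    ‖avgWeyl ν ε β μ x ψ‖ ≤ ν.real Set.univ * ‖ψ‖ := by
  rw [avgWeyl_apply]
  refine (norm_integral_le_integral_norm _).trans ?_
  simp [norm_weyl_apply]

theorem clm_avgWeyl {F : Type*} [NormedAddCommGroup F] [NormedSpace ℂ F] [CompleteSpace F]
    (L : ArakiWoods 𝔥 →L[ℂ] F) (x : C(Λ, OneParticle 𝔥)) (ψ : ArakiWoods 𝔥) :
    L (avgWeyl ν ε β μ x ψ) = ∫ l, L (weyl ε β μ (x l) ψ) ∂ν :=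
  (L.integral_comp_comm (integrable_of_continuous ν (continuous_weyl_comp x ψ))).symm

theorem inner_avgWeyl (x : C(Λ, OneParticle 𝔥)) (φ ψ : ArakiWoods 𝔥) :
    (inner ℂ φ (avgWeyl ν ε β μ x ψ) : ℂ) = ∫ l, inner ℂ φ (weyl ε β μ (x l) ψ) ∂ν :=
  clm_avgWeyl ν (innerSL ℂ φ) x ψ

theorem intertwine_avgWeyl {U : ArakiWoods 𝔥 →L[ℂ] ArakiWoods 𝔥} {x y : C(Λ, OneParticle 𝔥)}
    (h : ∀ l, U * weyl ε β μ (x l) = weyl ε β μ (y l) * U) :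
    U * avgWeyl ν ε β μ x = avgWeyl ν ε β μ y * U := by
  refine ContinuousLinearMap.ext fun ψ => ?_
  rw [mul_apply_eq_comp, mul_apply_eq_comp, clm_avgWeyl, avgWeyl_apply]
  congr 1
  funext l
  exact DFunLike.congr_fun (h l) ψ

theorem star_avgWeyl (x : C(Λ, OneParticle 𝔥)) :
    star (avgWeyl ν ε β μ x) = avgWeyl ν ε β μ (-x) := by
  refine ContinuousLinearMap.ext fun ψ => ext_inner_left ℂ fun φ => ?_
  rw [ContinuousLinearMap.star_eq_adjoint, ContinuousLinearMap.adjoint_inner_right,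
    ← inner_conj_symm, inner_avgWeyl, inner_avgWeyl, ← integral_conj]
  congr 1
  funext l
  rw [inner_conj_symm, ← ContinuousLinearMap.adjoint_inner_right,
    ← ContinuousLinearMap.star_eq_adjoint, star_weyl]
  rfl

theorem subset_vonNeumannSpan {H : Type*} [NormedAddCommGroup H] [InnerProductSpace ℂ H]
    [CompleteSpace H] {S : Set (H →L[ℂ] H)} {A : H →L[ℂ] H} (hA : A ∈ S) : A ∈ vonNeumannSpan S := by
  rw [vonNeumannSpan, StarSubalgebra.mem_centralizer_iff]
  intro B hB
  have h1 := (StarSubalgebra.mem_centralizer_iff ℂ).1 hB A hA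
  have h2 := (StarSubalgebra.mem_centralizer_iff ℂ).1 (star_mem hB) A hA
  exact ⟨h1.1.symm, h2.1.symm⟩

/-- An operator in the commutant can be moved through the integral, so the double commutant contains
the averages of its elements. -/
theorem avgWeyl_mem {S : Set (ArakiWoods 𝔥 →L[ℂ] ArakiWoods 𝔥)} {x : C(Λ, OneParticle 𝔥)}
    (h : ∀ l, weyl ε β μ (x l) ∈ vonNeumannSpan S) : avgWeyl ν ε β μ x ∈ vonNeumannSpan S := by
  rw [vonNeumannSpan, StarSubalgebra.mem_centralizer_iff]
  intro B hB
  have h1 := fun l => (StarSubalgebra.mem_centralizer_iff ℂ).1 (h l) B hB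
  exact ⟨intertwine_avgWeyl ν fun l => (h1 l).1, intertwine_avgWeyl ν fun l => (h1 l).2⟩

theorem avgWeyl_mem_field (x : C(Λ, OneParticle 𝔥)) :
    avgWeyl ν ε β μ x ∈ fieldAlgebra ε β μ :=
  avgWeyl_mem ν fun _ => subset_vonNeumannSpan ⟨_, rfl⟩

theorem weyl_mem_timeZero {J : 𝔥 ≃ₗᵢ⋆[ℂ] 𝔥} (hJ : ∀ x, J (J x) = x) (u : 𝔥) :
    weyl ε β μ (kvec J u) ∈ timeZeroAlgebra J ε β μ :=
  subset_vonNeumannSpan ⟨_, kvec_mem J hJ u, rfl⟩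

/-- `λ ↦ (w(λ) u, \overline{w(λ) u})`. -/
def kpath (J : 𝔥 ≃ₗᵢ⋆[ℂ] 𝔥) (w : C(Λ, ℂ)) (u : 𝔥) : C(Λ, OneParticle 𝔥) where
  toFun l := kvec J (w l • u)
  continuous_toFun := by
    unfold kvec
    refine (WithLp.prod_continuous_toLp 2 _ _).comp (Continuous.prodMk ?_ ?_)
    · fun_prop
    · exact J.continuous.comp (by fun_prop)

theorem kpath_apply (J : 𝔥 ≃ₗᵢ⋆[ℂ] 𝔥) (w : C(Λ, ℂ)) (u : 𝔥) (l : Λ) :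
    kpath J w u l = kvec J (w l • u) := rfl

theorem avgWeyl_kpath_mem_timeZero {J : 𝔥 ≃ₗᵢ⋆[ℂ] 𝔥} (hJ : ∀ x, J (J x) = x) (w : C(Λ, ℂ)) (u : 𝔥) :
    avgWeyl ν ε β μ (kpath J w u) ∈ timeZeroAlgebra J ε β μ :=
  avgWeyl_mem ν fun _ => weyl_mem_timeZero hJ _

/-- The time translate of a continuous family of vectors. -/
def evolPath (ε : 𝔥 →ₗ.[ℂ] 𝔥) (μ t : ℝ) (x : C(Λ, OneParticle 𝔥)) : C(Λ, OneParticle 𝔥) where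
  toFun l := evol ε μ t (x l)
  continuous_toFun := (evol ε μ t).continuous.comp x.continuous

theorem liouvilleGroup_mul_avgWeyl (H : IsGapped ε m) (hβ : 0 < β) (hμm : |μ| < m) (t : ℝ)
    (x : C(Λ, OneParticle 𝔥)) : liouvilleGroup ε μ t * avgWeyl ν ε β μ x =
      avgWeyl ν ε β μ (evolPath ε μ t x) * liouvilleGroup ε μ t :=
  intertwine_avgWeyl (y := evolPath ε μ t x) ν fun l => liouvilleGroup_mul_weyl H hβ hμm t (x l)

theorem dynamics_avgWeyl (H : IsGapped ε m) (hβ : 0 < β) (hμm : |μ| < m) (t : ℝ)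
    (x : C(Λ, OneParticle 𝔥)) : dynamics ε μ t (avgWeyl ν ε β μ x) =
      avgWeyl ν ε β μ (evolPath ε μ t x) := by
  rw [dynamics, liouvilleGroup_mul_avgWeyl ν H hβ hμm, mul_assoc, liouvilleGroup_mul_neg H, mul_one]

theorem continuous_circle_coe : Continuous fun θ : Circle => (θ : ℂ) := continuous_subtype_val

/-- The inclusion of the circle in the complex plane. -/
def circleIncl : C(Circle, ℂ) := ⟨fun θ => θ, continuous_circle_coe⟩

/-- The orbit of a vector under the gauge group. -/
def orbit (x : OneParticle 𝔥) : C(Circle, OneParticle 𝔥) where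
  toFun θ := rot θ x
  continuous_toFun := by
    simp only [rot_apply]
    refine (WithLp.prod_continuous_toLp 2 _ _).comp (Continuous.prodMk ?_ ?_)
    · exact continuous_circle_coe.smul continuous_const
    · exact continuous_circle_coe.star.smul continuous_const

theorem orbit_apply (x : OneParticle 𝔥) (θ : Circle) : orbit x θ = rot θ x := rfl

theorem kpath_circleIncl (J : 𝔥 ≃ₗᵢ⋆[ℂ] 𝔥) (u : 𝔥) :
    kpath J circleIncl u = orbit (kvec J u) := by
  ext1 θ
  rw [orbit_apply, rot_kvec]
  rfl

theorem orbit_smul_eq (x : OneParticle 𝔥) (z θ : Circle) : orbit (rot z x) θ = orbit x (z * θ) := by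
  rw [orbit_apply, orbit_apply, ← mul_apply_eq_comp, rot_mul, Circle.coe_mul, mul_comm]

theorem integral_circle_mul {F : Type*} [NormedAddCommGroup F] [NormedSpace ℝ F] (f : Circle → F)
    (z : Circle) : ∫ θ, f (z * θ) ∂circleHaar = ∫ θ, f θ ∂circleHaar :=
  integral_mul_left_eq_self f z

theorem avgWeyl_orbit_rot (x : OneParticle 𝔥) (z : Circle) :
    avgWeyl circleHaar ε β μ (orbit (rot z x)) = avgWeyl circleHaar ε β μ (orbit x) := by
  refine ContinuousLinearMap.ext fun ψ => ?_
  rw [avgWeyl_apply, avgWeyl_apply]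
  simp only [orbit_smul_eq]
  exact integral_circle_mul (fun θ => weyl ε β μ (orbit x θ) ψ) z

/-- Conjugation by `e^{itQ}` only moves the base point of the orbit, and Haar measure does not see
the base point. -/
theorem gaugeGroup_comm_avgWeyl (t : ℝ) (x : OneParticle 𝔥) :
    gaugeGroup 𝔥 t * avgWeyl circleHaar ε β μ (orbit x)
      = avgWeyl circleHaar ε β μ (orbit x) * gaugeGroup 𝔥 t := by
  have h : ∀ θ : Circle, gaugeGroup 𝔥 t * weyl ε β μ (orbit x θ)
      = weyl ε β μ (orbit (rot (Circle.exp t) x) θ) * gaugeGroup 𝔥 t := by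
    intro θ
    rw [gaugeGroup_mul_weyl, orbit_smul_eq, orbit_apply, orbit_apply, ← mul_apply_eq_comp, rot_mul,
      Circle.coe_mul, Circle.coe_exp, mul_comm Complex.I]
  rw [intertwine_avgWeyl circleHaar h, avgWeyl_orbit_rot]

theorem star_gaugeGroup (t : ℝ) : star (gaugeGroup 𝔥 t) = gaugeGroup 𝔥 (-t) := by
  rw [gaugeGroup_eq, gaugeGroup_eq]
  refine star_doubledQuant (inner_rot (star_mul_self_exp _)) (inner_rot (star_mul_self_exp _)) ?_
  rw [rot_mul, ← Complex.exp_add]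
  simp [rot_one]

theorem avgWeyl_orbit_mem_observable (x : OneParticle 𝔥) :
    avgWeyl circleHaar ε β μ (orbit x) ∈ observableAlgebra ε β μ := by
  refine ⟨avgWeyl_mem_field _ _, ?_⟩
  rw [SetLike.mem_coe, StarSubalgebra.mem_centralizer_iff]
  rintro _ ⟨t, rfl⟩
  rw [star_gaugeGroup]
  exact ⟨gaugeGroup_comm_avgWeyl t x, gaugeGroup_comm_avgWeyl (-t) x⟩

theorem avgWeyl_orbit_mem_timeZeroObservables {J : 𝔥 ≃ₗᵢ⋆[ℂ] 𝔥} (hJ : ∀ x, J (J x) = x) (u : 𝔥) :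
    avgWeyl circleHaar ε β μ (orbit (kvec J u)) ∈ timeZeroObservables J ε β μ := by
  refine ⟨avgWeyl_orbit_mem_observable _, ?_⟩
  rw [← kpath_circleIncl]
  exact avgWeyl_kpath_mem_timeZero _ hJ _ _

end Averages

/-! ### Positive elements built from averaged Weyl operators. -/

section Positivity
variable {𝔥 : Type*} [NormedAddCommGroup 𝔥] [InnerProductSpace ℂ 𝔥] [CompleteSpace 𝔥]
  {ε : 𝔥 →ₗ.[ℂ] 𝔥} {m β μ : ℝ} (ν : Measure Circle) [IsProbabilityMeasure ν]

/-- A selfadjoint contraction `A` satisfies `A + 1 ≥ 0`. -/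
theorem isPositive_add_one {H : Type*} [NormedAddCommGroup H] [InnerProductSpace ℂ H]
    [CompleteSpace H] {A : H →L[ℂ] H} (hsa : star A = A) (hA : ∀ ψ, ‖A ψ‖ ≤ ‖ψ‖) :
    (A + 1).IsPositive := by
  refine (ContinuousLinearMap.isPositive_def').2 ⟨?_, fun ψ => ?_⟩
  · rw [IsSelfAdjoint, star_add, hsa, star_one]
  · rw [ContinuousLinearMap.reApplyInnerSelf_apply, add_apply, one_apply_eq_self, inner_add_left,
      map_add]
    have h2 : |RCLike.re (inner ℂ (A ψ) ψ : ℂ)| ≤ ‖ψ‖ * ‖ψ‖ :=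
      (RCLike.abs_re_le_norm _).trans
        ((norm_inner_le_norm _ _).trans (mul_le_mul_of_nonneg_right (hA ψ) (norm_nonneg _)))
    have h3 := (abs_le.1 h2).1
    rw [inner_self_eq_norm_mul_norm]
    linarith

/-- The adjoint replaces `x` by `-x`, that is `θ` by `-θ`, so symmetry of `ν` makes the average
selfadjoint; it is a contraction because `ν` is a probability measure. -/
theorem isPositive_avgWeyl_add_one (hν : ν.map (fun θ => -θ) = ν) (J : 𝔥 ≃ₗᵢ⋆[ℂ] 𝔥) (u : 𝔥) :
    (avgWeyl ν ε β μ (kpath J circleIncl u) + 1).IsPositive := by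
  refine isPositive_add_one ?_ fun ψ => ?_
  · rw [star_avgWeyl]
    refine ContinuousLinearMap.ext fun ψ => ?_
    have h1 : ∀ θ : Circle, (-kpath J circleIncl u) θ = kpath J circleIncl u (-θ) := by
      intro θ
      have : ((-θ : Circle) : ℂ) = -(θ : ℂ) := rfl
      rw [ContinuousMap.neg_apply, kpath_apply, kpath_apply]
      change -kvec J ((θ : ℂ) • u) = kvec J (((-θ : Circle) : ℂ) • u)
      rw [this, neg_smul, kvec, kvec, map_neg]
      rfl
    have h2 := integral_map (μ := ν) (φ := fun θ : Circle => -θ)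
      (f := fun θ => weyl ε β μ (kpath J circleIncl u θ) ψ) continuous_neg.measurable.aemeasurable
      (continuous_weyl_comp (kpath J circleIncl u) ψ).aestronglyMeasurable
    rw [hν] at h2
    rw [avgWeyl_apply, avgWeyl_apply, h2]
    simp only [h1]
  · have h1 := norm_avgWeyl_apply_le (ε := ε) (β := β) (μ := μ) ν (kpath J circleIncl u) ψ
    rwa [probReal_univ, one_mul] at h1

theorem avgWeyl_kpath_zero (J : 𝔥 ≃ₗᵢ⋆[ℂ] 𝔥) : avgWeyl ν ε β μ (kpath J circleIncl 0) = 1 := by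
  refine ContinuousLinearMap.ext fun ψ => ?_
  have h0 : kvec J (0 : 𝔥) = 0 := by simp [kvec]
  rw [avgWeyl_apply]
  simp only [kpath_apply, smul_zero, h0, weyl_zero, one_apply_eq_self]
  simp

end Positivity

/-! ### Integrals of exponentials: analyticity and moments. -/

section ParametricIntegral
variable {Λ : Type*} [TopologicalSpace Λ] [CompactSpace Λ] [MeasurableSpace Λ] [BorelSpace Λ]
  (ν : Measure Λ) [IsFiniteMeasure ν] {H : Type*} [NormedAddCommGroup H] [NormedSpace ℂ H]

theorem differentiable_integral_exp {φ : Λ → ℂ} (hφ : Continuous φ) {L : Λ → H →L[ℂ] ℂ}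
    (hL : Continuous L) : Differentiable ℂ fun x => ∫ l, Complex.exp (φ l + L l x) ∂ν := by
  intro x₀
  obtain ⟨C, hC⟩ := isCompact_univ.exists_bound_of_continuousOn (f := L) hL.continuousOn
  obtain ⟨D, hD⟩ := isCompact_univ.exists_bound_of_continuousOn (f := φ) hφ.continuousOn
  have hmeas : ∀ x, AEStronglyMeasurable (fun l => Complex.exp (φ l + L l x)) ν := fun x =>
    (integrable_of_continuous ν (by fun_prop)).aestronglyMeasurable
  refine (hasFDerivAt_integral_of_dominated_of_fderiv_le (𝕜 := ℂ)
    (F := fun x l => Complex.exp (φ l + L l x))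
    (F' := fun x l => Complex.exp (φ l + L l x) • L l) (s := Metric.ball x₀ 1)
    (bound := fun _ => Real.exp (D + C * (‖x₀‖ + 1)) * C) (Metric.ball_mem_nhds x₀ one_pos)
    (Filter.Eventually.of_forall hmeas) (integrable_of_continuous ν (by fun_prop))
    (integrable_of_continuous ν (by fun_prop)).aestronglyMeasurable ?_ (integrable_const _)
    ?_).differentiableAt
  · refine Filter.Eventually.of_forall fun l x hx => ?_
    have hC' := hC l (Set.mem_univ l)
    have hC0 : 0 ≤ C := (norm_nonneg _).trans hC'
    rw [norm_smul, Complex.norm_exp]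
    gcongr
    · rw [Complex.add_re]
      have h1 : (φ l).re ≤ D := (Complex.re_le_norm _).trans (hD l (Set.mem_univ l))
      have h3 : ‖x‖ ≤ ‖x₀‖ + 1 := by
        have := norm_sub_norm_le x x₀
        rw [Metric.mem_ball, dist_eq_norm] at hx
        linarith
      have h2 : (L l x).re ≤ C * (‖x₀‖ + 1) :=
        (Complex.re_le_norm _).trans (((L l).le_opNorm x).trans (by gcongr))
      linarith
  · refine Filter.Eventually.of_forall fun l x _ => ?_
    exact ((L l).hasFDerivAt.const_add (φ l)).cexp

/-- If `∫ e^{wS}` is real for all `w ≤ 0` then all the moments of `S` are real. -/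
theorem moments_real_of_integral_exp_real {S : Λ → ℂ} (hS : Continuous S)
    (h : ∀ w : ℝ, w ≤ 0 → (∫ l, Complex.exp (w * S l) ∂ν).im = 0) (n : ℕ) :
    (∫ l, S l ^ n ∂ν).im = 0 := by
  obtain ⟨C, hC⟩ := isCompact_univ.exists_bound_of_continuousOn (f := S) hS.continuousOn
  set b : ℕ → ℝ := fun n => (∫ l, S l ^ n ∂ν).im / n.factorial with hb
  set g : ℝ → ℝ := fun w => (∫ l, Complex.exp (w * S l) ∂ν).im with hg
  have hsum : ∀ w : ℝ, HasSum (fun n => w ^ n * b n) (g w) := by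
    intro w
    have h1 : HasSum (fun n : ℕ => ∫ l, ((n.factorial : ℂ)⁻¹ * (w * S l) ^ n) ∂ν)
        (∫ l, ∑' n : ℕ, ((n.factorial : ℂ)⁻¹ * (w * S l) ^ n) ∂ν) := by
      refine hasSum_integral_of_summable_integral_norm
        (fun n => integrable_of_continuous ν (by fun_prop)) ?_
      refine Summable.of_nonneg_of_le (fun n => integral_nonneg fun _ => norm_nonneg _)
        (fun n => ?_) ((Real.summable_pow_div_factorial (|w| * C)).mul_left (ν.real Set.univ))
      have h2 : ∀ l, ‖((n.factorial : ℂ)⁻¹ * (w * S l) ^ n)‖ ≤ (|w| * C) ^ n / n.factorial := by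
        intro l
        rw [norm_mul, norm_inv, norm_pow, norm_mul, Complex.norm_natCast, Complex.norm_real,
          inv_mul_eq_div, Real.norm_eq_abs]
        gcongr
        exact hC l (Set.mem_univ l)
      calc ∫ l, ‖((n.factorial : ℂ)⁻¹ * (w * S l) ^ n)‖ ∂ν
          ≤ ∫ _, (|w| * C) ^ n / n.factorial ∂ν :=
            integral_mono (integrable_of_continuous ν (by fun_prop)) (integrable_const _) h2
        _ = _ := by rw [integral_const, smul_eq_mul]
    have h3 : ∀ l, ∑' n : ℕ, ((n.factorial : ℂ)⁻¹ * (w * S l) ^ n) = Complex.exp (w * S l) := by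
      intro l
      have := NormedSpace.exp_series_hasSum_exp' (𝕂 := ℂ) (𝔸 := ℂ) (w * S l)
      rw [← Complex.exp_eq_exp_ℂ] at this
      exact this.tsum_eq
    simp only [h3] at h1
    have h4 := Complex.hasSum_im h1
    refine h4.congr_fun fun n => ?_
    have h5 : ∫ l, ((n.factorial : ℂ)⁻¹ * (w * S l) ^ n) ∂ν
        = ((w ^ n / n.factorial : ℝ) : ℂ) * ∫ l, S l ^ n ∂ν := by
      rw [← integral_const_mul]
      congr 1
      funext l
      push_cast
      rw [mul_pow]; ring
    rw [h5, Complex.im_ofReal_mul]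
    simp only [hb]; ring
  have hp : HasFPowerSeriesAt g (FormalMultilinearSeries.ofScalars ℝ b) 0 := by
    rw [hasFPowerSeriesAt_iff]
    refine Filter.Eventually.of_forall fun z => ?_
    simpa [FormalMultilinearSeries.coeff_ofScalars] using hsum z
  -- The half line `w < 0` accumulates at `0`, so an analytic function that vanishes on it vanishes
  -- near `0`.
  have hz : ∀ᶠ w in nhds (0 : ℝ), g w = 0 := by
    rw [← hp.analyticAt.frequently_zero_iff_eventually_zero]
    have h1 : ∃ᶠ w in nhdsWithin (0 : ℝ) (Set.Iio 0), g w = 0 := by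
      refine Filter.Eventually.frequently ?_
      filter_upwards [self_mem_nhdsWithin] with w hw
      exact h w (le_of_lt hw)
    exact h1.filter_mono (nhdsWithin_mono _ fun w hw => ne_of_lt hw)
  have hp0 := (hp.congr hz).eq_zero
  have h1 : b n = 0 := by
    have h2 : FormalMultilinearSeries.coeff (0 : FormalMultilinearSeries ℝ ℝ ℝ) n = 0 := rfl
    rw [← h2, ← hp0, FormalMultilinearSeries.coeff_ofScalars]
  have hn : (n.factorial : ℝ) ≠ 0 := by positivity
  exact (div_eq_zero_iff.1 h1).resolve_right hn

end ParametricIntegral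

/-! ### Pair correlations and their values at imaginary times. -/

section PairCorrelation
variable {𝔥 : Type*} [NormedAddCommGroup 𝔥] [InnerProductSpace ℂ 𝔥] [CompleteSpace 𝔥]
  {ε : 𝔥 →ₗ.[ℂ] 𝔥} {m β μ : ℝ}

/-- Vectors on which `ε` is bounded. -/
def BoundedEnergy (ε : 𝔥 →ₗ.[ℂ] 𝔥) (u : 𝔥) : Prop :=
  ∃ (n : ℕ) (y : 𝔥), u = boundedFC ε (fun e => (cutoff n e : ℂ)) y

theorem BoundedEnergy.smul {u : 𝔥} (h : BoundedEnergy ε u) (c : ℂ) : BoundedEnergy ε (c • u) := by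
  obtain ⟨n, y, rfl⟩ := h
  exact ⟨n, c • y, (map_smul _ _ _).symm⟩

theorem BoundedEnergy.zero : BoundedEnergy ε (0 : 𝔥) := ⟨0, 0, (map_zero _).symm⟩

theorem BoundedEnergy.conj (H : IsGapped ε m) {J : 𝔥 ≃ₗᵢ⋆[ℂ] 𝔥} (hJ : ∀ x, J (J x) = x)
    (hreal : ∀ x : ε.domain, ∃ hx : J (x : 𝔥) ∈ ε.domain, ε ⟨J (x : 𝔥), hx⟩ = J (ε x))
    {u : 𝔥} (h : BoundedEnergy ε u) : BoundedEnergy ε (J u) := by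
  obtain ⟨n, y, rfl⟩ := h
  exact ⟨n, J y, (H.fc_conj J hJ hreal (bddCont_cutoff n) y).symm⟩

/-- For complex `z` the function `l` need not be bounded. One entire function nevertheless gives the
matrix elements for all admissible `l`: those at real times and those at imaginary times in the
thermal range. -/
theorem exists_entire_matrix_element (H : IsGapped ε m) (ν : ℝ) {k : ℝ → ℂ} (hk : BddCont m k)
    {v : 𝔥} (hv : BoundedEnergy ε v) (x : 𝔥) :
    ∃ F : ℂ → ℂ, Differentiable ℂ F ∧ ∀ (z : ℂ) (l : ℝ → ℂ), BddCont m l →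
      (∀ e, m ≤ e → l e = Complex.exp (Complex.I * z * ((e - ν : ℝ) : ℂ)) * k e) →
      F z = inner ℂ x (boundedFC ε l v) := by
  obtain ⟨n, y, rfl⟩ := hv
  obtain ⟨Φ, hΦ, hΦ'⟩ := H.exists_entire_exp n
  refine ⟨fun z => Complex.exp (-(Complex.I * z * ν)) *
    inner ℂ x (Φ z (boundedFC ε k (boundedFC ε (fun e => (cutoff n e : ℂ)) y))), ?_, ?_⟩
  · refine Differentiable.mul (by fun_prop) ?_
    exact (innerSL ℂ x).differentiable.comp (hΦ.clm_apply (differentiable_const _))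
  · intro z l hl hlk
    have h1 := hΦ' z k (fun e => Complex.exp (Complex.I * z * ν) * l e) hk
      ((BddCont.const _).mul hl) (fun e he => by
        rw [hlk e he, ← mul_assoc, ← Complex.exp_add]
        push_cast
        congr 2; ring) y
    simp only [h1]
    rw [H.fc_const_mul hl, smul_apply, inner_smul_right, ← mul_assoc, ← Complex.exp_add]
    simp

theorem inner_phase_fc_phase (H : IsGapped ε m) (ν t₁ t₂ : ℝ) {k : ℝ → ℂ} (hk : BddCont m k)
    (x y : 𝔥) :
    (inner ℂ (boundedFC ε (fun e => Complex.exp (Complex.I * t₁ * ((e - ν : ℝ) : ℂ))) x)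
      (boundedFC ε k (boundedFC ε (fun e => Complex.exp (Complex.I * t₂ * ((e - ν : ℝ) : ℂ))) y)) : ℂ)
    = inner ℂ x (boundedFC ε
        (fun e => Complex.exp (Complex.I * ((t₂ - t₁ : ℝ) : ℂ) * ((e - ν : ℝ) : ℂ)) * k e) y) := by
  rw [inner_phase_fc H, H.fc_mul_apply hk bddCont_phase,
    H.fc_mul_apply bddCont_phase (hk.mul bddCont_phase)]
  congr 3
  ext e
  have : Complex.exp (Complex.I * ((t₂ - t₁ : ℝ) : ℂ) * ((e - ν : ℝ) : ℂ)) =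
      Complex.exp (Complex.I * (-t₁ : ℝ) * ((e - ν : ℝ) : ℂ)) *
      Complex.exp (Complex.I * t₂ * ((e - ν : ℝ) : ℂ)) := by
    rw [← Complex.exp_add]; push_cast; congr 1; ring
  rw [this]; ring

/-- The operator `(1 + ρ(ε - μ)) e^{-s(ε - μ)} + ρ(ε + μ) e^{s(ε + μ)}`. -/
def thermalOp (ε : 𝔥 →ₗ.[ℂ] 𝔥) (β μ s : ℝ) : 𝔥 →L[ℂ] 𝔥 :=
  boundedFC ε fun e => ((thermalCreate β s (e - μ) + thermalAnnih β s (e - -μ) : ℝ) : ℂ)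

theorem bddCont_thermalOp (hβ : 0 < β) (hμm : |μ| < m) {s : ℝ} (hs : 0 ≤ s) (hs' : s ≤ β) :
    BddCont m fun e => ((thermalCreate β s (e - μ) + thermalAnnih β s (e - -μ) : ℝ) : ℂ) := by
  have := (bddCont_thermalCreate (m := m) hβ hμm hs).add
    (bddCont_thermalAnnih (m := m) (ν := -μ) hβ (by rwa [abs_neg]) hs')
  simpa using this

/-- Of the four terms in `inner_dvec`, the `1 + ρ` term at `ε - μ` and the `ρ` term at `ε + μ` carry
the phase `w̄₁ w₂` and make up `F`; the other two carry `w₁ w̄₂` and make up `G`. Reality of `ε`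
turns the terms in `J u`, `J v` into terms in `u`, `v` in reversed order, which yields `thermalOp`
with `μ` for `F` and with `-μ` for `G`. -/
theorem exists_entire_pair (H : IsGapped ε m) (hβ : 0 < β) (hμm : |μ| < m)
    {J : 𝔥 ≃ₗᵢ⋆[ℂ] 𝔥} (hJ : ∀ x, J (J x) = x)
    (hreal : ∀ x : ε.domain, ∃ hx : J (x : 𝔥) ∈ ε.domain, ε ⟨J (x : 𝔥), hx⟩ = J (ε x))
    {u v : 𝔥} (hu : BoundedEnergy ε u) (hv : BoundedEnergy ε v) :
    ∃ F G : ℂ → ℂ, Differentiable ℂ F ∧ Differentiable ℂ G ∧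
      (∀ (t₁ t₂ : ℝ) (w₁ w₂ : ℂ), (inner ℂ (dvec ε β μ (evol ε μ t₁ (kvec J (w₁ • u))))
        (dvec ε β μ (evol ε μ t₂ (kvec J (w₂ • v)))) : ℂ)
        = star w₁ * w₂ * F ((t₂ - t₁ : ℝ) : ℂ) + w₁ * star w₂ * G ((t₂ - t₁ : ℝ) : ℂ)) ∧
      ∀ s : ℝ, 0 ≤ s → s ≤ β → F (Complex.I * s) = inner ℂ u (thermalOp ε β μ s v) ∧
        G (Complex.I * s) = inner ℂ v (thermalOp ε β (-μ) s u) := by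
  have hμ' : |-μ| < m := by rwa [abs_neg]
  have key : ∀ ν, |ν| < m → ∀ (x y : 𝔥), BoundedEnergy ε y →
      ∃ F : ℂ → ℂ, Differentiable ℂ F ∧ (∀ t₁ t₂ : ℝ,
        (inner ℂ (boundedFC ε (fun e => Complex.exp (Complex.I * t₁ * ((e - ν : ℝ) : ℂ))) x)
        (boundedFC ε (fun e => ((1 + bose β (e - ν) : ℝ) : ℂ))
        (boundedFC ε (fun e => Complex.exp (Complex.I * t₂ * ((e - ν : ℝ) : ℂ))) y)) : ℂ)
          = F ((t₂ - t₁ : ℝ) : ℂ)) ∧ ∀ s : ℝ, 0 ≤ s → s ≤ β →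
        F (Complex.I * s) = inner ℂ x (boundedFC ε (fun e => (thermalCreate β s (e - ν) : ℂ)) y) := by
    intro ν hν x y hy
    have hk : BddCont m fun e => ((1 + bose β (e - ν) : ℝ) : ℂ) := by
      simpa using (BddCont.const (m := m) 1).add (bddCont_bose hβ hν)
    obtain ⟨F, hF, hF'⟩ := exists_entire_matrix_element H ν hk hy x
    refine ⟨F, hF, fun t₁ t₂ => ?_, fun s hs hs' => ?_⟩
    · rw [inner_phase_fc_phase H ν t₁ t₂ hk, hF' _ _ (bddCont_phase.mul hk) fun e _ => rfl]
    · refine hF' _ _ (bddCont_thermalCreate hβ hν hs) fun e he => ?_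
      rw [thermalCreate, Complex.ofReal_mul, mul_comm, Complex.ofReal_exp]
      congr 2
      push_cast
      linear_combination -((s : ℂ) * (e - ν)) * Complex.I_mul_I
  have key' : ∀ ν, |ν| < m → ∀ (x y : 𝔥), BoundedEnergy ε y →
      ∃ F : ℂ → ℂ, Differentiable ℂ F ∧ (∀ t₁ t₂ : ℝ,
        (inner ℂ (boundedFC ε (fun e => Complex.exp (Complex.I * t₂ * ((e - ν : ℝ) : ℂ))) x)
        (boundedFC ε (fun e => (bose β (e - ν) : ℂ))
        (boundedFC ε (fun e => Complex.exp (Complex.I * t₁ * ((e - ν : ℝ) : ℂ))) y)) : ℂ)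
          = F ((t₂ - t₁ : ℝ) : ℂ)) ∧ ∀ s : ℝ, 0 ≤ s → s ≤ β →
        F (Complex.I * s) = inner ℂ x (boundedFC ε (fun e => (thermalAnnih β s (e - ν) : ℂ)) y) := by
    intro ν hν x y hy
    have hk := bddCont_bose (m := m) hβ hν
    obtain ⟨F, hF, hF'⟩ := exists_entire_matrix_element H ν hk hy x
    -- The `ρ` terms have the two times in the opposite order, hence the reflection, which turns the
    -- decay `e^{-se}` into the growth `e^{se}`.
    refine ⟨fun z => F (-z), by fun_prop, fun t₁ t₂ => ?_, fun s hs hs' => ?_⟩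
    · simp only [← Complex.ofReal_neg, neg_sub]
      rw [inner_phase_fc_phase H ν t₂ t₁ hk, hF' _ _ (bddCont_phase.mul hk) fun e _ => rfl]
    · refine hF' _ _ (bddCont_thermalAnnih hβ hν hs') fun e he => ?_
      rw [thermalAnnih, Complex.ofReal_mul, mul_comm, Complex.ofReal_exp]
      congr 2
      push_cast
      linear_combination ((s : ℂ) * (e - ν)) * Complex.I_mul_I
  obtain ⟨F₁, hF₁, hF₁t, hF₁s⟩ := key μ hμm u v hv
  obtain ⟨F₂, hF₂, hF₂t, hF₂s⟩ := key' (-μ) hμ' (J v) (J u) (hu.conj H hJ hreal)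
  obtain ⟨G₁, hG₁, hG₁t, hG₁s⟩ := key (-μ) hμ' (J u) (J v) (hv.conj H hJ hreal)
  obtain ⟨G₂, hG₂, hG₂t, hG₂s⟩ := key' μ hμm v u hu
  refine ⟨fun z => F₁ z + F₂ z, fun z => G₁ z + G₂ z, by fun_prop, by fun_prop, ?_, ?_⟩
  · intro t₁ t₂ w₁ w₂
    rw [inner_dvec H hβ hμm, evol_apply, evol_apply]
    simp only [kvec, WithLp.toLp_fst, WithLp.toLp_snd, map_smulₛₗ, RingHom.id_apply,
      inner_smul_left, inner_smul_right, hF₁t, hF₂t, hG₁t, hG₂t, RCLike.star_def, Complex.conj_conj]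
    ring
  · intro s hs hs'
    have hsplit : ∀ ν, |ν| < m → ∀ x, thermalOp ε β ν s x =
        boundedFC ε (fun e => (thermalCreate β s (e - ν) : ℂ)) x +
        boundedFC ε (fun e => (thermalAnnih β s (e - -ν) : ℂ)) x := by
      intro ν hν x
      rw [← add_apply, H.fc_add (bddCont_thermalCreate hβ hν hs)
        (bddCont_thermalAnnih hβ (by rwa [abs_neg]) hs'), thermalOp]
      simp
    have hflip : ∀ {f : ℝ → ℝ}, BddCont m (fun e => (f e : ℂ)) → ∀ x y : 𝔥,
        (inner ℂ (J x) (boundedFC ε (fun e => (f e : ℂ)) (J y)) : ℂ)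
          = inner ℂ y (boundedFC ε (fun e => (f e : ℂ)) x) := by
      intro f hf x y
      rw [H.fc_conj J hJ hreal hf, inner_conj_map, H.inner_fc_real_left hf]
    simp only
    rw [hsplit μ hμm, hsplit (-μ) hμ', inner_add_right, inner_add_right, hF₁s s hs hs',
      hF₂s s hs hs', hG₁s s hs hs', hG₂s s hs hs',
      hflip (f := fun e => thermalAnnih β s (e - -μ)) (bddCont_thermalAnnih hβ hμ' hs'),
      hflip (f := fun e => thermalCreate β s (e - -μ)) (bddCont_thermalCreate hβ hμ' hs), neg_neg]
    exact ⟨rfl, rfl⟩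

end PairCorrelation

/-! ### The Euclidean three-point function of averaged Weyl operators. -/

section ThreePoint
variable {𝔥 : Type*} [NormedAddCommGroup 𝔥] [InnerProductSpace ℂ 𝔥] [CompleteSpace 𝔥]
  {ε : 𝔥 →ₗ.[ℂ] 𝔥} {m β μ : ℝ}

theorem vacuum_fockWeyl_three {K : Type*} [NormedAddCommGroup K] [InnerProductSpace ℂ K]
    (f g h : K) :
    (inner ℂ (expVec (0 : K)) (fockWeyl f (fockWeyl g (fockWeyl h (expVec 0)))) : ℂ) =
    Complex.exp (-(inner ℂ f f + inner ℂ g g + inner ℂ h h) / 4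
      - (inner ℂ f g + inner ℂ g h + inner ℂ f h) / 2) := by
  rw [← mul_apply_eq_comp (fockWeyl g), fockWeyl_mul, smul_apply, map_smul,
    ← mul_apply_eq_comp (fockWeyl f), fockWeyl_mul, smul_apply, smul_smul, inner_smul_right,
    vacuum_fockWeyl, ← Complex.exp_add, ← Complex.exp_add]
  congr 1
  simp only [inner_add_left, inner_add_right]
  ring

theorem state_weyl_three (x y z : OneParticle 𝔥) :
    state (weyl ε β μ x * (weyl ε β μ y * weyl ε β μ z)) =
    Complex.exp (-(inner ℂ (dvec ε β μ x) (dvec ε β μ x) + inner ℂ (dvec ε β μ y) (dvec ε β μ y)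
        + inner ℂ (dvec ε β μ z) (dvec ε β μ z)) / 4
      - (inner ℂ (dvec ε β μ x) (dvec ε β μ y) + inner ℂ (dvec ε β μ y) (dvec ε β μ z)
        + inner ℂ (dvec ε β μ x) (dvec ε β μ z)) / 2) :=
  vacuum_fockWeyl_three _ _ _

instance : SecondCountableTopology Circle :=
  inferInstanceAs (SecondCountableTopology (Metric.sphere (0 : ℂ) 1))

variable (ν : Measure Circle) [IsProbabilityMeasure ν]

theorem integral_triple {f : Circle × Circle × Circle → ℂ} (hf : Continuous f) :
    ∫ θ, f θ ∂(ν.prod (ν.prod ν)) = ∫ θ₁, ∫ θ₂, ∫ θ₃, f (θ₁, θ₂, θ₃) ∂ν ∂ν ∂ν := by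
  rw [integral_prod _ (integrable_of_continuous _ hf)]
  congr 1
  funext θ₁
  have h1 : Continuous fun θ : Circle × Circle => f (θ₁, θ) := by fun_prop
  exact integral_prod _ (integrable_of_continuous _ h1)

theorem state_avgWeyl_three (x y z : C(Circle, OneParticle 𝔥)) :
    state (avgWeyl ν ε β μ x * (avgWeyl ν ε β μ y * avgWeyl ν ε β μ z)) =
      ∫ θ : Circle × Circle × Circle, state (weyl ε β μ (x θ.1) *
        (weyl ε β μ (y θ.2.1) * weyl ε β μ (z θ.2.2))) ∂(ν.prod (ν.prod ν)) := by
  have hc : Continuous fun θ : Circle × Circle × Circle => state (weyl ε β μ (x θ.1) *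
        (weyl ε β μ (y θ.2.1) * weyl ε β μ (z θ.2.2))) := by
    simp only [state_weyl_three]
    have hx : Continuous fun θ : Circle × Circle × Circle => dvec ε β μ (x θ.1) :=
      continuous_dvec.comp (by fun_prop)
    have hy : Continuous fun θ : Circle × Circle × Circle => dvec ε β μ (y θ.2.1) :=
      continuous_dvec.comp (by fun_prop)
    have hz : Continuous fun θ : Circle × Circle × Circle => dvec ε β μ (z θ.2.2) :=
      continuous_dvec.comp (by fun_prop)
    fun_prop
  rw [integral_triple ν hc]
  unfold state
  simp only [mul_apply_eq_comp]
  rw [inner_avgWeyl]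
  congr 1
  funext θ₁
  have h2 := clm_avgWeyl (ε := ε) (β := β) (μ := μ) ν
    (innerSL ℂ (expVec (0 : Doubled 𝔥)) ∘L weyl ε β μ (x θ₁)) y
  refine (h2 _).trans ?_
  congr 1
  funext θ₂
  exact clm_avgWeyl (ε := ε) (β := β) (μ := μ) ν
    (innerSL ℂ (expVec (0 : Doubled 𝔥)) ∘L weyl ε β μ (x θ₁) ∘L weyl ε β μ (y θ₂)) z _

/-- The six characters `θ̄ⱼ θₖ`, `j ≠ k`, of the three-torus. -/
def charVec (θ : Circle × Circle × Circle) : Fin 6 → ℂ :=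
  ![star (θ.1 : ℂ) * θ.2.1, (θ.1 : ℂ) * star (θ.2.1 : ℂ), star (θ.2.1 : ℂ) * θ.2.2,
    (θ.2.1 : ℂ) * star (θ.2.2 : ℂ), star (θ.1 : ℂ) * θ.2.2, (θ.1 : ℂ) * star (θ.2.2 : ℂ)]

theorem continuous_charVec : Continuous charVec := by
  have h := continuous_circle_coe
  have h1 : Continuous fun θ : Circle × Circle × Circle => (θ.1 : ℂ) := h.comp continuous_fst
  have h2 : Continuous fun θ : Circle × Circle × Circle => (θ.2.1 : ℂ) :=
    h.comp (continuous_fst.comp continuous_snd)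
  have h3 : Continuous fun θ : Circle × Circle × Circle => (θ.2.2 : ℂ) :=
    h.comp (continuous_snd.comp continuous_snd)
  refine continuous_pi fun i => ?_
  fin_cases i
  · exact h1.star.mul h2
  · exact h1.mul h2.star
  · exact h2.star.mul h3
  · exact h2.mul h3.star
  · exact h1.star.mul h3
  · exact h1.mul h3.star

/-- The trigonometric polynomial with coefficients `a`. -/
def charSum (a : Fin 6 → ℂ) (θ : Circle × Circle × Circle) : ℂ := ∑ i, a i * charVec θ i

theorem continuous_charSum (a : Fin 6 → ℂ) : Continuous (charSum a) :=
  continuous_finsetSum _ fun i _ =>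
    continuous_const.mul ((continuous_apply i).comp continuous_charVec)

/-- The coefficients of the Euclidean three-point function at `(0, iβ/4, iβ/2)`. -/
def pairCoeff (ε : 𝔥 →ₗ.[ℂ] 𝔥) (β μ : ℝ) (u v w : 𝔥) : Fin 6 → ℂ :=
  ![inner ℂ u (thermalOp ε β μ (β / 4) v), inner ℂ v (thermalOp ε β (-μ) (β / 4) u),
    inner ℂ v (thermalOp ε β μ (β / 4) w), inner ℂ w (thermalOp ε β (-μ) (β / 4) v),
    inner ℂ u (thermalOp ε β μ (β / 2) w), inner ℂ w (thermalOp ε β (-μ) (β / 2) u)]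

/-- The Euclidean three-point function of averaged Weyl operators at `(0, iβ/4, iβ/2)`. -/
def euclideanThree (J : 𝔥 ≃ₗᵢ⋆[ℂ] 𝔥) (ε : 𝔥 →ₗ.[ℂ] 𝔥) (β μ : ℝ) (u v w : 𝔥) : ℂ :=
  Real.exp (-(‖dvec ε β μ (kvec J u)‖ ^ 2 + ‖dvec ε β μ (kvec J v)‖ ^ 2
    + ‖dvec ε β μ (kvec J w)‖ ^ 2) / 4) *
  ∫ θ, Complex.exp (((-1 / 2 : ℝ) : ℂ) * charSum (pairCoeff ε β μ u v w) θ) ∂(ν.prod (ν.prod ν))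

theorem star_circle_mul_self (θ : Circle) : star (θ : ℂ) * θ = 1 := by
  rw [RCLike.star_def, ← Complex.normSq_eq_conj_mul_self, Circle.normSq_coe, Complex.ofReal_one]

/-- The Weyl relations make the integrand the exponential of a constant plus a linear combination of
pair correlations. For vectors of bounded energy these are entire in the time differences, and
integration over the compact torus keeps the result entire. -/
theorem exists_continuation_three (H : IsGapped ε m) (hβ : 0 < β) (hμm : |μ| < m)
    {J : 𝔥 ≃ₗᵢ⋆[ℂ] 𝔥} (hJ : ∀ x, J (J x) = x)
    (hreal : ∀ x : ε.domain, ∃ hx : J (x : 𝔥) ∈ ε.domain, ε ⟨J (x : 𝔥), hx⟩ = J (ε x))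
    {u v w : 𝔥} (hu : BoundedEnergy ε u) (hv : BoundedEnergy ε v) (hw : BoundedEnergy ε w) :
    ∃ G : (Fin 3 → ℂ) → ℂ, Differentiable ℂ G ∧
      (∀ t : Fin 3 → ℝ, G (fun i => (t i : ℂ)) = state (
        dynamics ε μ (t 0) (avgWeyl ν ε β μ (kpath J circleIncl u)) *
        (dynamics ε μ (t 1) (avgWeyl ν ε β μ (kpath J circleIncl v)) *
        dynamics ε μ (t 2) (avgWeyl ν ε β μ (kpath J circleIncl w))))) ∧
      G (fun i => Complex.I * (![0, β / 4, β / 2] i : ℝ)) = euclideanThree ν J ε β μ u v w := by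
  -- The diagonal terms depend neither on the time nor on the phase: the time difference is zero and
  -- `w̄ w = 1`.
  have diag : ∀ {u : 𝔥}, BoundedEnergy ε u → ∀ (t : ℝ) (θ : Circle),
      (inner ℂ (dvec ε β μ (evol ε μ t (kvec J ((θ : ℂ) • u))))
        (dvec ε β μ (evol ε μ t (kvec J ((θ : ℂ) • u)))) : ℂ) =
      ((‖dvec ε β μ (kvec J u)‖ ^ 2 : ℝ) : ℂ) := by
    intro u hu t θ
    obtain ⟨F, G, -, -, h, -⟩ := exists_entire_pair H hβ hμm hJ hreal hu hu
    have h0 := h 0 0 1 1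
    rw [evol_zero H, one_smul, one_apply_eq_self, ← norm_sq_eq_inner] at h0
    have hθ := star_circle_mul_self θ
    have hθ' := hθ
    rw [mul_comm] at hθ'
    rw [h, Complex.ofReal_pow, h0, hθ, hθ']
    simp
  obtain ⟨F₁, G₁, hF₁, hG₁, h₁, s₁⟩ := exists_entire_pair H hβ hμm hJ hreal hu hv
  obtain ⟨F₂, G₂, hF₂, hG₂, h₂, s₂⟩ := exists_entire_pair H hβ hμm hJ hreal hv hw
  obtain ⟨F₃, G₃, hF₃, hG₃, h₃, s₃⟩ := exists_entire_pair H hβ hμm hJ hreal hu hw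
  set c : ℂ := ((-(‖dvec ε β μ (kvec J u)‖ ^ 2 + ‖dvec ε β μ (kvec J v)‖ ^ 2
    + ‖dvec ε β μ (kvec J w)‖ ^ 2) / 4 : ℝ) : ℂ) with hc
  set L : Circle × Circle × Circle → (Fin 6 → ℂ) →L[ℂ] ℂ := fun θ =>
    ∑ i, (((-1 / 2 : ℝ) : ℂ) * charVec θ i) • (ContinuousLinearMap.proj i : (Fin 6 → ℂ) →L[ℂ] ℂ) with hL
  have hLc : Continuous L := by
    refine continuous_finsetSum _ fun i _ => ?_
    exact (continuous_const.mul ((continuous_apply i).comp continuous_charVec)).smul continuous_const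
  have hLa : ∀ θ a, L θ a = ((-1 / 2 : ℝ) : ℂ) * charSum a θ := by
    intro θ a
    simp only [hL, charSum, Finset.mul_sum, sum_apply, smul_apply, ContinuousLinearMap.proj_apply,
      smul_eq_mul]
    refine Finset.sum_congr rfl fun i _ => ?_
    ring
  set E : (Fin 3 → ℂ) → Fin 6 → ℂ := fun z => ![F₁ (z 1 - z 0), G₁ (z 1 - z 0), F₂ (z 2 - z 1),
    G₂ (z 2 - z 1), F₃ (z 2 - z 0), G₃ (z 2 - z 0)] with hE
  have hEd : Differentiable ℂ E := by
    refine differentiable_pi.2 fun i => ?_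
    fin_cases i <;> simp [hE] <;> fun_prop
  refine ⟨fun z => ∫ θ, Complex.exp (c + L θ (E z)) ∂(ν.prod (ν.prod ν)),
    (differentiable_integral_exp (ν.prod (ν.prod ν)) continuous_const hLc).comp hEd, fun t => ?_, ?_⟩
  · rw [dynamics_avgWeyl ν H hβ hμm, dynamics_avgWeyl ν H hβ hμm, dynamics_avgWeyl ν H hβ hμm,
      state_avgWeyl_three]
    refine integral_congr_ae (Filter.Eventually.of_forall fun θ => ?_)
    beta_reduce
    have e : ∀ t u (θ : Circle), evolPath ε μ t (kpath J circleIncl u) θ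
      = evol ε μ t (kvec J ((θ : ℂ) • u)) := fun _ _ _ => rfl
    rw [state_weyl_three, e, e, e, diag hu, diag hv, diag hw, h₁, h₂, h₃, hLa]
    refine congrArg Complex.exp ?_
    simp [hE, charSum, charVec, Fin.sum_univ_succ, hc]
    ring
  · have hb : β / 4 ≤ β := by linarith
    have hb' : β / 2 ≤ β := by linarith
    have hEs : E (fun i => Complex.I * (![0, β / 4, β / 2] i : ℝ)) = pairCoeff ε β μ u v w := by
      have d1 : Complex.I * ((β / 4 : ℝ) : ℂ) - Complex.I * ((0 : ℝ) : ℂ)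
        = Complex.I * ((β / 4 : ℝ) : ℂ) := by simp
      have d2 : Complex.I * ((β / 2 : ℝ) : ℂ) - Complex.I * ((β / 4 : ℝ) : ℂ)
        = Complex.I * ((β / 4 : ℝ) : ℂ) := by push_cast; ring
      have d3 : Complex.I * ((β / 2 : ℝ) : ℂ) - Complex.I * ((0 : ℝ) : ℂ)
        = Complex.I * ((β / 2 : ℝ) : ℂ) := by simp
      have e0 : (![0, β / 4, β / 2] : Fin 3 → ℝ) 0 = 0 := rfl
      have e1 : (![0, β / 4, β / 2] : Fin 3 → ℝ) 1 = β / 4 := rfl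
      have e2 : (![0, β / 4, β / 2] : Fin 3 → ℝ) 2 = β / 2 := rfl
      simp only [hE, e0, e1, e2, d1, d2, d3]
      rw [(s₁ _ (by positivity) hb).1, (s₁ _ (by positivity) hb).2, (s₂ _ (by positivity) hb).1,
        (s₂ _ (by positivity) hb).2, (s₃ _ (by positivity) hb').1, (s₃ _ (by positivity) hb').2]
      rfl
    simp only [hEs, hLa]
    rw [euclideanThree, Complex.ofReal_exp, ← hc, ← integral_const_mul]
    simp only [Complex.exp_add]

theorem dynamics_add (t : ℝ) (A B : ArakiWoods 𝔥 →L[ℂ] ArakiWoods 𝔥) :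
    dynamics ε μ t (A + B) = dynamics ε μ t A + dynamics ε μ t B := by
  simp only [dynamics, mul_add, add_mul]

theorem state_add (A B : ArakiWoods 𝔥 →L[ℂ] ArakiWoods 𝔥) : state (A + B) = state A + state B := by
  simp only [state, add_apply, inner_add_right]

/-- Stochastic positivity forces the Euclidean three-point functions of the averaged Weyl operators
to be real. -/
theorem euclideanThree_real (H : IsGapped ε m) (hβ : 0 < β) (hμm : |μ| < m)
    {J : 𝔥 ≃ₗᵢ⋆[ℂ] 𝔥} (hJ : ∀ x, J (J x) = x)
    (hreal : ∀ x : ε.domain, ∃ hx : J (x : 𝔥) ∈ ε.domain, ε ⟨J (x : 𝔥), hx⟩ = J (ε x))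
    (hν : ν.map (fun θ => -θ) = ν)
    {𝓕 𝓤 : StarSubalgebra ℂ (ArakiWoods 𝔥 →L[ℂ] ArakiWoods 𝔥)}
    (h𝓤 : ∀ u, avgWeyl ν ε β μ (kpath J circleIncl u) ∈ 𝓤)
    (hpos : IsStochasticallyPositive 𝓕 𝓤 (dynamics ε μ) state β)
    {u v w : 𝔥} (hu : BoundedEnergy ε u) (hv : BoundedEnergy ε v) (hw : BoundedEnergy ε w) :
    (euclideanThree ν J ε β μ u v w).im = 0 := by
  set W : 𝔥 → ArakiWoods 𝔥 →L[ℂ] ArakiWoods 𝔥 := fun u => avgWeyl ν ε β μ (kpath J circleIncl u)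
    with hW
  -- These eight terms are the expansion of the function for the positive operators `W u + 1`, `W v
  -- + 1`, `W w + 1`. A factor `1` is `W 0`, so it is represented by the zero vector.
  have key : ∀ {u v w : 𝔥}, BoundedEnergy ε u → BoundedEnergy ε v → BoundedEnergy ε w →
      (euclideanThree ν J ε β μ u v w + euclideanThree ν J ε β μ u v 0
      + euclideanThree ν J ε β μ u 0 w + euclideanThree ν J ε β μ u 0 0
      + euclideanThree ν J ε β μ 0 v w + euclideanThree ν J ε β μ 0 v 0
      + euclideanThree ν J ε β μ 0 0 w + euclideanThree ν J ε β μ 0 0 0).im = 0 := by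
    intro u v w hu hv hw
    have h0 : BoundedEnergy ε (0 : 𝔥) := BoundedEnergy.zero
    obtain ⟨G₁, d₁, t₁, s₁⟩ := exists_continuation_three ν H hβ hμm hJ hreal hu hv hw
    obtain ⟨G₂, d₂, t₂, s₂⟩ := exists_continuation_three ν H hβ hμm hJ hreal hu hv h0
    obtain ⟨G₃, d₃, t₃, s₃⟩ := exists_continuation_three ν H hβ hμm hJ hreal hu h0 hw
    obtain ⟨G₄, d₄, t₄, s₄⟩ := exists_continuation_three ν H hβ hμm hJ hreal hu h0 h0
    obtain ⟨G₅, d₅, t₅, s₅⟩ := exists_continuation_three ν H hβ hμm hJ hreal h0 hv hw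
    obtain ⟨G₆, d₆, t₆, s₆⟩ := exists_continuation_three ν H hβ hμm hJ hreal h0 hv h0
    obtain ⟨G₇, d₇, t₇, s₇⟩ := exists_continuation_three ν H hβ hμm hJ hreal h0 h0 hw
    obtain ⟨G₈, d₈, t₈, s₈⟩ := exists_continuation_three ν H hβ hμm hJ hreal h0 h0 h0
    set G : (Fin 3 → ℂ) → ℂ := fun z => G₁ z + G₂ z + G₃ z + G₄ z + G₅ z + G₆ z + G₇ z + G₈ z
      with hG
    have hGd : Differentiable ℂ G := by fun_prop
    have h := hpos.green_nonneg 3 ![W u + 1, W v + 1, W w + 1] (fun i => by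
      fin_cases i
      · exact ⟨add_mem (h𝓤 u) (one_mem _), isPositive_avgWeyl_add_one ν hν J u⟩
      · exact ⟨add_mem (h𝓤 v) (one_mem _), isPositive_avgWeyl_add_one ν hν J v⟩
      · exact ⟨add_mem (h𝓤 w) (one_mem _), isPositive_avgWeyl_add_one ν hν J w⟩)
      ![0, β / 4, β / 2] (by
        intro i j hij
        fin_cases i <;> fin_cases j <;> first | exact absurd hij (by decide) | (simp <;> linarith))
      (by
        intro i j
        fin_cases i <;> fin_cases j <;> simp <;> linarith) G
      ⟨hGd.differentiableOn, hGd.continuous.continuousOn, fun t => by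
        have h1 : W 0 = 1 := avgWeyl_kpath_zero ν J
        simp only [hG, t₁, t₂, t₃, t₄, t₅, t₆, t₇, t₈]
        change state (dynamics ε μ (t 0) (W u) * (dynamics ε μ (t 1) (W v) * dynamics ε μ (t 2) (W w)))
          + state (dynamics ε μ (t 0) (W u) * (dynamics ε μ (t 1) (W v) * dynamics ε μ (t 2) (W 0)))
          + state (dynamics ε μ (t 0) (W u) * (dynamics ε μ (t 1) (W 0) * dynamics ε μ (t 2) (W w)))
          + state (dynamics ε μ (t 0) (W u) * (dynamics ε μ (t 1) (W 0) * dynamics ε μ (t 2) (W 0)))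
          + state (dynamics ε μ (t 0) (W 0) * (dynamics ε μ (t 1) (W v) * dynamics ε μ (t 2) (W w)))
          + state (dynamics ε μ (t 0) (W 0) * (dynamics ε μ (t 1) (W v) * dynamics ε μ (t 2) (W 0)))
          + state (dynamics ε μ (t 0) (W 0) * (dynamics ε μ (t 1) (W 0) * dynamics ε μ (t 2) (W w)))
          + state (dynamics ε μ (t 0) (W 0) * (dynamics ε μ (t 1) (W 0) * dynamics ε μ (t 2) (W 0)))
          = state (dynamics ε μ (t 0) (W u + 1) * (dynamics ε μ (t 1) (W v + 1) *
            (dynamics ε μ (t 2) (W w + 1) * 1)))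
        rw [h1, mul_one]
        simp only [dynamics_add, mul_add, add_mul, state_add]
        ring⟩
    have h2 := (Complex.le_def.1 h).2
    simp only [hG] at h2
    rw [s₁, s₂, s₃, s₄, s₅, s₆, s₇, s₈] at h2
    exact h2.symm
  have h0 : BoundedEnergy ε (0 : 𝔥) := BoundedEnergy.zero
  -- Inclusion and exclusion over the sets of vectors put to zero isolates the term with all three
  -- vectors.
  have k1 := key hu hv hw
  have k2 := key hu hv h0
  have k3 := key hu h0 hw
  have k4 := key h0 hv hw
  have k5 := key hu h0 h0
  have k6 := key h0 hv h0
  have k7 := key h0 h0 hw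
  have k8 := key h0 h0 h0
  simp only [Complex.add_im] at k1 k2 k3 k4 k5 k6 k7 k8
  linarith

end ThreePoint

/-! ### Second and third moments of the trigonometric polynomials. -/

section CircleMoments

/-- Rotation by `i` multiplies the integral by `iⁿ`, which differs from `1` for the degrees up to
three that a cube can contain. -/
theorem integral_circle_pow {n : ℕ} (hn : n = 1 ∨ n = 2 ∨ n = 3) :
    ∫ θ : Circle, (θ : ℂ) ^ n ∂circleHaar = 0 := by
  have key : ∀ z : Circle, ∫ θ : Circle, (θ : ℂ) ^ n ∂circleHaar
      = (z : ℂ) ^ n * ∫ θ : Circle, (θ : ℂ) ^ n ∂circleHaar := by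
    intro z
    rw [← integral_const_mul, ← integral_circle_mul _ z]
    simp only [Circle.coe_mul, mul_pow]
  have hI := key (Circle.exp (Real.pi / 2))
  have hz : ((Circle.exp (Real.pi / 2) : Circle) : ℂ) = Complex.I := by
    rw [Circle.coe_exp]
    push_cast
    exact Complex.exp_pi_div_two_mul_I
  rw [hz] at hI
  have h1 : (1 - Complex.I ^ n) * ∫ θ : Circle, (θ : ℂ) ^ n ∂circleHaar = 0 := by
    rw [sub_mul, one_mul, ← hI, sub_self]
  refine (mul_eq_zero.1 h1).resolve_left ?_
  rcases hn with rfl | rfl | rfl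
  · intro h; simpa using congrArg Complex.re h
  · rw [Complex.I_sq]; norm_num
  · rw [Complex.I_pow_three]; intro h; simpa using congrArg Complex.re h

theorem integral_circle_star_pow {n : ℕ} (hn : n = 1 ∨ n = 2 ∨ n = 3) :
    ∫ θ : Circle, star (θ : ℂ) ^ n ∂circleHaar = 0 := by
  have h := integral_circle_pow hn
  have h2 := integral_conj (μ := circleHaar) (f := fun θ : Circle => (θ : ℂ) ^ n)
  rw [h, map_zero] at h2
  simpa using h2

/-- Only the constant term of a trigonometric polynomial of degree three has a nonzero mean. -/
theorem integral_circle_laurent (c₀ : ℂ) (c d : Fin 3 → ℂ) :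
    ∫ θ : Circle, (c₀ + ∑ k : Fin 3, (c k * (θ : ℂ) ^ (k.val + 1) + d k * star (θ : ℂ) ^ (k.val + 1)))
      ∂circleHaar = c₀ := by
  have hc := continuous_circle_coe
  have hs := continuous_circle_coe.star
  have hk : ∀ k : Fin 3, k.val + 1 = 1 ∨ k.val + 1 = 2 ∨ k.val + 1 = 3 := by decide
  have h1 : ∀ k : Fin 3, ∫ θ : Circle, (c k * (θ : ℂ) ^ (k.val + 1) + d k * star (θ : ℂ) ^ (k.val + 1))
      ∂circleHaar = 0 := by
    intro k
    have i1 : Integrable (fun θ : Circle => c k * (θ : ℂ) ^ (k.val + 1)) circleHaar :=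
      integrable_of_continuous _ (continuous_const.mul (hc.pow _))
    have i2 : Integrable (fun θ : Circle => d k * star (θ : ℂ) ^ (k.val + 1)) circleHaar :=
      integrable_of_continuous _ (continuous_const.mul (hs.pow _))
    rw [integral_add i1 i2, integral_const_mul, integral_const_mul, integral_circle_pow (hk k),
      integral_circle_star_pow (hk k), mul_zero, mul_zero, add_zero]
  have h2 : ∀ k : Fin 3, Continuous fun θ : Circle =>
      c k * (θ : ℂ) ^ (k.val + 1) + d k * star (θ : ℂ) ^ (k.val + 1) := fun k =>
    (continuous_const.mul (hc.pow _)).add (continuous_const.mul (hs.pow _))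
  have i3 : Integrable (fun θ : Circle => ∑ k : Fin 3,
      (c k * (θ : ℂ) ^ (k.val + 1) + d k * star (θ : ℂ) ^ (k.val + 1))) circleHaar :=
    integrable_of_continuous _ (continuous_finsetSum _ fun k _ => h2 k)
  rw [integral_add (integrable_const _) i3,
    integral_finsetSum _ fun k _ => integrable_of_continuous _ (h2 k),
    Finset.sum_eq_zero fun k _ => h1 k, integral_const, probReal_univ, one_smul, add_zero]

theorem integral_circle_eq {f : Circle → ℂ} {c₀ : ℂ} (c d : Fin 3 → ℂ)
    (h : ∀ θ : Circle, f θ = c₀ + ∑ k : Fin 3,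
      (c k * (θ : ℂ) ^ (k.val + 1) + d k * star (θ : ℂ) ^ (k.val + 1))) :
    ∫ θ, f θ ∂circleHaar = c₀ := by
  simp only [h, integral_circle_laurent]

/-- Only the characters `θ̄₁θ₂` and `θ₁θ̄₂` are present, and of their products only the mixed one is
constant. -/
theorem integral_charSum_sq (a b : ℂ) :
    ∫ θ, charSum ![a, b, 0, 0, 0, 0] θ ^ 2 ∂(circleHaar.prod (circleHaar.prod circleHaar))
      = 2 * (a * b) := by
  rw [integral_triple _ (f := fun θ => charSum _ θ ^ 2) ((continuous_charSum _).pow 2)]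
  have h : ∀ θ₁ θ₂ θ₃ : Circle, charSum ![a, b, 0, 0, 0, 0] (θ₁, θ₂, θ₃) ^ 2
      = 2 * (a * b) + (b * (θ₁ : ℂ) * star (θ₂ : ℂ)) ^ 2 + (a * star (θ₁ : ℂ) * (θ₂ : ℂ)) ^ 2 := by
    intro θ₁ θ₂ θ₃
    have h1 := star_circle_mul_self θ₁
    have h2 := star_circle_mul_self θ₂
    rw [RCLike.star_def] at h1 h2
    simp [charSum, charVec, Fin.sum_univ_succ]
    linear_combination (2 * a * b * (starRingEnd ℂ) (θ₂ : ℂ) * (θ₂ : ℂ)) * h1 + (2 * a * b) * h2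
  simp only [h, integral_const, probReal_univ, one_smul]
  have h2 : ∀ θ₁ : Circle, ∫ θ₂ : Circle, (2 * (a * b) + (b * (θ₁ : ℂ) * star (θ₂ : ℂ)) ^ 2
      + (a * star (θ₁ : ℂ) * (θ₂ : ℂ)) ^ 2) ∂circleHaar = 2 * (a * b) := by
    intro θ₁
    refine integral_circle_eq ![0, (a * star (θ₁ : ℂ)) ^ 2, 0] ![0, (b * (θ₁ : ℂ)) ^ 2, 0]
      fun θ => ?_
    simp [Fin.sum_univ_succ]
    ring
  simp only [h2, integral_const, probReal_univ, one_smul]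

/-- Three of the six characters multiply to `1` only if they run once around the triangle `1, 2, 3`.
The two orientations give `a 0 * a 2 * a 5` and `a 1 * a 3 * a 4`, each in `3! = 6` orders. -/
theorem integral_charSum_cube (a : Fin 6 → ℂ) :
    ∫ θ, charSum a θ ^ 3 ∂(circleHaar.prod (circleHaar.prod circleHaar))
      = 6 * (a 0 * a 2 * a 5 + a 1 * a 3 * a 4) := by
  rw [integral_triple _ (f := fun θ => charSum _ θ ^ 3) ((continuous_charSum _).pow 3)]
  have h3 : ∀ θ₁ θ₂ : Circle, ∫ θ₃ : Circle, charSum a (θ₁, θ₂, θ₃) ^ 3 ∂circleHaar =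
      (a 0 * star (θ₁ : ℂ) * θ₂ + a 1 * θ₁ * star (θ₂ : ℂ)) ^ 3
      + 6 * (a 0 * star (θ₁ : ℂ) * θ₂ + a 1 * θ₁ * star (θ₂ : ℂ))
        * (a 2 * star (θ₂ : ℂ) + a 4 * star (θ₁ : ℂ)) * (a 3 * θ₂ + a 5 * θ₁) := by
    intro θ₁ θ₂
    -- As a function of `θ₃` the sum is `C + A θ₃ + B θ̄₃`, and the constant term of its cube is `C³
    -- + 6 C A B`.
    set C := a 0 * star (θ₁ : ℂ) * θ₂ + a 1 * θ₁ * star (θ₂ : ℂ) with hC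
    set A := a 2 * star (θ₂ : ℂ) + a 4 * star (θ₁ : ℂ) with hA
    set B := a 3 * (θ₂ : ℂ) + a 5 * θ₁ with hB
    refine integral_circle_eq ![3 * C ^ 2 * A + 3 * A ^ 2 * B, 3 * C * A ^ 2, A ^ 3]
      ![3 * C ^ 2 * B + 3 * A * B ^ 2, 3 * C * B ^ 2, B ^ 3] fun θ => ?_
    have h1 := star_circle_mul_self θ
    have h2 : charSum a (θ₁, θ₂, θ) = C + A * θ + B * star (θ : ℂ) := by
      simp [charSum, charVec, Fin.sum_univ_succ, hC, hA, hB]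
      ring
    rw [h2]
    simp [Fin.sum_univ_succ]
    rw [RCLike.star_def] at h1
    linear_combination (6 * C * A * B + 3 * A ^ 2 * B * θ
      + 3 * A * B ^ 2 * (starRingEnd ℂ) (θ : ℂ)) * h1
  simp only [h3]
  have h2 : ∀ θ₁ : Circle, ∫ θ₂ : Circle, ((a 0 * star (θ₁ : ℂ) * θ₂ + a 1 * θ₁ * star (θ₂ : ℂ)) ^ 3
      + 6 * (a 0 * star (θ₁ : ℂ) * θ₂ + a 1 * θ₁ * star (θ₂ : ℂ))
        * (a 2 * star (θ₂ : ℂ) + a 4 * star (θ₁ : ℂ)) * (a 3 * θ₂ + a 5 * θ₁)) ∂circleHaar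
      = 6 * (a 0 * a 2 * a 5 + a 1 * a 3 * a 4) := by
    intro θ₁
    set P := a 0 * star (θ₁ : ℂ) with hP
    set Q := a 1 * (θ₁ : ℂ) with hQ
    set k := a 3 * a 4 * star (θ₁ : ℂ) with hk
    set l := a 2 * a 5 * (θ₁ : ℂ) with hl
    set K := a 2 * a 3 + a 4 * a 5 with hK
    have e1 := star_circle_mul_self θ₁
    refine integral_circle_eq ![3 * P ^ 2 * Q + 6 * K * P, 6 * P * k, P ^ 3]
      ![3 * P * Q ^ 2 + 6 * K * Q, 6 * Q * l, Q ^ 3] fun θ => ?_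
    have e2 := star_circle_mul_self θ
    have e3 : (a 2 * star (θ : ℂ) + a 4 * star (θ₁ : ℂ)) * (a 3 * θ + a 5 * θ₁)
        = K + k * θ + l * star (θ : ℂ) := by
      rw [hK, hk, hl]
      linear_combination (a 2 * a 3) * e2 + (a 4 * a 5) * e1
    have e4 : 6 * (a 0 * a 2 * a 5 + a 1 * a 3 * a 4) = 6 * (P * l + Q * k) := by
      rw [hP, hQ, hk, hl]
      linear_combination (-6 * (a 0 * a 2 * a 5 + a 1 * a 3 * a 4)) * e1
    rw [mul_assoc (6 * _), e3, e4]
    rw [RCLike.star_def] at e2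
    simp [Fin.sum_univ_succ]
    linear_combination (3 * P ^ 2 * Q * θ + 3 * P * Q ^ 2 * (starRingEnd ℂ) (θ : ℂ)
      + 6 * (P * l + Q * k)) * e2
  simp only [h2, integral_const, probReal_univ, one_smul]

/-- The symmetric measure on `{1, -1}`. -/
def signMeasure : Measure Circle := (2 : ENNReal)⁻¹ • (Measure.dirac 1 + Measure.dirac (-1))

instance : IsProbabilityMeasure signMeasure := ⟨by
  simp only [signMeasure, Measure.smul_apply, Measure.add_apply, measure_univ, smul_eq_mul]
  rw [one_add_one_eq_two]
  exact ENNReal.inv_mul_cancel (by norm_num) (by norm_num)⟩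

theorem map_neg_signMeasure : signMeasure.map (fun θ => -θ) = signMeasure := by
  have hm : Measurable fun θ : Circle => -θ := by
    have : Continuous fun θ : Circle => -θ := by fun_prop
    exact this.measurable
  rw [signMeasure, Measure.map_smul, Measure.map_add _ _ hm, Measure.map_dirac' hm,
    Measure.map_dirac' hm, neg_neg, add_comm]

theorem integral_signMeasure (f : Circle → ℂ) : ∫ θ, f θ ∂signMeasure = (f 1 + f (-1)) / 2 := by
  have hi : ∀ a : Circle, Integrable f (Measure.dirac a) := fun a => integrable_dirac (by simp)
  rw [signMeasure, integral_smul_measure, integral_add_measure (hi _) (hi _), integral_dirac,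
    integral_dirac, ENNReal.toReal_inv]
  simp [Complex.real_smul]
  ring

/-- On `{1, -1}` the two conjugate characters coincide and have square `1`, so the integrand is
constant. -/
theorem integral_charSum_sign (a b : ℂ) :
    ∫ θ, charSum ![a, b, 0, 0, 0, 0] θ ^ 2 ∂(signMeasure.prod (signMeasure.prod signMeasure))
      = (a + b) ^ 2 := by
  rw [integral_triple _ (f := fun θ => charSum _ θ ^ 2) ((continuous_charSum _).pow 2)]
  have hn : ((-1 : Circle) : ℂ) = -1 := rfl
  simp only [integral_signMeasure]
  simp [charSum, charVec, Fin.sum_univ_succ, hn]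
  ring

theorem map_neg_circleHaar : circleHaar.map (fun θ => -θ) = circleHaar := by
  have h := map_mul_circleHaar (-1)
  simpa using h

end CircleMoments

/-! ### What real moments say about the operators. -/

section InnerProductAlgebra
variable {E : Type*} [NormedAddCommGroup E] [InnerProductSpace ℂ E]

/-- The rank-one operator `u ↦ ⟪b, u⟫ a` has a real quadratic form, so it is symmetric. A symmetric
rank-one operator has its range on the line of `b`, with a real factor. -/
theorem eq_real_smul_of_inner_mul_inner_real {a b : E} (hb : b ≠ 0)
    (h : ∀ u, (inner ℂ u a * inner ℂ b u : ℂ).im = 0) : ∃ c : ℝ, a = (c : ℂ) • b := by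
  set T : E →ₗ[ℂ] E := (innerₛₗ ℂ b).smulRight a with hT
  have hTa : ∀ u, T u = (inner ℂ b u : ℂ) • a := fun u => rfl
  have hs : T.IsSymmetric := by
    rw [LinearMap.isSymmetric_iff_inner_map_self_real]
    intro u
    rw [inner_conj_symm, hTa, inner_smul_right, inner_smul_left, inner_conj_symm]
    have h1 := h u
    rw [mul_comm] at h1
    have h2 := Complex.conj_eq_iff_im.2 h1
    rw [map_mul, inner_conj_symm, inner_conj_symm] at h2
    rw [← h2, mul_comm]
  have hbb : (inner ℂ b b : ℂ) ≠ 0 := inner_self_ne_zero.2 hb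
  have h1 : (inner ℂ b b : ℂ) • a = (inner ℂ a b : ℂ) • b := by
    refine ext_inner_left ℂ fun v => ?_
    have := hs v b
    rw [hTa, hTa, inner_smul_left, inner_conj_symm] at this
    rw [← this, inner_smul_right, mul_comm]
  have h2 : (inner ℂ a b : ℂ).im = 0 := by
    have h3 := h b
    have h4 : ((inner ℂ b b : ℂ)).im = 0 := inner_self_im (𝕜 := ℂ) b
    rw [Complex.mul_im, h4, mul_zero, zero_add] at h3
    have h5 : ((inner ℂ b b : ℂ)).re ≠ 0 := fun h0 => hbb (Complex.ext h0 h4)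
    rw [← inner_conj_symm, Complex.conj_im, (mul_eq_zero.1 h3).resolve_right h5, neg_zero]
  refine ⟨(inner ℂ a b : ℂ).re / (inner ℂ b b : ℂ).re, ?_⟩
  have e1 : (((inner ℂ a b : ℂ).re : ℝ) : ℂ) = inner ℂ a b := Complex.ext rfl h2.symm
  have e2 : (((inner ℂ b b : ℂ).re : ℝ) : ℂ) = inner ℂ b b :=
    Complex.ext rfl (inner_self_im (𝕜 := ℂ) b).symm
  rw [Complex.ofReal_div, e1, e2, div_eq_inv_mul, mul_smul, ← h1, smul_smul, inv_mul_cancel₀ hbb,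
    one_smul]

/-- In dimension at least two, the second and third moments of the pair correlations of two
comparable, distinct positive operators cannot all be real. -/
theorem moments_not_real {P R T : E →L[ℂ] E} (hdim : ∀ w : E, w ≠ 0 → ∃ q : E, q ≠ 0 ∧ inner ℂ q w = (0 : ℂ))
    (hR : ∀ x y, (inner ℂ (R x) y : ℂ) = inner ℂ x (R y))
    (hT : ∀ x y, (inner ℂ (T x) y : ℂ) = inner ℂ x (T y))
    (hPpos : ∀ x, x ≠ 0 → ∃ c : ℝ, 0 < c ∧ (inner ℂ x (P x) : ℂ) = c)
    (hRpos : ∀ x, x ≠ 0 → ∃ c : ℝ, 0 < c ∧ (inner ℂ x (R x) : ℂ) = c)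
    (hTpos : ∀ x, x ≠ 0 → ∃ c : ℝ, 0 < c ∧ (inner ℂ x (T x) : ℂ) = c)
    {σ : ℝ} (hσ : σ ≠ 0)
    (hPR : ∀ x, x ≠ 0 → ∃ c : ℝ, 0 < c ∧ (inner ℂ x (P x) : ℂ) - inner ℂ x (R x) = (σ * c : ℝ))
    (h2 : ∀ u v, (inner ℂ u (P v) * inner ℂ v (R u) : ℂ).im = 0)
    (h3 : ∀ u v w, (inner ℂ u (P v) * inner ℂ v (P w) * inner ℂ w (T u)
      + inner ℂ v (R u) * inner ℂ w (R v) * inner ℂ u (T w) : ℂ).im = 0) [Nontrivial E] : False := by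
  have ne_of_pos : ∀ {S : E →L[ℂ] E}, (∀ x, x ≠ 0 → ∃ c : ℝ, 0 < c ∧ (inner ℂ x (S x) : ℂ) = c) →
      ∀ x, x ≠ 0 → (inner ℂ x (S x) : ℂ) ≠ 0 := by
    intro S hS x hx
    obtain ⟨c, hc, h⟩ := hS x hx
    rw [h]
    exact Complex.ofReal_ne_zero.2 hc.ne'
  have apply_ne : ∀ {S : E →L[ℂ] E}, (∀ x, x ≠ 0 → ∃ c : ℝ, 0 < c ∧ (inner ℂ x (S x) : ℂ) = c) →
      ∀ x, x ≠ 0 → S x ≠ 0 := by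
    intro S hS x hx h0
    exact ne_of_pos hS x hx (by rw [h0, inner_zero_right])
  -- Reality of the second moment makes `P v` and `R v` parallel with a real factor, positivity of
  -- both operators makes it positive, and the definite sign of `P - R` puts it on the side of `1`
  -- given by `σ`.
  have hc : ∀ v, v ≠ 0 → ∃ c : ℝ, P v = (c : ℂ) • R v ∧ 0 < c ∧ 0 < σ * (c - 1) := by
    intro v hv
    obtain ⟨c, hc⟩ := eq_real_smul_of_inner_mul_inner_real (a := P v) (b := R v)
      (apply_ne hRpos v hv) fun u => by rw [hR]; exact h2 u v
    obtain ⟨p, hp, hp'⟩ := hPpos v hv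
    obtain ⟨r, hr, hr'⟩ := hRpos v hv
    obtain ⟨d, hd, hd'⟩ := hPR v hv
    rw [hp', hr', ← Complex.ofReal_sub] at hd'
    have e1 := Complex.ofReal_injective hd'
    rw [hc, inner_smul_right, hr', ← Complex.ofReal_mul] at hp'
    have e2 := Complex.ofReal_injective hp'
    refine ⟨c, hc, ?_, ?_⟩
    · by_contra h
      push Not at h
      nlinarith
    · by_contra h
      push Not at h
      have : (c - 1) * r = σ * d := by linarith
      have h5 : σ * (c - 1) * r = σ ^ 2 * d := by rw [mul_assoc, this]; ring
      have h6 : 0 < σ ^ 2 * d := by positivity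
      nlinarith
  have hpar : ∀ v w, v ≠ 0 → w ≠ 0 → (inner ℂ v (R w) : ℂ) ≠ 0 → ∃ c : ℂ, R v = c • T w := by
    intro v w hv hw hne
    obtain ⟨c, hc1, hc2, hc3⟩ := hc v hv
    obtain ⟨d, hd1, hd2, hd3⟩ := hc w hw
    -- Both factors are positive and lie strictly on the same side of `1`.
    have hcd : c * d - 1 ≠ 0 := by
      intro h0
      rcases lt_or_gt_of_ne hσ with h | h
      · have : c < 1 := by nlinarith
        have : d < 1 := by nlinarith
        nlinarith
      · have : 1 < c := by nlinarith
        have : 1 < d := by nlinarith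
        nlinarith
    -- With this multiple `b` of `T w`, the product `⟪v, R w⟫ ⟪w, T u⟫` is `⟪b, u⟫`, so the rank-one
    -- criterion applies with `a = R v`.
    have hb : (starRingEnd ℂ) (inner ℂ v (R w)) • T w ≠ 0 :=
      smul_ne_zero ((map_ne_zero (starRingEnd ℂ)).2 hne) (apply_ne hTpos w hw)
    obtain ⟨t, ht⟩ := eq_real_smul_of_inner_mul_inner_real (a := R v) hb fun u => by
      have h4 := h3 u v w
      rw [hc1, hd1, inner_smul_right, inner_smul_right] at h4
      -- By symmetry of `R` and `T`, the two orientations of the cycle are complex conjugates up to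
      -- the factor `c d`, so the imaginary part of the sum is `c d - 1` times that of a single
      -- cycle.
      have e : (inner ℂ v (R u) * inner ℂ w (R v) * inner ℂ u (T w) : ℂ) =
          (starRingEnd ℂ) (inner ℂ u (R v) * inner ℂ v (R w) * inner ℂ w (T u)) := by
        rw [map_mul, map_mul, inner_conj_symm, inner_conj_symm, inner_conj_symm, hR, hR, hT]
      have e2 : (c * inner ℂ u (R v) * (d * inner ℂ v (R w)) * inner ℂ w (T u) : ℂ)
          = ((c * d : ℝ) : ℂ) * (inner ℂ u (R v) * inner ℂ v (R w) * inner ℂ w (T u)) := by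
        push_cast; ring
      rw [e, e2, Complex.add_im, Complex.conj_im, Complex.im_ofReal_mul] at h4
      have h5 : (c * d - 1) * (inner ℂ u (R v) * inner ℂ v (R w) * inner ℂ w (T u) : ℂ).im = 0 := by
        linarith
      rw [inner_smul_left, Complex.conj_conj, hT, ← mul_assoc]
      exact (mul_eq_zero.1 h5).resolve_left hcd
    exact ⟨_, by rw [ht, smul_smul]⟩
  obtain ⟨w, hw⟩ := exists_ne (0 : E)
  obtain ⟨q, hq, hqw⟩ := hdim (R w) (apply_ne hRpos w hw)
  have hww := ne_of_pos hRpos w hw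
  obtain ⟨t, ht⟩ := hpar w w hw hw hww
  -- Adding `q` does not change the pairing with `R w`, so `R w` and `R (w + q)` both lie on the
  -- line of `T w`. Injectivity of `R` puts `q` on the line of `w`, which contradicts `⟪q, R w⟫ =
  -- 0`.
  have h5 : (inner ℂ (w + q) (R w) : ℂ) = inner ℂ w (R w) := by rw [inner_add_left, hqw, add_zero]
  obtain ⟨s, hs⟩ := hpar (w + q) w (fun h0 => hww (by rw [← h5, h0, inner_zero_left])) hw (by rwa [h5])
  have ht0 : t ≠ 0 := by
    rintro rfl
    rw [zero_smul] at ht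
    exact apply_ne hRpos w hw ht
  have h6 : R (q - ((s - t) / t) • w) = 0 := by
    rw [map_add] at hs
    rw [map_sub, map_smul, eq_sub_of_add_eq' hs, ht, smul_smul, div_mul_cancel₀ _ ht0, sub_smul,
      sub_self]
  have h7 : q = ((s - t) / t) • w := by
    by_contra h8
    exact apply_ne hRpos _ (sub_ne_zero.2 h8) h6
  rw [h7, inner_smul_left] at hqw
  have h8 := (mul_eq_zero.1 hqw).resolve_right hww
  rw [map_eq_zero] at h8
  rw [h8, zero_smul] at h7
  exact hq h7

end InnerProductAlgebra

/-! ### The thermal operators, and failure of positivity from complex moments. -/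

section Thermal
variable {𝔥 : Type*} [NormedAddCommGroup 𝔥] [InnerProductSpace ℂ 𝔥] [CompleteSpace 𝔥]
  {ε : 𝔥 →ₗ.[ℂ] 𝔥} {m β μ : ℝ}

/-- With `y = e^{βe/4}` the difference is `(y³ - y) / (y⁴ - 1) = 1 / (y + 1/y)`. Its strict
monotonicity is what distinguishes `μ` from `-μ`. -/
theorem thermalCreate_sub_thermalAnnih (hβ : 0 < β) {e : ℝ} (he : 0 < e) :
    thermalCreate β (β / 4) e - thermalAnnih β (β / 4) e
      = (Real.exp (β / 4 * e) + (Real.exp (β / 4 * e))⁻¹)⁻¹ := by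
  unfold thermalCreate thermalAnnih bose
  have h4 : Real.exp (β * e) = Real.exp (β / 4 * e) ^ 4 := by
    rw [← Real.exp_nat_mul]; congr 1; push_cast; ring
  rw [h4, Real.exp_neg]
  set y := Real.exp (β / 4 * e) with hy
  have hy1 : 1 < y := Real.one_lt_exp_iff.2 (by positivity)
  have hy4 : y ^ 4 - 1 ≠ 0 := (sub_pos.2 (one_lt_pow₀ hy1 (by norm_num))).ne'
  have hy0 : y ≠ 0 := by positivity
  have hy2 : y ^ 2 + 1 ≠ 0 := by positivity
  field_simp
  ring

theorem thermalCreate_sub_thermalAnnih_lt (hβ : 0 < β) {d e : ℝ} (hd : 0 < d) (hde : d < e) :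
    thermalCreate β (β / 4) e - thermalAnnih β (β / 4) e
      < thermalCreate β (β / 4) d - thermalAnnih β (β / 4) d := by
  rw [thermalCreate_sub_thermalAnnih hβ hd, thermalCreate_sub_thermalAnnih hβ (hd.trans hde)]
  have h1 : 1 < Real.exp (β / 4 * d) := Real.one_lt_exp_iff.2 (by positivity)
  have h2 : Real.exp (β / 4 * d) < Real.exp (β / 4 * e) := Real.exp_lt_exp.2 (by gcongr)
  set x := Real.exp (β / 4 * d)
  set y := Real.exp (β / 4 * e)
  have hx0 : 0 < x := by positivity
  have hy0 : 0 < y := by positivity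
  refine inv_strictAnti₀ (by positivity) ?_
  rw [← sub_pos]
  have : y + y⁻¹ - (x + x⁻¹) = (y - x) * (x * y - 1) / (x * y) := by field_simp; ring
  rw [this]
  have h3 : 0 < x * y - 1 := by nlinarith
  have h4 : 0 < y - x := by linarith
  positivity

theorem thermalCreate_half (hβ : 0 < β) {e : ℝ} (he : 0 < e) :
    thermalCreate β (β / 2) e = thermalAnnih β (β / 2) e := by
  unfold thermalCreate thermalAnnih
  rw [← bose_mul_exp hβ he, mul_assoc, ← Real.exp_add]
  congr 2
  ring

/-- At the midpoint `β/2` the two thermal factors agree, so a change of the sign of `μ` merely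
exchanges the summands. -/
theorem thermalOp_half (H : IsGapped ε m) (hβ : 0 < β) (hμm : |μ| < m) :
    thermalOp ε β (-μ) (β / 2) = thermalOp ε β μ (β / 2) := by
  have hμ' : |-μ| < m := by rwa [abs_neg]
  refine H.fc_congr (bddCont_thermalOp hβ hμ' (by positivity) (by linarith))
    (bddCont_thermalOp hβ hμm (by positivity) (by linarith)) fun e he => ?_
  obtain ⟨h1, h2⟩ := abs_lt.1 hμm
  rw [neg_neg, thermalCreate_half hβ (by linarith), thermalCreate_half hβ (by linarith), add_comm]

theorem thermalOp_symmetric (H : IsGapped ε m) (hβ : 0 < β) (hμm : |μ| < m) {s : ℝ} (hs : 0 ≤ s)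
    (hs' : s ≤ β) (x y : 𝔥) :
    (inner ℂ (thermalOp ε β μ s x) y : ℂ) = inner ℂ x (thermalOp ε β μ s y) :=
  H.inner_fc_real_left (bddCont_thermalOp hβ hμm hs hs') x y

theorem inner_thermalOp_pos (H : IsGapped ε m) (hβ : 0 < β) (hμm : |μ| < m) {s : ℝ} (hs : 0 ≤ s)
    (hs' : s ≤ β) (x : 𝔥) (hx : x ≠ 0) :
    ∃ c : ℝ, 0 < c ∧ (inner ℂ x (thermalOp ε β μ s x) : ℂ) = c := by
  refine H.inner_fc_pos (bddCont_thermalOp hβ hμm hs hs') (fun e he => ?_) hx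
  obtain ⟨h1, h2⟩ := abs_lt.1 hμm
  exact add_pos (thermalCreate_pos hβ s (by linarith)) (thermalAnnih_pos hβ s (by linarith))

/-- The difference of the two operators is `g(ε - μ) - g(ε + μ)` for the strictly decreasing
function `g = thermalCreate - thermalAnnih` at `β/4`. -/
theorem inner_thermalOp_lt (H : IsGapped ε m) (hβ : 0 < β) (hμm : |μ| < m) (hμ : 0 < μ) (x : 𝔥)
    (hx : x ≠ 0) : ∃ c : ℝ, 0 < c ∧ (inner ℂ x (thermalOp ε β μ (β / 4) x) : ℂ)
      = inner ℂ x (thermalOp ε β (-μ) (β / 4) x) + c := by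
  have hμ' : |-μ| < m := by rwa [abs_neg]
  have hp := bddCont_thermalOp (m := m) (s := β / 4) hβ hμm (by positivity) (by linarith)
  have hr := bddCont_thermalOp (m := m) (s := β / 4) hβ hμ' (by positivity) (by linarith)
  set p : ℝ → ℝ := fun e => thermalCreate β (β / 4) (e - μ) + thermalAnnih β (β / 4) (e - -μ) with hpd
  set r : ℝ → ℝ := fun e => thermalCreate β (β / 4) (e - -μ) + thermalAnnih β (β / 4) (e - - -μ)
    with hrd
  have hd : BddCont m fun e => ((p e - r e : ℝ) : ℂ) := by
    have h1 := hp.add ((BddCont.const (-1)).mul hr)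
    have h2 : (fun e => ((p e - r e : ℝ) : ℂ)) = fun e => (p e : ℂ) + -1 * (r e : ℂ) := by
      funext e
      push_cast
      ring
    rw [h2]
    exact h1
  obtain ⟨c, hc, h⟩ := H.inner_fc_pos hd (fun e he => by
    obtain ⟨h1, h2⟩ := abs_lt.1 hμm
    have := thermalCreate_sub_thermalAnnih_lt (d := e - μ) (e := e - -μ) hβ (by linarith)
      (by linarith)
    simp only [hpd, hrd, neg_neg]
    linarith) hx
  refine ⟨c, hc, ?_⟩
  rw [← h, ← inner_add_right]
  have h2 := H.fc_add hr hd
  have h3 : thermalOp ε β μ (β / 4) = boundedFC ε fun e => (r e : ℂ) + ((p e - r e : ℝ) : ℂ) := by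
    refine congrArg (boundedFC ε) (funext fun e => ?_)
    rw [← Complex.ofReal_add, add_sub_cancel]
  rw [h3, ← h2, add_apply]
  rfl

theorem exists_sign_thermalOp (H : IsGapped ε m) (hβ : 0 < β) (hμm : |μ| < m) (hμ : μ ≠ 0) :
    ∃ σ : ℝ, σ ≠ 0 ∧ ∀ x : 𝔥, x ≠ 0 → ∃ c : ℝ, 0 < c ∧ (inner ℂ x (thermalOp ε β μ (β / 4) x) : ℂ)
      - inner ℂ x (thermalOp ε β (-μ) (β / 4) x) = (σ * c : ℝ) := by
  rcases lt_or_gt_of_ne hμ with h | h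
  · refine ⟨-1, by norm_num, fun x hx => ?_⟩
    obtain ⟨c, hc, hc'⟩ := inner_thermalOp_lt H hβ (μ := -μ) (by rwa [abs_neg]) (by linarith) x hx
    rw [neg_neg] at hc'
    exact ⟨c, hc, by rw [hc']; push_cast; ring⟩
  · refine ⟨1, one_ne_zero, fun x hx => ?_⟩
    obtain ⟨c, hc, hc'⟩ := inner_thermalOp_lt H hβ hμm h x hx
    exact ⟨c, hc, by rw [hc']; push_cast; ring⟩

variable (ν : Measure Circle) [IsProbabilityMeasure ν]

theorem pairCoeff_smul (r : ℝ) (u v w : 𝔥) : pairCoeff ε β μ ((r : ℂ) • u) ((r : ℂ) • v) ((r : ℂ) • w)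
    = ((r ^ 2 : ℝ) : ℂ) • pairCoeff ε β μ u v w := by
  ext i
  fin_cases i <;>
    simp [pairCoeff, inner_smul_left, inner_smul_right] <;> ring

theorem charSum_smul (c : ℂ) (a : Fin 6 → ℂ) (θ : Circle × Circle × Circle) :
    charSum (c • a) θ = c * charSum a θ := by
  simp only [charSum, Finset.mul_sum, Pi.smul_apply, smul_eq_mul, mul_assoc]

theorem moment_real (H : IsGapped ε m) (hβ : 0 < β) (hμm : |μ| < m)
    {J : 𝔥 ≃ₗᵢ⋆[ℂ] 𝔥} (hJ : ∀ x, J (J x) = x)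
    (hreal : ∀ x : ε.domain, ∃ hx : J (x : 𝔥) ∈ ε.domain, ε ⟨J (x : 𝔥), hx⟩ = J (ε x))
    (hν : ν.map (fun θ => -θ) = ν)
    {𝓕 𝓤 : StarSubalgebra ℂ (ArakiWoods 𝔥 →L[ℂ] ArakiWoods 𝔥)}
    (h𝓤 : ∀ u, avgWeyl ν ε β μ (kpath J circleIncl u) ∈ 𝓤)
    (hpos : IsStochasticallyPositive 𝓕 𝓤 (dynamics ε μ) state β)
    {u v w : 𝔥} (hu : BoundedEnergy ε u) (hv : BoundedEnergy ε v) (hw : BoundedEnergy ε w) (n : ℕ) :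
    (∫ θ, charSum (pairCoeff ε β μ u v w) θ ^ n ∂(ν.prod (ν.prod ν))).im = 0 := by
  refine moments_real_of_integral_exp_real _ (continuous_charSum _) (fun t ht => ?_) n
  -- Scaling all vectors by `√(-2t)` multiplies the quadratic coefficients by `-2t`, so that the
  -- prefactor `-1/2` of the exponent becomes `t`.
  have h := euclideanThree_real ν H hβ hμm hJ hreal hν h𝓤 hpos (hu.smul (√(-2 * t) : ℝ))
    (hv.smul (√(-2 * t) : ℝ)) (hw.smul (√(-2 * t) : ℝ))
  rw [euclideanThree, Complex.im_ofReal_mul, pairCoeff_smul, Real.sq_sqrt (by linarith)] at h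
  have h2 := (mul_eq_zero.1 h).resolve_left (Real.exp_pos _).ne'
  simp only [charSum_smul, ← mul_assoc, ← Complex.ofReal_mul] at h2
  have h3 : -1 / 2 * -2 * t = t := by ring
  rwa [h3] at h2

theorem pairCoeff_zero_right (u v : 𝔥) : pairCoeff ε β μ u v 0 =
    ![inner ℂ u (thermalOp ε β μ (β / 4) v), inner ℂ v (thermalOp ε β (-μ) (β / 4) u), 0, 0, 0, 0] := by
  simp [pairCoeff]

theorem forall_of_boundedEnergy (H : IsGapped ε m) {f : 𝔥 × 𝔥 × 𝔥 → ℂ} (hf : Continuous f)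
    (h : ∀ u v w, BoundedEnergy ε u → BoundedEnergy ε v → BoundedEnergy ε w → (f (u, v, w)).im = 0)
    (u v w : 𝔥) : (f (u, v, w)).im = 0 := by
  have hd := H.dense_cutoff.prod (H.dense_cutoff.prod H.dense_cutoff)
  have hc : Continuous fun p => (f p).im := Complex.continuous_im.comp hf
  have := hc.ext_on hd (continuous_const (y := (0 : ℝ))) fun p hp => h p.1 p.2.1 p.2.2 hp.1 hp.2.1 hp.2.2
  exact congrFun this (u, v, w)

/-- The charged field is not stochastically positive. -/
theorem not_isStochasticallyPositive_field [Nontrivial 𝔥] (H : IsGapped ε m) (hβ : 0 < β)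
    (hμm : |μ| < m) (hμ : μ ≠ 0) {J : 𝔥 ≃ₗᵢ⋆[ℂ] 𝔥} (hJ : ∀ x, J (J x) = x)
    (hreal : ∀ x : ε.domain, ∃ hx : J (x : 𝔥) ∈ ε.domain, ε ⟨J (x : 𝔥), hx⟩ = J (ε x)) :
    ¬ IsStochasticallyPositive (fieldAlgebra ε β μ) (timeZeroAlgebra J ε β μ)
      (dynamics ε μ) state β := by
  intro hpos
  have hμ' : |-μ| < m := by rwa [abs_neg]
  have h := fun u v w : 𝔥 => forall_of_boundedEnergy H (f := fun p : 𝔥 × 𝔥 × 𝔥 =>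
    ((inner ℂ p.1 (thermalOp ε β μ (β / 4) p.2.1) : ℂ)
      + inner ℂ p.2.1 (thermalOp ε β (-μ) (β / 4) p.1)) ^ 2) (by fun_prop) (fun u v w hu hv _ => by
        have := moment_real signMeasure H hβ hμm hJ hreal map_neg_signMeasure
          (avgWeyl_kpath_mem_timeZero signMeasure hJ circleIncl) hpos hu hv BoundedEnergy.zero 2
        rwa [pairCoeff_zero_right, integral_charSum_sign] at this) u v w
  obtain ⟨σ, hσ, hσ'⟩ := exists_sign_thermalOp H hβ hμm hμ
  obtain ⟨u, hu⟩ := exists_ne (0 : 𝔥)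
  obtain ⟨p, hp, hp'⟩ := inner_thermalOp_pos (s := β / 4) H hβ hμm (by positivity) (by linarith) u hu
  obtain ⟨r, hr, hr'⟩ := inner_thermalOp_pos (s := β / 4) H hβ hμ' (by positivity) (by linarith) u hu
  obtain ⟨c, hc, hc'⟩ := hσ' u hu
  -- For `v = (1 + i) u` the sum of the correlations is `(p + r) + i (p - r)`, whose square has
  -- imaginary part `2 (p + r) (p - r)`; the second factor is not zero since `P - R` is definite.
  have h1 := h u ((1 + Complex.I) • u) 0
  simp only [map_smul, inner_smul_left, inner_smul_right, hp', hr'] at h1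
  rw [hp', hr', ← Complex.ofReal_sub] at hc'
  have e := Complex.ofReal_injective hc'
  have e2 : (((1 + Complex.I) * p + (starRingEnd ℂ) (1 + Complex.I) * r) ^ 2).im
      = 2 * (p + r) * (p - r) := by
    simp [pow_two, Complex.mul_im, Complex.mul_re]
    ring
  rw [e2, e] at h1
  have : (p + r) ≠ 0 := by positivity
  have : c ≠ 0 := hc.ne'
  simp_all

/-- In dimension at least two, the observables are not stochastically positive. -/
theorem not_isStochasticallyPositive_observable [Nontrivial 𝔥] (H : IsGapped ε m) (hβ : 0 < β)
    (hμm : |μ| < m) (hμ : μ ≠ 0) {J : 𝔥 ≃ₗᵢ⋆[ℂ] 𝔥} (hJ : ∀ x, J (J x) = x)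
    (hreal : ∀ x : ε.domain, ∃ hx : J (x : 𝔥) ∈ ε.domain, ε ⟨J (x : 𝔥), hx⟩ = J (ε x))
    (hdim : ∀ w : 𝔥, w ≠ 0 → ∃ q : 𝔥, q ≠ 0 ∧ inner ℂ q w = (0 : ℂ)) :
    ¬ IsStochasticallyPositive (observableAlgebra ε β μ) (timeZeroObservables J ε β μ)
      (dynamics ε μ) state β := by
  intro hpos
  have hμ' : |-μ| < m := by rwa [abs_neg]
  have h𝓤 : ∀ u, avgWeyl circleHaar ε β μ (kpath J circleIncl u) ∈ timeZeroObservables J ε β μ :=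
    fun u => by rw [kpath_circleIncl]; exact avgWeyl_orbit_mem_timeZeroObservables hJ u
  obtain ⟨σ, hσ, hσ'⟩ := exists_sign_thermalOp H hβ hμm hμ
  refine moments_not_real (P := thermalOp ε β μ (β / 4)) (R := thermalOp ε β (-μ) (β / 4))
    (T := thermalOp ε β μ (β / 2)) hdim
    (thermalOp_symmetric H hβ hμ' (by positivity) (by linarith))
    (thermalOp_symmetric H hβ hμm (by positivity) (by linarith))
    (inner_thermalOp_pos H hβ hμm (by positivity) (by linarith))
    (inner_thermalOp_pos H hβ hμ' (by positivity) (by linarith))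
    (inner_thermalOp_pos H hβ hμm (by positivity) (by linarith)) hσ hσ' (fun u v => ?_) fun u v w => ?_
  · exact forall_of_boundedEnergy H (f := fun p : 𝔥 × 𝔥 × 𝔥 =>
      (inner ℂ p.1 (thermalOp ε β μ (β / 4) p.2.1) : ℂ)
        * inner ℂ p.2.1 (thermalOp ε β (-μ) (β / 4) p.1)) (by fun_prop) (fun u v w hu hv _ => by
      have := moment_real circleHaar H hβ hμm hJ hreal map_neg_circleHaar h𝓤 hpos hu hv
        BoundedEnergy.zero 2
      rw [pairCoeff_zero_right, integral_charSum_sq, ← Complex.ofReal_ofNat,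
        Complex.im_ofReal_mul] at this
      exact (mul_eq_zero.1 this).resolve_left (by norm_num)) u v 0
  · exact forall_of_boundedEnergy H (f := fun p : 𝔥 × 𝔥 × 𝔥 =>
      (inner ℂ p.1 (thermalOp ε β μ (β / 4) p.2.1) * inner ℂ p.2.1 (thermalOp ε β μ (β / 4) p.2.2)
          * inner ℂ p.2.2 (thermalOp ε β μ (β / 2) p.1)
        + inner ℂ p.2.1 (thermalOp ε β (-μ) (β / 4) p.1)
          * inner ℂ p.2.2 (thermalOp ε β (-μ) (β / 4) p.2.1)
          * inner ℂ p.1 (thermalOp ε β μ (β / 2) p.2.2) : ℂ)) (by fun_prop) (fun u v w hu hv hw => by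
      have := moment_real circleHaar H hβ hμm hJ hreal map_neg_circleHaar h𝓤 hpos hu hv hw 3
      rw [integral_charSum_cube, ← Complex.ofReal_ofNat, Complex.im_ofReal_mul] at this
      have h6 := (mul_eq_zero.1 this).resolve_left (by norm_num)
      have h7 : (inner ℂ u (thermalOp ε β μ (β / 4) v) * inner ℂ v (thermalOp ε β μ (β / 4) w)
          * inner ℂ w (thermalOp ε β (-μ) (β / 2) u)
        + inner ℂ v (thermalOp ε β (-μ) (β / 4) u) * inner ℂ w (thermalOp ε β (-μ) (β / 4) v)
          * inner ℂ u (thermalOp ε β μ (β / 2) w) : ℂ).im = 0 := h6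
      -- The edge of length `β/2` carries the same operator `T` in both orientations of the cycle.
      rw [thermalOp_half H hβ hμm] at h7
      exact h7) u v w

end Thermal

/-! ### Closed invariant subspaces of generated von Neumann algebras. -/

section InvariantSubspace
variable {H : Type*} [NormedAddCommGroup H] [InnerProductSpace ℂ H] [CompleteSpace H]

/-- Invariance under the generators and their adjoints puts the orthogonal projection onto `V` in
the commutant, with which `T` commutes. -/
theorem apply_mem_of_mem_vonNeumannSpan {S : Set (H →L[ℂ] H)} {V : Submodule ℂ H}
    (hV : IsClosed (V : Set H)) (h : ∀ A ∈ S, ∀ x ∈ V, A x ∈ V) (h' : ∀ A ∈ S, ∀ x ∈ V, star A x ∈ V)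
    {T : H →L[ℂ] H} (hT : T ∈ vonNeumannSpan S) {x : H} (hx : x ∈ V) : T x ∈ V := by
  have : CompleteSpace V := hV.completeSpace_coe
  have key : ∀ A : H →L[ℂ] H, (∀ x ∈ V, A x ∈ V) → (∀ x ∈ V, star A x ∈ V) →
      A * V.starProjection = V.starProjection * A := by
    intro A hA hA'
    refine ContinuousLinearMap.ext fun x => ?_
    rw [mul_apply_eq_comp, mul_apply_eq_comp]
    have h1 : A (x - V.starProjection x) ∈ Vᗮ := by
      rw [Submodule.mem_orthogonal]
      intro u hu
      rw [← ContinuousLinearMap.adjoint_inner_left, ← ContinuousLinearMap.star_eq_adjoint]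
      exact (Submodule.mem_orthogonal _ _).1 (V.sub_starProjection_mem_orthogonal x) _ (hA' u hu)
    have h2 := Submodule.starProjection_apply_eq_zero_iff (K := V).2 h1
    have h3 := Submodule.starProjection_eq_self_iff (K := V).2
      (hA _ (V.starProjection_apply_mem x))
    rw [map_sub, map_sub, h3, sub_eq_zero] at h2
    exact h2.symm
  have hP : V.starProjection ∈ StarSubalgebra.centralizer ℂ S := by
    rw [StarSubalgebra.mem_centralizer_iff]
    intro A hA
    refine ⟨key A (h A hA) (h' A hA), key (star A) (h' A hA) ?_⟩
    rw [star_star]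
    exact h A hA
  rw [vonNeumannSpan, StarSubalgebra.mem_centralizer_iff] at hT
  have h1 := DFunLike.congr_fun (hT _ hP).1 x
  rw [mul_apply_eq_comp, mul_apply_eq_comp, Submodule.starProjection_eq_self_iff.2 hx] at h1
  rw [← h1]
  exact V.starProjection_apply_mem _

theorem apply_mem_of_mem_closure_span {ι : Type*} {g : ι → H} {f : H →L[ℂ] H} {V : Submodule ℂ H}
    (hV : IsClosed (V : Set H)) (h : ∀ i, f (g i) ∈ V) {x : H}
    (hx : x ∈ (Submodule.span ℂ (Set.range g)).topologicalClosure) : f x ∈ V := by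
  have h2 : (Submodule.span ℂ (Set.range g)).topologicalClosure ≤ V.comap f.toLinearMap := by
    refine Submodule.topologicalClosure_minimal _ (Submodule.span_le.2 ?_) (hV.preimage f.continuous)
    rintro _ ⟨i, rfl⟩
    exact h i
  exact h2 hx

theorem mem_closure_span {ι : Type*} (g : ι → H) (i : ι) :
    g i ∈ (Submodule.span ℂ (Set.range g)).topologicalClosure :=
  (Submodule.le_topologicalClosure _) (Submodule.subset_span ⟨i, rfl⟩)

end InvariantSubspace

/-! ### Action of the observables on gauge invariant vectors. -/

section GaugeInvariantVectors
variable {𝔥 : Type*} [NormedAddCommGroup 𝔥] [InnerProductSpace ℂ 𝔥] [CompleteSpace 𝔥]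
  {ε : 𝔥 →ₗ.[ℂ] 𝔥} {m β μ : ℝ}

variable (𝔥) in
/-- The space of gauge invariant vectors. -/
def gaugeInvariant : Submodule ℂ (ArakiWoods 𝔥) where
  carrier := {ψ | ∀ t, gaugeGroup 𝔥 t ψ = ψ}
  add_mem' hψ hφ t := by rw [map_add, hψ t, hφ t]
  zero_mem' t := map_zero _
  smul_mem' c ψ hψ t := by rw [map_smul, hψ t]

theorem mem_gaugeInvariant {ψ : ArakiWoods 𝔥} :
    ψ ∈ gaugeInvariant 𝔥 ↔ ∀ t, gaugeGroup 𝔥 t ψ = ψ := Iff.rfl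

theorem isClosed_gaugeInvariant : IsClosed (gaugeInvariant 𝔥 : Set (ArakiWoods 𝔥)) := by
  have : (gaugeInvariant 𝔥 : Set (ArakiWoods 𝔥)) = ⋂ t, {ψ | gaugeGroup 𝔥 t ψ = ψ} := by
    ext ψ
    simp [mem_gaugeInvariant]
  rw [this]
  exact isClosed_iInter fun t => isClosed_eq (gaugeGroup 𝔥 t).continuous continuous_id

theorem avgWeyl_mem_gaugeInvariant (x : OneParticle 𝔥) {ψ : ArakiWoods 𝔥}
    (hψ : ψ ∈ gaugeInvariant 𝔥) : avgWeyl circleHaar ε β μ (orbit x) ψ ∈ gaugeInvariant 𝔥 := by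
  intro t
  rw [← mul_apply_eq_comp, gaugeGroup_comm_avgWeyl, mul_apply_eq_comp, hψ t]

/-- Rotating `x` amounts to conjugation by a gauge unitary, which fixes both vectors. -/
theorem inner_weyl_rot (x : OneParticle 𝔥) (θ : Circle) {χ ψ : ArakiWoods 𝔥}
    (hχ : χ ∈ gaugeInvariant 𝔥) (hψ : ψ ∈ gaugeInvariant 𝔥) :
    (inner ℂ χ (weyl ε β μ (rot θ x) ψ) : ℂ) = inner ℂ χ (weyl ε β μ x ψ) := by
  have hθ : (θ : ℂ) = Complex.exp (Complex.I * (Complex.arg θ : ℝ)) := by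
    conv_lhs => rw [← Circle.exp_arg θ]
    rw [Circle.coe_exp, mul_comm]
  rw [hθ]
  set t := Complex.arg θ
  have h := DFunLike.congr_fun (gaugeGroup_mul_weyl (ε := ε) (β := β) (μ := μ) t x) ψ
  rw [mul_apply_eq_comp, mul_apply_eq_comp, hψ t] at h
  rw [← h, ← ContinuousLinearMap.adjoint_inner_left, ← ContinuousLinearMap.star_eq_adjoint,
    star_gaugeGroup, hχ]

/-- The gauge average of a Weyl operator, on gauge invariant vectors, is its compression. -/
theorem starProjection_weyl (x : OneParticle 𝔥) {ψ : ArakiWoods 𝔥} (hψ : ψ ∈ gaugeInvariant 𝔥)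
    [(gaugeInvariant 𝔥).HasOrthogonalProjection] :
    (gaugeInvariant 𝔥).starProjection (weyl ε β μ x ψ)
      = avgWeyl circleHaar ε β μ (orbit x) ψ := by
  refine Submodule.eq_starProjection_of_mem_of_inner_eq_zero (avgWeyl_mem_gaugeInvariant x hψ) ?_
  intro χ hχ
  rw [← inner_conj_symm, inner_sub_right, inner_avgWeyl]
  simp only [orbit_apply, inner_weyl_rot x _ hχ hψ, integral_const, probReal_univ, one_smul, sub_self,
    map_zero]

theorem gaugeGroup_comm_of_mem {J : 𝔥 ≃ₗᵢ⋆[ℂ] 𝔥} {A : ArakiWoods 𝔥 →L[ℂ] ArakiWoods 𝔥}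
    (hA : A ∈ timeZeroObservables J ε β μ) (t : ℝ) :
    gaugeGroup 𝔥 t * A = A * gaugeGroup 𝔥 t :=
  ((StarSubalgebra.mem_centralizer_iff ℂ).1 (StarSubalgebra.mem_inf.1
    (StarSubalgebra.mem_inf.1 hA).1).2 _ ⟨t, rfl⟩).1

theorem mem_gaugeInvariant_apply {J : 𝔥 ≃ₗᵢ⋆[ℂ] 𝔥} {A : ArakiWoods 𝔥 →L[ℂ] ArakiWoods 𝔥}
    (hA : A ∈ timeZeroObservables J ε β μ) {ψ : ArakiWoods 𝔥} (hψ : ψ ∈ gaugeInvariant 𝔥) :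
    A ψ ∈ gaugeInvariant 𝔥 := by
  intro t
  rw [← mul_apply_eq_comp, gaugeGroup_comm_of_mem hA, mul_apply_eq_comp, hψ t]

theorem kvec_add (J : 𝔥 ≃ₗᵢ⋆[ℂ] 𝔥) (u v : 𝔥) : kvec J u + kvec J v = kvec J (u + v) := by
  rw [kvec, kvec, kvec, map_add]; rfl

theorem kvec_neg (J : 𝔥 ≃ₗᵢ⋆[ℂ] 𝔥) (u : 𝔥) : -kvec J u = kvec J (-u) := by
  rw [kvec, kvec, map_neg]; rfl

theorem kvec_zero (J : 𝔥 ≃ₗᵢ⋆[ℂ] 𝔥) : kvec J (0 : 𝔥) = 0 := by simp [kvec]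

theorem weyl_apply_mem_closure_span (H : IsGapped ε m) (hβ : 0 < β) (hμm : |μ| < m)
    (J : 𝔥 ≃ₗᵢ⋆[ℂ] 𝔥) (ψ : ArakiWoods 𝔥) (u : 𝔥) {φ : ArakiWoods 𝔥}
    (hφ : φ ∈ (Submodule.span ℂ (Set.range fun u : 𝔥 =>
      weyl ε β μ (kvec J u) ψ)).topologicalClosure) :
    weyl ε β μ (kvec J u) φ ∈ (Submodule.span ℂ (Set.range fun u : 𝔥 =>
      weyl ε β μ (kvec J u) ψ)).topologicalClosure := by
  refine apply_mem_of_mem_closure_span (Submodule.isClosed_topologicalClosure _) (fun v => ?_) hφ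
  rw [← mul_apply_eq_comp, weyl_mul H hβ hμm, kvec_add, smul_apply]
  exact Submodule.smul_mem _ _ (mem_closure_span (fun u : 𝔥 => weyl ε β μ (kvec J u) ψ) (u + v))

theorem apply_mem_closure_span_weyl (H : IsGapped ε m) (hβ : 0 < β) (hμm : |μ| < m)
    {J : 𝔥 ≃ₗᵢ⋆[ℂ] 𝔥}
    {A : ArakiWoods 𝔥 →L[ℂ] ArakiWoods 𝔥} (hA : A ∈ timeZeroObservables J ε β μ)
    (ψ : ArakiWoods 𝔥) : A ψ ∈ (Submodule.span ℂ (Set.range fun u : 𝔥 =>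
      weyl ε β μ (kvec J u) ψ)).topologicalClosure := by
  have hψ := mem_closure_span (fun u : 𝔥 => weyl ε β μ (kvec J u) ψ) 0
  rw [kvec_zero, weyl_zero, one_apply_eq_self] at hψ
  refine apply_mem_of_mem_vonNeumannSpan (Submodule.isClosed_topologicalClosure _) ?_ ?_
    (StarSubalgebra.mem_inf.1 hA).2 hψ
  · rintro _ ⟨x, hx, rfl⟩ φ hφ
    rw [eq_kvec hx]
    exact weyl_apply_mem_closure_span H hβ hμm J ψ _ hφ
  · rintro _ ⟨x, hx, rfl⟩ φ hφ
    rw [eq_kvec hx, star_weyl, kvec_neg]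
    exact weyl_apply_mem_closure_span H hβ hμm J ψ _ hφ

/-- The vector `A ψ` is a limit of combinations of vectors `W_ω(x) ψ` with `x ∈ X_κ`, and it is its
own projection onto the gauge invariant vectors. That projection turns `W_ω(x) ψ` into the averaged
Weyl operator applied to `ψ`, so arbitrary time-zero observables are replaced by explicit ones,
vector by vector. -/
theorem apply_mem_closure_span (H : IsGapped ε m) (hβ : 0 < β) (hμm : |μ| < m)
    {J : 𝔥 ≃ₗᵢ⋆[ℂ] 𝔥}
    {A : ArakiWoods 𝔥 →L[ℂ] ArakiWoods 𝔥} (hA : A ∈ timeZeroObservables J ε β μ)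
    {ψ : ArakiWoods 𝔥} (hψ : ψ ∈ gaugeInvariant 𝔥) :
    A ψ ∈ (Submodule.span ℂ (Set.range fun u : 𝔥 =>
      avgWeyl circleHaar ε β μ (orbit (kvec J u)) ψ)).topologicalClosure := by
  have : CompleteSpace (gaugeInvariant 𝔥) := isClosed_gaugeInvariant.completeSpace_coe
  rw [← Submodule.starProjection_eq_self_iff.2 (mem_gaugeInvariant_apply hA hψ)]
  refine apply_mem_of_mem_closure_span (Submodule.isClosed_topologicalClosure _) (fun u => ?_)
    (apply_mem_closure_span_weyl H hβ hμm hA ψ)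
  rw [starProjection_weyl _ hψ]
  exact mem_closure_span (fun u : 𝔥 => avgWeyl circleHaar ε β μ (orbit (kvec J u)) ψ) u

theorem gaugeGroup_liouvilleGroup (H : IsGapped ε m) (s t : ℝ) :
    gaugeGroup 𝔥 s * liouvilleGroup ε μ t = liouvilleGroup ε μ t * gaugeGroup 𝔥 s := by
  rw [gaugeGroup_eq, liouvilleGroup_eq, doubledQuant_mul (inner_rot (star_mul_self_exp s))
    (inner_evol H t), doubledQuant_mul (inner_evol H t) (inner_rot (star_mul_self_exp s))]
  congr 1
  exact ContinuousLinearMap.ext fun x => (evol_rot t _ x).symm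

theorem star_dynamics (H : IsGapped ε m) (t : ℝ) (A : ArakiWoods 𝔥 →L[ℂ] ArakiWoods 𝔥) :
    star (dynamics ε μ t A) = dynamics ε μ t (star A) := by
  have hs : ∀ t, star (liouvilleGroup ε μ t) = liouvilleGroup ε μ (-t) := by
    intro t
    rw [liouvilleGroup_eq, liouvilleGroup_eq]
    refine star_doubledQuant (inner_evol H t) (inner_evol H (-t)) ?_
    rw [evol_mul H, neg_add_cancel, evol_zero H]
  rw [dynamics, dynamics, star_mul, star_mul, hs, hs, neg_neg, mul_assoc]

theorem evolPath_orbit (t : ℝ) (x : OneParticle 𝔥) :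
    evolPath ε μ t (orbit x) = orbit (evol ε μ t x) := by
  ext1 θ
  exact evol_rot t θ x

theorem dynamics_apply (t : ℝ) (A : ArakiWoods 𝔥 →L[ℂ] ArakiWoods 𝔥) (ψ : ArakiWoods 𝔥) :
    dynamics ε μ t A ψ = liouvilleGroup ε μ t (A (liouvilleGroup ε μ (-t) ψ)) := rfl

/-- The vector `e^{-itL} φ` need not lie in `V`, but it is gauge invariant, which is all that the
approximation of `A` requires. Applying `e^{itL}` turns the approximants into translated averages
acting on `φ` itself. -/
theorem dynamics_apply_mem (H : IsGapped ε m) (hβ : 0 < β) (hμm : |μ| < m) {J : 𝔥 ≃ₗᵢ⋆[ℂ] 𝔥}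
    {V : Submodule ℂ (ArakiWoods 𝔥)} (hV : IsClosed (V : Set (ArakiWoods 𝔥)))
    (hVg : V ≤ gaugeInvariant 𝔥)
    (h : ∀ (t : ℝ) (u : 𝔥), ∀ ψ ∈ V, avgWeyl circleHaar ε β μ (orbit (evol ε μ t (kvec J u))) ψ ∈ V)
    (t : ℝ) {A : ArakiWoods 𝔥 →L[ℂ] ArakiWoods 𝔥} (hA : A ∈ timeZeroObservables J ε β μ)
    {φ : ArakiWoods 𝔥} (hφ : φ ∈ V) : dynamics ε μ t A φ ∈ V := by
  have hφ' : liouvilleGroup ε μ (-t) φ ∈ gaugeInvariant 𝔥 := by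
    intro s
    rw [← mul_apply_eq_comp, gaugeGroup_liouvilleGroup H, mul_apply_eq_comp, hVg hφ s]
  rw [dynamics_apply]
  refine apply_mem_of_mem_closure_span hV (fun u => ?_) (apply_mem_closure_span H hβ hμm hA hφ')
  rw [← dynamics_apply, dynamics_avgWeyl circleHaar H hβ hμm, evolPath_orbit]
  exact h t u φ hφ

/-- A closed space of gauge invariant vectors that is invariant under the time translates of the
averaged Weyl operators is invariant under the algebra that the observables generate. -/
theorem generated_apply_mem (H : IsGapped ε m) (hβ : 0 < β) (hμm : |μ| < m) {J : 𝔥 ≃ₗᵢ⋆[ℂ] 𝔥}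
    {V : Submodule ℂ (ArakiWoods 𝔥)} (hV : IsClosed (V : Set (ArakiWoods 𝔥)))
    (hVg : V ≤ gaugeInvariant 𝔥)
    (h : ∀ (t : ℝ) (u : 𝔥), ∀ ψ ∈ V, avgWeyl circleHaar ε β μ (orbit (evol ε μ t (kvec J u))) ψ ∈ V)
    {T : ArakiWoods 𝔥 →L[ℂ] ArakiWoods 𝔥}
    (hT : T ∈ vonNeumannSpan (⋃ t : ℝ, dynamics ε μ t '' (timeZeroObservables J ε β μ :
      Set (ArakiWoods 𝔥 →L[ℂ] ArakiWoods 𝔥)))) {ψ : ArakiWoods 𝔥} (hψ : ψ ∈ V) : T ψ ∈ V := by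
  refine apply_mem_of_mem_vonNeumannSpan hV ?_ ?_ hT hψ
  · rintro B hB φ hφ
    obtain ⟨t, A, hA, rfl⟩ := Set.mem_iUnion.1 hB
    exact dynamics_apply_mem H hβ hμm hV hVg h t hA hφ
  · rintro B hB φ hφ
    obtain ⟨t, A, hA, rfl⟩ := Set.mem_iUnion.1 hB
    rw [star_dynamics H]
    exact dynamics_apply_mem H hβ hμm hV hVg h t (star_mem hA) hφ

end GaugeInvariantVectors

/-! ### The one-dimensional case in coordinates. -/

section SingleMode
variable {𝔥 : Type*} [NormedAddCommGroup 𝔥] [InnerProductSpace ℂ 𝔥] [CompleteSpace 𝔥]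
  {ε : 𝔥 →ₗ.[ℂ] 𝔥} {m β μ : ℝ} {e : 𝔥}

/-- On a line, `ε` is multiplication by a number. -/
theorem exists_energy (H : IsGapped ε m) (he : ‖e‖ = 1) (hspan : ∀ x, ∃ z : ℂ, x = z • e) :
    ∃ E : ℝ, m ≤ E ∧ ∀ f, BddCont m f → boundedFC ε f e = f E • e := by
  have he0 : e ≠ 0 := by rintro rfl; simp at he
  have : Nontrivial 𝔥 := ⟨e, 0, he0⟩
  obtain ⟨z, hz⟩ := hspan (boundedInverse ε e)
  have hT : boundedInverse ε = algebraMap ℂ (𝔥 →L[ℂ] 𝔥) z := by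
    refine ContinuousLinearMap.ext fun x => ?_
    obtain ⟨c, rfl⟩ := hspan x
    rw [map_smul, hz, Algebra.algebraMap_eq_smul_one, smul_apply, one_apply_eq_self, smul_comm]
  have hsp : z ∈ spectrum ℂ (boundedInverse ε) := by
    rw [hT, spectrum.scalar_eq]
    exact Set.mem_singleton z
  obtain ⟨h1, h2, h3⟩ := H.spectrum_le hsp
  have hz0 : z ≠ 0 := by
    rintro rfl
    obtain ⟨y, hy⟩ := H.dense_range.exists_dist_lt e (ε := 1) one_pos
    rw [hT, map_zero, zero_apply, dist_zero_right, he] at hy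
    exact lt_irrefl _ hy
  have hre : 0 < z.re := lt_of_le_of_ne h2 fun h => hz0 (Complex.ext h.symm h1)
  refine ⟨z.re⁻¹, (le_inv_comm₀ H.pos hre).2 h3, fun f hf => ?_⟩
  have h4 := H.apply_inverse hf e
  rw [hz, map_smul, hT, cfc_algebraMap, Algebra.algebraMap_eq_smul_one, smul_apply,
    one_apply_eq_self, mul_smul] at h4
  exact smul_right_injective 𝔥 hz0 h4

/-- The vector `(a e, b e)` of `X`. -/
def modeVec (e : 𝔥) (a b : ℂ) : OneParticle 𝔥 := WithLp.toLp 2 (a • e, b • e)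

theorem exists_eq_modeVec (hspan : ∀ x : 𝔥, ∃ z : ℂ, x = z • e) (x : OneParticle 𝔥) :
    ∃ a b, x = modeVec e a b := by
  obtain ⟨a, ha⟩ := hspan x.fst
  obtain ⟨b, hb⟩ := hspan x.snd
  refine ⟨a, b, ?_⟩
  rw [modeVec, ← ha, ← hb]
  rfl

theorem modeVec_add (a b a' b' : ℂ) :
    modeVec e a b + modeVec e a' b' = modeVec e (a + a') (b + b') := by
  simp only [modeVec, add_smul]
  rfl

theorem inner_modeVec (he : ‖e‖ = 1) (a b a' b' : ℂ) :
    (inner ℂ (modeVec e a b) (modeVec e a' b') : ℂ) = star a * a' + star b * b' := by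
  have h1 : (inner ℂ e e : ℂ) = 1 := by
    rw [← norm_sq_eq_inner, he]; simp
  rw [inner_prod_eq]
  simp only [modeVec, WithLp.toLp_fst, WithLp.toLp_snd, inner_smul_left, inner_smul_right, h1,
    RCLike.star_def]
  ring

theorem continuous_modeVec {Y : Type*} [TopologicalSpace Y] {f g : Y → ℂ} (hf : Continuous f)
    (hg : Continuous g) : Continuous fun y => modeVec e (f y) (g y) := by
  unfold modeVec
  exact (WithLp.prod_continuous_toLp 2 _ _).comp (by fun_prop)

theorem rot_modeVec (w a b : ℂ) : rot w (modeVec e a b) = modeVec e (w * a) (star w * b) := by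
  rw [rot_apply, modeVec, modeVec]
  simp only [WithLp.toLp_fst, WithLp.toLp_snd, smul_smul]

theorem evol_modeVec {E : ℝ} (hE : ∀ f, BddCont m f → boundedFC ε f e = f E • e) (t : ℝ) (a b : ℂ) :
    evol ε μ t (modeVec e a b) = modeVec e (Complex.exp (Complex.I * t * ((E - μ : ℝ) : ℂ)) * a)
      (Complex.exp (Complex.I * t * ((E - -μ : ℝ) : ℂ)) * b) := by
  rw [evol_apply, modeVec, modeVec]
  simp only [WithLp.toLp_fst, WithLp.toLp_snd, map_smul, hE _ bddCont_phase, smul_smul, mul_comm]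

theorem kvec_smul_eq {J : 𝔥 ≃ₗᵢ⋆[ℂ] 𝔥} (hJe : J e = e) (z : ℂ) :
    kvec J (z • e) = modeVec e z (star z) := by
  rw [kvec, modeVec, map_smulₛₗ, hJe]
  rfl

theorem inner_dvec_modeVec (H : IsGapped ε m) (hβ : 0 < β) (hμm : |μ| < m) (he : ‖e‖ = 1) {E : ℝ}
    (hE : ∀ f, BddCont m f → boundedFC ε f e = f E • e) (a b : ℂ) :
    (inner ℂ (dvec ε β μ (modeVec e a b)) (dvec ε β μ (modeVec e a b)) : ℂ) =
      (((1 + 2 * bose β (E - μ)) * Complex.normSq a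
        + (1 + 2 * bose β (E - -μ)) * Complex.normSq b : ℝ) : ℂ) := by
  have h1 : (inner ℂ e e : ℂ) = 1 := by
    rw [← norm_sq_eq_inner, he]; simp
  have hμ' : |-μ| < m := by rwa [abs_neg]
  have h4 : ∀ ν, |ν| < m → BddCont m fun e => ((1 + bose β (e - ν) : ℝ) : ℂ) := by
    intro ν hν
    have := (BddCont.const (m := m) 1).add (bddCont_bose hβ hν)
    simpa using this
  rw [inner_dvec H hβ hμm]
  simp only [modeVec, WithLp.toLp_fst, WithLp.toLp_snd, map_smul, hE _ (bddCont_bose hβ hμm),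
    hE _ (bddCont_bose hβ hμ'), hE _ (h4 μ hμm), hE _ (h4 (-μ) hμ'), inner_smul_left,
    inner_smul_right, h1]
  push_cast
  rw [Complex.normSq_eq_conj_mul_self, Complex.normSq_eq_conj_mul_self]
  ring

theorem vacuum_weyl (x : OneParticle 𝔥) :
    (inner ℂ (expVec (0 : Doubled 𝔥)) (weyl ε β μ x (expVec 0)) : ℂ)
      = Complex.exp (-(inner ℂ (dvec ε β μ x) (dvec ε β μ x)) / 4) := by
  rw [weyl_eq, vacuum_fockWeyl]

/-- Interchange of particles and antiparticles. -/
def swap (x : OneParticle 𝔥) : OneParticle 𝔥 := WithLp.toLp 2 (x.snd, x.fst)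

theorem swap_modeVec (a b : ℂ) : swap (modeVec e a b) = modeVec e b a := rfl

theorem swap_add (x y : OneParticle 𝔥) : swap (x + y) = swap x + swap y := rfl

theorem inner_swap (x y : OneParticle 𝔥) :
    (inner ℂ (swap x) (swap y) : ℂ) = inner ℂ x y := by
  rw [inner_prod_eq, inner_prod_eq, add_comm]
  rfl

end SingleMode

/-! ### Vectors whose overlaps with Weyl vectors are Gaussians of prescribed width. -/

section GaussianVector
variable {𝔥 : Type*} [NormedAddCommGroup 𝔥] [InnerProductSpace ℂ 𝔥] [CompleteSpace 𝔥]
  {ε : 𝔥 →ₗ.[ℂ] 𝔥} {m β μ : ℝ} {e : 𝔥}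

/-- The real parametrization of `X` for a single mode. -/
def realVec (e : 𝔥) (v : Fin 4 → ℝ) : OneParticle 𝔥 :=
  modeVec e (v 0 + Complex.I * v 1) (v 2 + Complex.I * v 3)

theorem continuous_realVec : Continuous (realVec e) :=
  continuous_modeVec (by fun_prop) (by fun_prop)

/-- A centered Gaussian weight on `ℝ⁴`. -/
def gaussWeight (b : Fin 4 → ℝ) (v : Fin 4 → ℝ) : ℂ :=
  Complex.exp (-∑ i, (b i : ℂ) * (v i : ℂ) ^ 2 + ∑ i, (0 : ℂ) * v i)

theorem star_gaussWeight (b v : Fin 4 → ℝ) : (starRingEnd ℂ) (gaussWeight b v) = gaussWeight b v := by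
  rw [gaussWeight, ← Complex.exp_conj]
  simp

/-- The Gaussian superposition of the vectors `W(-y)Ω`. -/
def gaussVec (e : 𝔥) (ε : 𝔥 →ₗ.[ℂ] 𝔥) (β μ : ℝ) (b : Fin 4 → ℝ) : ArakiWoods 𝔥 :=
  ∫ v : Fin 4 → ℝ, gaussWeight b v • weyl ε β μ (-realVec e v) (expVec 0)

theorem inner_gaussVec {b : Fin 4 → ℝ} (hb : ∀ i, 0 < b i) (χ : ArakiWoods 𝔥) :
    (inner ℂ (gaussVec e ε β μ b) χ : ℂ) = ∫ v : Fin 4 → ℝ, gaussWeight b v *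
      inner ℂ (expVec (0 : Doubled 𝔥)) (weyl ε β μ (realVec e v) χ) := by
  have hi : Integrable fun v : Fin 4 → ℝ => gaussWeight b v :=
    GaussianFourier.integrable_cexp_neg_sum_mul_add (b := fun i => (b i : ℂ)) (by simpa using hb) 0
  have hc : Continuous fun v : Fin 4 → ℝ => weyl ε β μ (-realVec e v) (expVec (0 : Doubled 𝔥)) :=
    (continuous_weyl_apply _).comp continuous_realVec.neg
  have hF : Integrable fun v : Fin 4 → ℝ =>
      gaussWeight b v • weyl ε β μ (-realVec e v) (expVec (0 : Doubled 𝔥)) := by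
    refine Integrable.mono hi (hi.aestronglyMeasurable.smul hc.aestronglyMeasurable)
      (Filter.Eventually.of_forall fun v => ?_)
    rw [norm_smul, norm_weyl_apply, norm_vacuum, mul_one]
  rw [← inner_conj_symm, gaussVec, ← integral_inner hF, ← integral_conj]
  congr 1
  funext v
  rw [inner_smul_right, map_mul, star_gaussWeight, inner_conj_symm, ← star_weyl,
    ContinuousLinearMap.star_eq_adjoint, ContinuousLinearMap.adjoint_inner_left]

/-- Superposition with weight `e^{-bv²}` lowers the width `κ` of the Weyl expectation by `(κ² - 1) /
(4b + κ)`; here `b` is solved for so that the new width is `p`. -/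
theorem gaussian_identity {κ p : ℝ} (h1 : 1 < p) (h2 : p < κ) :
    ∃ b : ℝ, 0 < b ∧ 0 < b + κ / 4 ∧ (κ ^ 2 - 1) / (4 * (b + κ / 4)) = κ - p := by
  have h3 : 0 < κ - p := by linarith
  have h4 : 0 < κ ^ 2 - 1 := by nlinarith
  have h5 : (κ * p - 1) / (4 * (κ - p)) + κ / 4 = (κ ^ 2 - 1) / (4 * (κ - p)) := by
    field_simp
    ring
  refine ⟨(κ * p - 1) / (4 * (κ - p)), div_pos (by nlinarith) (by positivity), ?_, ?_⟩
  · rw [h5]; positivity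
  · rw [h5]
    field_simp

/-- The matrix elements of the Weyl operators between the vacuum and suitable vectors are
Gaussians with prescribed widths. -/
theorem exists_gaussian_vector (H : IsGapped ε m) (hβ : 0 < β) (hμm : |μ| < m) (he : ‖e‖ = 1)
    {κ κ' : ℝ} (hκ : ∀ a b : ℂ, (inner ℂ (dvec ε β μ (modeVec e a b))
      (dvec ε β μ (modeVec e a b)) : ℂ) = ((κ * Complex.normSq a + κ' * Complex.normSq b : ℝ) : ℂ))
    {p r : ℝ} (hp : 1 < p) (hpκ : p < κ) (hr : 1 < r) (hrκ : r < κ') :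
    ∃ η : ArakiWoods 𝔥, ∀ a b : ℂ, (inner ℂ η (weyl ε β μ (modeVec e a b) (expVec 0)) : ℂ)
      = Complex.exp ((-(p * Complex.normSq a + r * Complex.normSq b) / 4 : ℝ)) := by
  obtain ⟨b, hb, hB, hb'⟩ := gaussian_identity hp hpκ
  obtain ⟨c, hc, hC, hc'⟩ := gaussian_identity hr hrκ
  set w : Fin 4 → ℝ := ![b, b, c, c] with hw
  have hwpos : ∀ i, 0 < w i := by intro i; fin_cases i <;> simp [hw, hb, hc]
  set B : Fin 4 → ℂ := ![((b + κ / 4 : ℝ) : ℂ), ((b + κ / 4 : ℝ) : ℂ), ((c + κ' / 4 : ℝ) : ℂ),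
    ((c + κ' / 4 : ℝ) : ℂ)] with hBd
  have hBpos : ∀ i, 0 < (B i).re := by
    intro i
    fin_cases i
    · exact hB
    · exact hB
    · exact hC
    · exact hC
  have hB0 : ∀ i, B i ≠ 0 := fun i h0 => by
    have := hBpos i
    rw [h0] at this
    exact lt_irrefl _ this
  -- The value of the pure Gaussian integral, divided out to normalize the vector.
  set D : ℂ := ∏ i, ((Real.pi : ℂ) / B i) ^ (1 / 2 : ℂ) with hD
  have hD0 : D ≠ 0 := by
    refine Finset.prod_ne_zero_iff.2 fun i _ => ?_
    rw [Complex.cpow_ne_zero_iff_of_exponent_ne_zero (by norm_num)]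
    exact div_ne_zero (Complex.ofReal_ne_zero.2 Real.pi_ne_zero) (hB0 i)
  refine ⟨(starRingEnd ℂ) D⁻¹ • gaussVec e ε β μ w, fun x y => ?_⟩
  rw [inner_smul_left, Complex.conj_conj, inner_gaussVec hwpos, inv_mul_eq_iff_eq_mul₀ hD0]
  -- The imaginary coefficients come from the symplectic phase of the product of Weyl operators, the
  -- real ones from the cross terms of the norm.
  set k : Fin 4 → ℂ := ![-(Complex.I / 2) * x.im - κ * x.re / 2, Complex.I / 2 * x.re - κ * x.im / 2,
    -(Complex.I / 2) * y.im - κ' * y.re / 2, Complex.I / 2 * y.re - κ' * y.im / 2] with hk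
  have hint : ∀ v : Fin 4 → ℝ, gaussWeight w v * inner ℂ (expVec (0 : Doubled 𝔥))
      (weyl ε β μ (realVec e v) (weyl ε β μ (modeVec e x y) (expVec 0))) =
      Complex.exp ((-(κ * Complex.normSq x + κ' * Complex.normSq y) / 4 : ℝ)) *
        Complex.exp (-∑ i, B i * (v i : ℂ) ^ 2 + ∑ i, k i * v i) := by
    intro v
    rw [← mul_apply_eq_comp, weyl_mul H hβ hμm, smul_apply, inner_smul_right, vacuum_weyl, realVec,
      modeVec_add, hκ, inner_modeVec he, inner_modeVec he, gaussWeight, ← Complex.exp_add,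
      ← Complex.exp_add, ← Complex.exp_add]
    congr 1
    simp only [hk, hBd, hw, Fin.sum_univ_four, Complex.normSq_apply]
    simp only [RCLike.star_def, Complex.add_re, Complex.add_im, Complex.ofReal_re, Complex.ofReal_im,
      Complex.mul_re, Complex.mul_im, Complex.I_re, Complex.I_im, map_add, map_mul, Complex.conj_ofReal,
      Complex.conj_I]
    have ex : (starRingEnd ℂ) x = x.re - x.im * Complex.I := by
      apply Complex.ext <;> simp
    have ey : (starRingEnd ℂ) y = y.re - y.im * Complex.I := by
      apply Complex.ext <;> simp
    have ex' : x = x.re + x.im * Complex.I := (Complex.re_add_im x).symm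
    have ey' : y = y.re + y.im * Complex.I := (Complex.re_add_im y).symm
    rw [ex, ey]
    generalize hx1 : x.re = x1 at *
    generalize hx2 : x.im = x2 at *
    generalize hy1 : y.re = y1 at *
    generalize hy2 : y.im = y2 at *
    rw [ex', ey']
    simp
    ring
  simp only [hint]
  rw [integral_const_mul, GaussianFourier.integral_cexp_neg_sum_mul_add hBpos, Finset.prod_mul_distrib,
    ← hD, ← Complex.exp_sum, mul_left_comm, ← Complex.exp_add]
  congr 2
  have hb2 : (((κ : ℂ) ^ 2 - 1) / (4 * ((b + κ / 4 : ℝ) : ℂ))) = κ - p := by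
    exact_mod_cast congrArg (fun z : ℝ => (z : ℂ)) hb'
  have hc2 : (((κ' : ℂ) ^ 2 - 1) / (4 * ((c + κ' / 4 : ℝ) : ℂ))) = κ' - r := by
    exact_mod_cast congrArg (fun z : ℝ => (z : ℂ)) hc'
  -- Within each pair of coordinates the mixed terms cancel; the real parts contribute `κ²` and the
  -- imaginary parts `-1`.
  have hs : ∑ i, k i ^ 2 / (4 * B i) = (((κ : ℂ) ^ 2 - 1) / (4 * ((b + κ / 4 : ℝ) : ℂ)))
      * (Complex.normSq x / 4) + (((κ' : ℂ) ^ 2 - 1) / (4 * ((c + κ' / 4 : ℝ) : ℂ)))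
      * (Complex.normSq y / 4) := by
    simp only [hk, hBd, Fin.sum_univ_four, Complex.normSq_apply]
    simp
    have n1 : ((b : ℂ) + κ / 4) ≠ 0 := by exact_mod_cast hB.ne'
    have n2 : ((c : ℂ) + κ' / 4) ≠ 0 := by exact_mod_cast hC.ne'
    generalize (b : ℂ) + κ / 4 = B1 at *
    generalize (c : ℂ) + κ' / 4 = B2 at *
    field_simp
    ring_nf
    simp only [Complex.I_sq]
    ring
  rw [hs, hb2, hc2]
  push_cast
  ring

end GaussianVector

/-! ### Interchange of particles and antiparticles, and failure of generation for a single mode. -/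

section SwapSymmetry
variable {𝔥 : Type*} [NormedAddCommGroup 𝔥] [InnerProductSpace ℂ 𝔥] [CompleteSpace 𝔥]
  {ε : 𝔥 →ₗ.[ℂ] 𝔥} {m β μ : ℝ} {e : 𝔥}

/-- The gauge invariant vectors that do not distinguish `η₁` from the charge conjugate of `η₂`. -/
def swapSpace (ε : 𝔥 →ₗ.[ℂ] 𝔥) (β μ : ℝ) (η₁ η₂ : ArakiWoods 𝔥) : Submodule ℂ (ArakiWoods 𝔥) where
  carrier := {ξ | ξ ∈ gaugeInvariant 𝔥 ∧ ∀ x : OneParticle 𝔥,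
    (inner ℂ η₁ (weyl ε β μ x ξ) : ℂ) = inner ℂ η₂ (weyl ε β μ (swap x) ξ)}
  add_mem' := by
    rintro ξ ζ ⟨h1, h2⟩ ⟨h3, h4⟩
    refine ⟨add_mem h1 h3, fun x => ?_⟩
    rw [map_add, map_add, inner_add_right, inner_add_right, h2, h4]
  zero_mem' := ⟨zero_mem _, fun x => by rw [map_zero, map_zero, inner_zero_right, inner_zero_right]⟩
  smul_mem' := by
    rintro c ξ ⟨h1, h2⟩
    refine ⟨Submodule.smul_mem _ c h1, fun x => ?_⟩
    rw [map_smul, map_smul, inner_smul_right, inner_smul_right, h2]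

theorem mem_swapSpace {η₁ η₂ ξ : ArakiWoods 𝔥} : ξ ∈ swapSpace ε β μ η₁ η₂ ↔
    ξ ∈ gaugeInvariant 𝔥 ∧ ∀ x : OneParticle 𝔥,
      (inner ℂ η₁ (weyl ε β μ x ξ) : ℂ) = inner ℂ η₂ (weyl ε β μ (swap x) ξ) := Iff.rfl

theorem isClosed_swapSpace (η₁ η₂ : ArakiWoods 𝔥) :
    IsClosed (swapSpace ε β μ η₁ η₂ : Set (ArakiWoods 𝔥)) := by
  have : (swapSpace ε β μ η₁ η₂ : Set (ArakiWoods 𝔥)) = (gaugeInvariant 𝔥 : Set (ArakiWoods 𝔥)) ∩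
      ⋂ x, {ξ | (inner ℂ η₁ (weyl ε β μ x ξ) : ℂ) = inner ℂ η₂ (weyl ε β μ (swap x) ξ)} := by
    ext ξ
    simp [mem_swapSpace]
  rw [this]
  refine isClosed_gaugeInvariant.inter (isClosed_iInter fun x => isClosed_eq ?_ ?_)
  · exact continuous_const.inner (weyl ε β μ x).continuous
  · exact continuous_const.inner (weyl ε β μ (swap x)).continuous

theorem integral_circle_inv (f : Circle → ℂ) :
    ∫ θ, f θ⁻¹ ∂circleHaar = ∫ θ, f θ ∂circleHaar :=
  integral_inv_eq_self f circleHaar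

/-- By `hy` the swap maps the gauge orbit of `y` to itself through `θ ↦ z θ⁻¹`, which preserves Haar
measure. It also preserves inner products, so the phases in the Weyl relations agree on both sides.
-/
theorem avgWeyl_mem_swapSpace (H : IsGapped ε m) (hβ : 0 < β) (hμm : |μ| < m)
    {η₁ η₂ ξ : ArakiWoods 𝔥} (hξ : ξ ∈ swapSpace ε β μ η₁ η₂) {y : OneParticle 𝔥} {z : Circle}
    (hy : ∀ θ : Circle, swap (rot θ y) = rot (z * θ⁻¹ : Circle) y) :
    avgWeyl circleHaar ε β μ (orbit y) ξ ∈ swapSpace ε β μ η₁ η₂ := by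
  refine ⟨avgWeyl_mem_gaugeInvariant y hξ.1, fun x => ?_⟩
  have key : ∀ (η : ArakiWoods 𝔥) (x : OneParticle 𝔥),
      (inner ℂ η (weyl ε β μ x (avgWeyl circleHaar ε β μ (orbit y) ξ)) : ℂ)
        = ∫ θ, inner ℂ η (weyl ε β μ x (weyl ε β μ (orbit y θ) ξ)) ∂circleHaar := fun η x =>
    clm_avgWeyl circleHaar (innerSL ℂ η ∘L weyl ε β μ x) (orbit y) ξ
  have hinv : ∀ F : Circle → ℂ, ∫ θ, F (z * θ⁻¹) ∂circleHaar = ∫ θ, F θ ∂circleHaar := fun F =>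
    (integral_circle_inv fun θ => F (z * θ)).trans (integral_circle_mul F z)
  rw [key, key, ← hinv fun θ => inner ℂ η₂ (weyl ε β μ (swap x) (weyl ε β μ (orbit y θ) ξ))]
  congr 1
  funext θ
  rw [orbit_apply, orbit_apply, ← hy, ← mul_apply_eq_comp (weyl ε β μ x),
    ← mul_apply_eq_comp (weyl ε β μ (swap x)), weyl_mul H hβ hμm, weyl_mul H hβ hμm, smul_apply,
    smul_apply, inner_smul_right, inner_smul_right, inner_swap, inner_swap, hξ.2, swap_add]

/-- Once the phase of `c` is absorbed by the gauge average, the evolved components are `e^{it(E-μ)}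
‖c‖` and `e^{it(E+μ)} ‖c‖`. Their quotient is the phase `z = e^{2itμ}` by which the swapped orbit is
displaced. -/
theorem avgWeyl_evol_mem_swapSpace (H : IsGapped ε m) (hβ : 0 < β) (hμm : |μ| < m)
    {J : 𝔥 ≃ₗᵢ⋆[ℂ] 𝔥} (hJe : J e = e) (hspan : ∀ x, ∃ z : ℂ, x = z • e) {E : ℝ}
    (hE : ∀ f, BddCont m f → boundedFC ε f e = f E • e) {η₁ η₂ ξ : ArakiWoods 𝔥}
    (hξ : ξ ∈ swapSpace ε β μ η₁ η₂) (t : ℝ) (u : 𝔥) :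
    avgWeyl circleHaar ε β μ (orbit (evol ε μ t (kvec J u))) ξ ∈ swapSpace ε β μ η₁ η₂ := by
  obtain ⟨c, rfl⟩ := hspan u
  have hc : c • e = ((Circle.exp c.arg : Circle) : ℂ) • ((‖c‖ : ℂ) • e) := by
    rw [smul_smul, Circle.coe_exp, mul_comm, Complex.norm_mul_exp_arg_mul_I]
  rw [hc, ← rot_kvec, evol_rot, avgWeyl_orbit_rot, kvec_smul_eq hJe, evol_modeVec hE]
  refine avgWeyl_mem_swapSpace H hβ hμm hξ (z := Circle.exp (2 * t * μ)) fun θ => ?_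
  have h1 : Complex.exp (Complex.I * t * ((E - -μ : ℝ) : ℂ))
      = Complex.exp ((2 * t * μ : ℝ) * Complex.I) * Complex.exp (Complex.I * t * ((E - μ : ℝ) : ℂ)) := by
    rw [← Complex.exp_add]
    push_cast
    congr 1
    ring
  have h2 : star (Complex.exp ((2 * t * μ : ℝ) * Complex.I))
      * Complex.exp ((2 * t * μ : ℝ) * Complex.I) = 1 := by
    rw [← Circle.coe_exp]
    exact star_circle_mul_self _
  have hs : star (‖c‖ : ℂ) = ‖c‖ := Complex.conj_ofReal _
  rw [rot_modeVec, rot_modeVec, swap_modeVec, hs, Circle.coe_mul, Circle.coe_inv_eq_conj,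
    Circle.coe_exp, h1, star_mul', ← RCLike.star_def, star_star]
  congr 1
  · ring
  · linear_combination (-((θ : ℂ) * Complex.exp (Complex.I * t * ((E - μ : ℝ) : ℂ)) * ‖c‖)) * h2

/-- For a single mode the observables at time zero do not generate the observable algebra. -/
theorem not_isStochasticallyPositive_observable_of_line (H : IsGapped ε m) (hβ : 0 < β)
    (hμm : |μ| < m) {J : 𝔥 ≃ₗᵢ⋆[ℂ] 𝔥} (he : ‖e‖ = 1) (hJe : J e = e)
    (hspan : ∀ x, ∃ z : ℂ, x = z • e) :
    ¬ IsStochasticallyPositive (observableAlgebra ε β μ) (timeZeroObservables J ε β μ)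
      (dynamics ε μ) state β := by
  intro hpos
  obtain ⟨E, hmE, hE⟩ := exists_energy H he hspan
  obtain ⟨hμ1, hμ2⟩ := abs_lt.1 hμm
  have hκ := inner_dvec_modeVec H hβ hμm he hE
  have hρ := bose_pos hβ (e := E - μ) (by linarith)
  have hρ' := bose_pos hβ (e := E - -μ) (by linarith)
  set ρ := bose β (E - μ)
  set ρ' := bose β (E - -μ)
  -- The widths `1 + δ/2` and `1 + δ` lie strictly between `1` and both thermal widths `1 + 2ρ` and
  -- `1 + 2ρ'`, so they can be assigned to the two charges in either order.
  set δ := min ρ ρ' with hδ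
  have hδ0 : 0 < δ := lt_min hρ hρ'
  have hδ1 : δ ≤ ρ := min_le_left _ _
  have hδ2 : δ ≤ ρ' := min_le_right _ _
  obtain ⟨η₁, h1⟩ := exists_gaussian_vector H hβ hμm he hκ (p := 1 + δ / 2) (r := 1 + δ)
    (by linarith) (by linarith) (by linarith) (by linarith)
  obtain ⟨η₂, h2⟩ := exists_gaussian_vector H hβ hμm he hκ (p := 1 + δ) (r := 1 + δ / 2)
    (by linarith) (by linarith) (by linarith) (by linarith)
  have hΩ : expVec (0 : Doubled 𝔥) ∈ swapSpace ε β μ η₁ η₂ := by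
    refine ⟨gaugeGroup_vacuum, fun x => ?_⟩
    obtain ⟨a, b, rfl⟩ := exists_eq_modeVec hspan x
    rw [swap_modeVec, h1, h2, add_comm]
  -- The vector `(e, 0)` is purely of one charge, so its gauge average is an observable without the
  -- swap symmetry. Applied to `Ω` and tested at `x = 0`, membership would force `e^{-(1 + δ/2)/4} =
  -- e^{-(1 + δ)/4}`.
  have hT := avgWeyl_orbit_mem_observable (ε := ε) (β := β) (μ := μ) (modeVec e 1 0)
  rw [← hpos.generates] at hT
  have h3 := (generated_apply_mem H hβ hμm (isClosed_swapSpace η₁ η₂) (fun ξ hξ => hξ.1)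
    (fun t u ξ hξ => avgWeyl_evol_mem_swapSpace H hβ hμm hJe hspan hE hξ t u) hT hΩ).2 0
  have hs0 : swap (0 : OneParticle 𝔥) = 0 := rfl
  rw [hs0, weyl_zero, one_apply_eq_self, inner_avgWeyl, inner_avgWeyl] at h3
  have h4 : ∀ θ : Circle, orbit (modeVec e 1 0) θ = modeVec e θ 0 := by
    intro θ
    rw [orbit_apply, rot_modeVec, mul_one, mul_zero]
  simp only [h4, h1, h2, Circle.normSq_coe, map_zero, integral_const, probReal_univ, one_smul] at h3
  rw [← Complex.ofReal_exp, ← Complex.ofReal_exp] at h3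
  have h5 := Real.exp_injective (Complex.ofReal_injective h3)
  linarith

/-- The vector `w + J w` is real; if it vanishes, then `J w = -w` and `i w` is real. -/
theorem exists_real_unit_vector [Nontrivial 𝔥] {J : 𝔥 ≃ₗᵢ⋆[ℂ] 𝔥} (hJ : ∀ x, J (J x) = x) :
    ∃ e : 𝔥, ‖e‖ = 1 ∧ J e = e := by
  obtain ⟨w, hw⟩ := exists_ne (0 : 𝔥)
  obtain ⟨f, hf, hJf⟩ : ∃ f : 𝔥, f ≠ 0 ∧ J f = f := by
    by_cases h : w + J w = 0
    · refine ⟨Complex.I • w, smul_ne_zero Complex.I_ne_zero hw, ?_⟩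
      rw [map_smulₛₗ, Complex.conj_I, ← neg_eq_of_add_eq_zero_right h, neg_smul_neg]
    · exact ⟨w + J w, h, by rw [map_add, hJ, add_comm]⟩
  refine ⟨((‖f‖⁻¹ : ℝ) : ℂ) • f, ?_, ?_⟩
  · rw [norm_smul, Complex.norm_real, norm_inv, norm_norm, inv_mul_cancel₀ (norm_ne_zero_iff.2 hf)]
  · rw [map_smulₛₗ, Complex.conj_ofReal, hJf]

/-- A space without nonzero vectors orthogonal to some `w` is a line. -/
theorem exists_smul_of_orthogonal_eq_zero {w : 𝔥}
    (h : ∀ q : 𝔥, inner ℂ q w = (0 : ℂ) → q = 0) (e : 𝔥) (he : e ≠ 0) (x : 𝔥) :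
    ∃ z : ℂ, x = z • e := by
  have h1 : (inner ℂ e w : ℂ) ≠ 0 := fun h0 => he (h e h0)
  refine ⟨(starRingEnd ℂ) (inner ℂ x w / inner ℂ e w), sub_eq_zero.1 (h _ ?_)⟩
  rw [inner_sub_left, inner_smul_left, Complex.conj_conj, div_mul_cancel₀ _ h1, sub_self]

end SwapSymmetry

end KleinGordon

end

theorem lemma8p8 {𝔥 : Type*} [NormedAddCommGroup 𝔥] [InnerProductSpace ℂ 𝔥] [CompleteSpace 𝔥]
    [Nontrivial 𝔥]
    (conj : 𝔥 ≃ₗᵢ⋆[ℂ] 𝔥) (hconj : ∀ x, conj (conj x) = x)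
    (ε : 𝔥 →ₗ.[ℂ] 𝔥) (hε : IsSelfAdjoint ε)
    (hreal : ∀ x : ε.domain, ∃ hx : conj (x : 𝔥) ∈ ε.domain, ε ⟨conj (x : 𝔥), hx⟩ = conj (ε x))
    (m : ℝ) (hm : 0 < m)
    (hεm : ∀ x : ε.domain, m * ‖(x : 𝔥)‖ ^ 2 ≤ (inner ℂ (x : 𝔥) (ε x)).re)
    (β : ℝ) (hβ : 0 < β) (μ : ℝ) (hμ : μ ≠ 0) (hμm : |μ| < m) :
    ¬ KleinGordon.IsStochasticallyPositive
        (KleinGordon.fieldAlgebra ε β μ) (KleinGordon.timeZeroAlgebra conj ε β μ)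
        (KleinGordon.dynamics ε μ) KleinGordon.state β ∧
      ¬ KleinGordon.IsStochasticallyPositive
        (KleinGordon.observableAlgebra ε β μ) (KleinGordon.timeZeroObservables conj ε β μ)
        (KleinGordon.dynamics ε μ) KleinGordon.state β := by
  have H : KleinGordon.IsGapped ε m := ⟨hε, hm, hεm⟩
  refine ⟨KleinGordon.not_isStochasticallyPositive_field H hβ hμm hμ hconj hreal, ?_⟩
  -- This condition says that the dimension is at least two, where nonnegativity of the Green's
  -- functions fails. Otherwise the space is a line, spanned by a real unit vector, and the
  -- generation axiom fails.
  by_cases hdim : ∀ w : 𝔥, w ≠ 0 → ∃ q : 𝔥, q ≠ 0 ∧ inner ℂ q w = (0 : ℂ)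
  · exact KleinGordon.not_isStochasticallyPositive_observable H hβ hμm hμ hconj hreal hdim
  · push Not at hdim
    obtain ⟨w, hw, hw'⟩ := hdim
    obtain ⟨e, he, hJe⟩ := KleinGordon.exists_real_unit_vector hconj
    have he0 : e ≠ 0 := by
      rintro rfl
      simp at he
    exact KleinGordon.not_isStochasticallyPositive_observable_of_line H hβ hμm he hJe
      (KleinGordon.exists_smul_of_orthogonal_eq_zero (w := w)
        (fun q hq => not_not.1 fun hq0 => hw' q hq0 hq) e he0)
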